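/- There is an absolute constant $C$ such that the following holds. Let $(\Omega,\mathcal F,P)$ be a probability space. For each $n$ let $(\mathcal I_n,\mathbf d)$ be an index set with $n$ elements and a metric $\mathbf d:\mathcal I_n\times\mathcal I_n\to[0,\infty]$ such that $\mathbf d(i,j)\ge 1$ for $i\ne j$. Let $X_i$ ($i\in\mathcal I_n$) be random vectors in $\mathbb R^d$, and let $H=H_n:\mathbb R^d\times\mathbb R^d\to\mathbb R$ be measurable and symmetric with $\mathbb E\,H(X_i,\tilde X_j)^2<\infty$ for all $i\ne j$ in $\mathcal I_n$, where $\tilde X_j$ denotes a copy of $X_j$ independent of $X_i$ (dependence of the $X_i$ and of the quantities below on $n$ is suppressed). *Mixing.* For $\sigma$-algebras $\mathcal F_1,\mathcal F_2\subset\mathcal F$ let $\beta(\mathcal F_1,\mathcal F_2)=\sup\frac12\sum_{a,b}|P(A_a\cap B_b)-P(A_a)P(B_b)|$, the supremum being over finite partitions $(A_a)\subset\mathcal F_1$, $(B_b)\subset\mathcal F_2$ of $\Omega$. Assume that $\beta_n(n_1,n_2,m)$ are numbers (where $n_1,n_2\in\mathbb N\cup\{\infty\}$ and $m\ge 0$ is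 real) with $$\beta\big(\sigma(X_i:i\in\mathcal J_1),\,\sigma(X_i:i\in\mathcal J_2)\big)\le\beta_n(n_1,n_2,m)$$ whenever $\mathcal J_1,\mathcal J_2\subset\mathcal I_n$, $|\mathcal J_1|\le n_1$, $|\mathcal J_2|\le n_2$ and $\mathbf d(i_1,i_2)\ge m$ for all $i_1\in\mathcal J_1$, $i_2\in\mathcal J_2$. Put $\beta(n_1,n_2,m)=\sup_n\beta_n(n_1,n_2,m)$. *Sparsity.* Two entries of a vector of indices $\mathbf i=(i_1,\dots,i_q)\in\mathcal I_n^q$ are $m$-connected in $\mathbf i$ if they are joined by a chain of entries of $\mathbf i$ with consecutive distances at most $m$. The $m$-profile of $\mathbf i$ is the list, in descending order, of the numbers of positions of $\mathbf i$ occupied by each $m$-connectedness class, and $\tau^m_{q_1,\dots,q_s}$ is the number of $\mathbf i\in\mathcal I_n^{q_1+\dots+q_s}$ with $m$-profile $(q_1,\dots,q_s)$. *Moments.* With $\|\cdot\|_p$ the $L^p$-norm, put $\mathbf H_p=\sup_{i\ne j}\max\{\|H(X_i,X_j)\|_p,\|H(X_i,\tilde X_j)\|_p\}\in[0,\infty]$.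 *Hoeffding projection.* For $n\ge 2$ put $\hat H_k(x)=\mathbb E\,H(X_k,x)$, $\theta_{ik}=\mathbb E\,\hat H_k(X_i)$, $h_i=(n-1)^{-1}\sum_{k\ne i}(\hat H_k(X_i)-\theta_{ik})$, $\nu_n^2=\operatorname{Var}\big(\sum_i h_i\big)$, $S_n=\sum_{i\ne k}H(X_i,X_k)$, and, if $\nu_n>0$, $$W_n=\frac{S_n-\sum_{i\ne k}\theta_{ik}}{2(n-1)\nu_n}.$$ Then, for every $\delta>0$, every real $m\ge1$ and every $n\ge 2$ with $\nu_n>0$, the Wasserstein distance $\mathbf d_W(W_n,Z)=\sup_g|\mathbb E g(W_n)-\mathbb E g(Z)|$ (supremum over $1$-Lipschitz $g:\mathbb R\to\mathbb R$; read as $\infty$ if $W_n$ is not integrable) between $W_n$ and $Z\sim N(0,1)$ satisfies $$\begin{aligned}\mathbf d_W(W_n,Z)\le C\Big\{&\frac1{\nu_n n}\Big[(\tau_4^m+\tau_{2,2}^m)\mathbf H_2^2+n^4\mathbf H_{2+\delta}^2\,\beta(1,3,m)^{\frac{\delta}{2+\delta}}\Big]^{\frac12}+\frac n{\nu_n}\mathbf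 H_{1+\delta}\,\beta(1,\infty,m)^{\frac{\delta}{1+\delta}}\\&+\frac{n^2}{\nu_n^2}\mathbf H_{2+\delta}^2\,\beta(1,1,m)^{\frac{\delta}{2+\delta}}+\frac{\tau_2^m}{\nu_n^2}\mathbf H_{2+\delta}^2\,\beta(2,\infty,m)^{\frac{\delta}{2+\delta}}+\frac{\tau_3^m}{\nu_n^3}\mathbf H_3^3\Big\},\end{aligned}$$ where the right-hand side is computed in $[0,\infty]$ with $0\cdot\infty=0$. -/

import Mathlib

open MeasureTheory ProbabilityTheory
open scoped ENNReal NNReal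

noncomputable section

namespace UStat

/-! ### Beta-mixing -/

/-- `A` is a finite partition of `Ω` into sets of the sigma-algebra `F` (empty cells are harmless). -/
def IsFinitePartition {Ω : Type*} (F : MeasurableSpace Ω) {a : ℕ} (A : Fin a → Set Ω) : Prop :=
  (∀ i, MeasurableSet[F] (A i)) ∧ Pairwise (fun i j => Disjoint (A i) (A j)) ∧
    ⋃ i, A i = Set.univ

/-- The beta-mixing coefficient of two sigma-algebras: the supremum over finite partitions of
`1/2 * ∑ i, ∑ j, |P (A i ∩ B j) - P (A i) * P (B j)|`. -/
def betaCoeff {Ω : Type*} [MeasurableSpace Ω] (P : Measure Ω) (F₁ F₂ : MeasurableSpace Ω) :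
    ℝ≥0∞ :=
  ⨆ (a : ℕ) (b : ℕ) (A : Fin a → Set Ω) (B : Fin b → Set Ω)
    (_ : IsFinitePartition F₁ A) (_ : IsFinitePartition F₂ B),
    ENNReal.ofReal ((1 / 2) * ∑ i, ∑ j, |P.real (A i ∩ B j) - P.real (A i) * P.real (B j)|)

/-- The sigma-algebra generated by `X i`, `i ∈ J`. -/
abbrev sigmaGen {I Ω E : Type*} [MeasurableSpace E] (X : I → Ω → E) (J : Finset I) :
    MeasurableSpace Ω :=
  ⨆ i ∈ J, MeasurableSpace.comap (X i) inferInstance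

/-- The distance between two groups of nodes. -/
def groupDist {I : Type*} [EMetricSpace I] (J₁ J₂ : Finset I) : ℝ≥0∞ :=
  ⨅ i₁ ∈ J₁, ⨅ i₂ ∈ J₂, edist i₁ i₂

/-- Pairs of groups of nodes, of sizes at most `n₁` and `n₂`, at distance at least `m`. -/
def separatedPairs (I : Type*) [EMetricSpace I] (n₁ n₂ : ℕ∞) (m : ℝ≥0) :
    Set (Finset I × Finset I) :=
  {J | (J.1.card : ℕ∞) ≤ n₁ ∧ (J.2.card : ℕ∞) ≤ n₂ ∧ (m : ℝ≥0∞) ≤ groupDist J.1 J.2}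

/-- The sample `X` is beta-mixing with coefficients (at most) `β`. -/
def IsBetaMixing {I Ω E : Type*} [EMetricSpace I] [MeasurableSpace Ω] [MeasurableSpace E]
    (P : Measure Ω) (X : I → Ω → E) (β : ℕ∞ → ℕ∞ → ℝ≥0 → ℝ≥0∞) : Prop :=
  ∀ (n₁ n₂ : ℕ∞) (m : ℝ≥0),
    ⨆ J ∈ separatedPairs I n₁ n₂ m, betaCoeff P (sigmaGen X J.1) (sigmaGen X J.2) ≤ β n₁ n₂ m

/-! ### Sparsity of the index space -/

/-- `x` and `y` are `m`-connected in the vector of indices `v`: there is a chain from `x` to `y`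
of entries of `v`, with steps of length at most `m`. -/
def MConnected {I : Type*} [EMetricSpace I] (m : ℝ≥0) {q : ℕ} (v : Fin q → I) : I → I → Prop :=
  Relation.TransGen
    (fun x y => x ∈ Set.range v ∧ y ∈ Set.range v ∧ edist x y ≤ (m : ℝ≥0∞))

open Classical in
/-- For each class `Q` of entries of `v` modulo `m`-connectedness, the set of positions
`j` with `v j ∈ Q`. -/
def positionClasses {I : Type*} [EMetricSpace I] (m : ℝ≥0) {q : ℕ} (v : Fin q → I) :
    Finset (Finset (Fin q)) :=
  Finset.univ.image fun j => Finset.univ.filter fun j' => MConnected m v (v j) (v j')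

/-- The `m`-profile of `v`: the numbers of occurrences in `v` of the classes of
`m`-connectedness (counting duplicates), in descending order. -/
def profile {I : Type*} [EMetricSpace I] (m : ℝ≥0) {q : ℕ} (v : Fin q → I) : List ℕ :=
  ((positionClasses m v).val.map Finset.card).sort (· ≥ ·)

/-- The number of index vectors of length `q₁ + ⋯ + q_S` with `m`-profile `L = [q₁, …, q_S]`. -/
def tau (I : Type*) [EMetricSpace I] (m : ℝ≥0) (L : List ℕ) : ℕ :=
  Nat.card {v : Fin L.sum → I // profile m v = L}

/-! ### The U-statistic and its projection -/

open Classical in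
/-- The U-statistic `∑_{i ≠ k} H (X i, X k)`. -/
def uStat {I Ω E : Type*} [Fintype I] (X : I → Ω → E) (H : E → E → ℝ) (ω : Ω) : ℝ :=
  ∑ i, ∑ k with k ≠ i, H (X i ω) (X k ω)

/-- `x ↦ E H (X k, x)`. -/
def Hhat {I Ω E : Type*} [MeasurableSpace Ω] (P : Measure Ω) (X : I → Ω → E) (H : E → E → ℝ)
    (k : I) (x : E) : ℝ :=
  ∫ ω, H (X k ω) x ∂P

/-- `θ i k = E Hhat_k (X i)`. -/
def theta {I Ω E : Type*} [MeasurableSpace Ω] (P : Measure Ω) (X : I → Ω → E) (H : E → E → ℝ)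
    (i k : I) : ℝ :=
  ∫ ω, Hhat P X H k (X i ω) ∂P

open Classical in
/-- `h i = (n - 1)⁻¹ ∑_{k ≠ i} (Hhat_k (X i) - θ i k)`, with `n` the sample size. -/
def proj {I Ω E : Type*} [Fintype I] [MeasurableSpace Ω] (P : Measure Ω) (X : I → Ω → E)
    (H : E → E → ℝ) (i : I) (ω : Ω) : ℝ :=
  ((Fintype.card I : ℝ) - 1)⁻¹ * ∑ k with k ≠ i, (Hhat P X H k (X i ω) - theta P X H i k)

/-- `ν`, the standard deviation of `∑ i, h i`. -/
def nu {I Ω E : Type*} [Fintype I] [MeasurableSpace Ω] (P : Measure Ω) (X : I → Ω → E)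
    (H : E → E → ℝ) : ℝ :=
  √(variance (fun ω => ∑ i, proj P X H i ω) P)

open Classical in
/-- The normalised U-statistic `(S - ∑_{i ≠ k} θ i k) / (2 (n - 1) ν)`. -/
def normalized {I Ω E : Type*} [Fintype I] [MeasurableSpace Ω] (P : Measure Ω)
    (X : I → Ω → E) (H : E → E → ℝ) (ω : Ω) : ℝ :=
  (uStat X H ω - ∑ i, ∑ k with k ≠ i, theta P X H i k) /
    (2 * ((Fintype.card I : ℝ) - 1) * nu P X H)

/-- The supremum over `i ≠ j` of the `L^p` norms of `H (X i, X j)` and of `H (X i, X' j)`, where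
`X' j` is a copy of `X j` independent of `X i` (so that `(X i, X' j)` has the product law). -/
def momentSup {I Ω E : Type*} [MeasurableSpace Ω] [MeasurableSpace E] (P : Measure Ω)
    (X : I → Ω → E) (H : E → E → ℝ) (p : ℝ) : ℝ≥0∞ :=
  ⨆ (i : I) (j : I) (_ : i ≠ j),
    max (eLpNorm (fun ω => H (X i ω) (X j ω)) (ENNReal.ofReal p) P)
      (eLpNorm (fun z : E × E => H z.1 z.2) (ENNReal.ofReal p) ((P.map (X i)).prod (P.map (X j))))

/-- The kernel is (measurable,) symmetric, and `E H (X i, X' j) ^ 2 < ∞` for `i ≠ j`, with `X' j` a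
copy of `X j` independent of `X i`. -/
def IsKernel {I Ω E : Type*} [MeasurableSpace Ω] [MeasurableSpace E] (P : Measure Ω)
    (X : I → Ω → E) (H : E → E → ℝ) : Prop :=
  Measurable (fun z : E × E => H z.1 z.2) ∧ (∀ x y, H x y = H y x) ∧
    ∀ i j, i ≠ j → MemLp (fun z : E × E => H z.1 z.2) 2 ((P.map (X i)).prod (P.map (X j)))

open Classical in
/-- The Wasserstein distance of two probability measures on `ℝ`, as a supremum over `1`-Lipschitz
test functions; it is `∞` unless both measures have a first moment, in which case all the
integrals below exist. -/
def wasserstein (μ₁ μ₂ : Measure ℝ) : ℝ≥0∞ :=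
  if Integrable (fun x : ℝ => x) μ₁ ∧ Integrable (fun x : ℝ => x) μ₂ then
    ⨆ (g : ℝ → ℝ) (_ : LipschitzWith 1 g), ENNReal.ofReal |∫ x, g x ∂μ₁ - ∫ x, g x ∂μ₂|
  else ⊤

end UStat

end

open UStat

noncomputable section

namespace UStat

/-! ### The Stein equation for Lipschitz test functions -/

/-! The Hoeffding decomposition writes the normalised statistic as `∑ i, stdProj P X H i` plus a
multiple, at most `1 / (ν n)`, of the degenerate sum `degSum`. A `1`-Lipschitz test function sees
the second summand only through its `L¹` norm, so the two parts are treated separately.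

The degenerate part is small in `L²`. Its second moment is a sum over quadruples `(i, k, j, l)`. If
one of the four indices is farther than `m` from the other three, beta-mixing allows the
corresponding variable to be replaced by an independent copy, and integrating that copy out gives
zero because `degKernel` is completely degenerate; the error is governed by `β 1 3 m`. If no index
is isolated, every class of `m`-connectedness occupies at least two positions, so the profile is
`[4]` or `[2, 2]`: such quadruples are counted by `tau`, and Cauchy–Schwarz suffices for each. This
is `eLpNorm_degSum_le`.

The linear part is a sum of centred variables with unit variance that are almost independent of what
lies outside balls of radius `m`. Stein's method applies: `exists_stein_solution` gives a bounded
solution with bounded, Lipschitz derivative, with a constant independent of the test function, and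
`abs_integral_sub_gaussian_le` turns local dependence into a bound with four errors. Three of them
measure the failure of exact independence (one variable against the far sum, two far variables, a
near pair against the far sum) and correspond to the `β 1 ⊤`, `β 1 1` and `β 2 ⊤` terms. The fourth
is a third-moment Taylor error weighted by the number of near triples, hence `τ [3]`.

Both parts rest on one decoupling inequality, `ofReal_abs_integral_sub_prod_le`: the beta
coefficient bounds the total variation distance between a joint law and the product of its marginals
up to a factor, and Hölder's inequality with respect to the variation measure passes to unbounded
functions with a `p`-th moment, at the cost of the exponent `1 - 1 / p`. -/

/-- The unnormalised standard Gaussian density. -/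
def gaussWeight (t : ℝ) : ℝ := Real.exp (-(t ^ 2) / 2)

lemma gaussWeight_pos (t : ℝ) : 0 < gaussWeight t := Real.exp_pos _

lemma gaussWeight_neg (t : ℝ) : gaussWeight (-t) = gaussWeight t := by simp [gaussWeight]

lemma hasDerivAt_gaussWeight (t : ℝ) : HasDerivAt gaussWeight (-t * gaussWeight t) t := by
  have h : HasDerivAt (fun t : ℝ => -(t ^ 2) / 2) (-t) t := by
    exact ((hasDerivAt_pow 2 t).neg.div_const 2).congr_deriv (by norm_num; ring)
  exact h.exp.congr_deriv (by simp only [gaussWeight]; ring)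

lemma integrable_pow_mul_gaussWeight (k : ℕ) : Integrable fun t => t ^ k * gaussWeight t := by
  have := integrable_rpow_mul_exp_neg_mul_sq (b := 1 / 2) (by norm_num) (s := k)
    (by have : (0 : ℝ) ≤ k := k.cast_nonneg
        linarith)
  refine this.congr (Filter.Eventually.of_forall fun t => ?_)
  simp only [Real.rpow_natCast, gaussWeight]
  congr 2; ring

lemma integrable_gaussWeight : Integrable gaussWeight := by
  simpa using integrable_pow_mul_gaussWeight 0

lemma continuous_gaussWeight : Continuous gaussWeight := by
  unfold gaussWeight; fun_prop

lemma integrable_lipschitz_mul_gaussWeight {g : ℝ → ℝ} (hg : LipschitzWith 1 g) :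
    Integrable fun t => g t * gaussWeight t := by
  have h1 : Integrable fun t => (|g 0| * gaussWeight t + |t ^ 1 * gaussWeight t|) :=
    (integrable_gaussWeight.const_mul _).add (integrable_pow_mul_gaussWeight 1).abs
  refine h1.mono' (hg.continuous.mul continuous_gaussWeight).aestronglyMeasurable
    (Filter.Eventually.of_forall fun t => ?_)
  have h2 : |g t - g 0| ≤ |t| := by simpa [Real.dist_eq] using hg.dist_le_mul t 0
  have h3 : |g t| ≤ |g 0| + |t| := by
    have := abs_sub_abs_le_abs_sub (g t) (g 0); linarith
  have hw := gaussWeight_pos t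
  rw [Real.norm_eq_abs, abs_mul, abs_mul, abs_of_pos hw, pow_one]
  nlinarith

lemma integral_Ioi_id_mul_gaussWeight (x : ℝ) :
    ∫ t in Set.Ioi x, t * gaussWeight t = gaussWeight x := by
  have hd : ∀ t ∈ Set.Ici x, HasDerivAt (fun t => -gaussWeight t) (t * gaussWeight t) t := by
    intro t _
    exact (hasDerivAt_gaussWeight t).neg.congr_deriv (by ring)
  have hi : IntegrableOn (fun t => t * gaussWeight t) (Set.Ioi x) := by
    simpa using (integrable_pow_mul_gaussWeight 1).integrableOn
  have ht := tendsto_zero_of_hasDerivAt_of_integrableOn_Ioi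
    (fun t ht => hd t (Set.Ioi_subset_Ici_self ht)) hi integrable_gaussWeight.neg.integrableOn
  rw [integral_Ioi_of_hasDerivAt_of_tendsto' hd hi ht]
  ring

lemma integral_Ioi_sq_mul_gaussWeight (x : ℝ) :
    ∫ t in Set.Ioi x, t ^ 2 * gaussWeight t =
      x * gaussWeight x + ∫ t in Set.Ioi x, gaussWeight t := by
  have hd : ∀ t ∈ Set.Ici x, HasDerivAt (fun t => -(t * gaussWeight t))
      (t ^ 2 * gaussWeight t - gaussWeight t) t := by
    intro t _
    exact ((hasDerivAt_id t).mul (hasDerivAt_gaussWeight t)).neg.congr_deriv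
      (by simp only [id]; ring)
  have hi2 : IntegrableOn (fun t => t ^ 2 * gaussWeight t) (Set.Ioi x) :=
    (integrable_pow_mul_gaussWeight 2).integrableOn
  have hi0 : IntegrableOn gaussWeight (Set.Ioi x) := integrable_gaussWeight.integrableOn
  have hi1 : Integrable (fun t => -(t * gaussWeight t)) := by
    simpa using (integrable_pow_mul_gaussWeight 1).neg
  have ht := tendsto_zero_of_hasDerivAt_of_integrableOn_Ioi
    (fun t ht => hd t (Set.Ioi_subset_Ici_self ht)) (hi2.sub hi0) hi1.integrableOn
  have h := integral_Ioi_of_hasDerivAt_of_tendsto' hd (hi2.sub hi0) ht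
  rw [integral_sub hi2 hi0] at h
  linarith

/-- The Gaussian upper tail. -/
def gaussTail (x : ℝ) : ℝ := ∫ t in Set.Ioi x, gaussWeight t

lemma gaussTail_nonneg (x : ℝ) : 0 ≤ gaussTail x :=
  integral_nonneg fun t => (gaussWeight_pos t).le

lemma integral_Ioi_sub_mul_gaussWeight (x : ℝ) :
    ∫ t in Set.Ioi x, (t - x) * gaussWeight t = gaussWeight x - x * gaussTail x := by
  have h1 : IntegrableOn (fun t => t * gaussWeight t) (Set.Ioi x) := by
    simpa using (integrable_pow_mul_gaussWeight 1).integrableOn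
  have h0 : IntegrableOn (fun t => x * gaussWeight t) (Set.Ioi x) :=
    (integrable_gaussWeight.const_mul x).integrableOn
  simp_rw [sub_mul]
  rw [integral_sub h1 h0, integral_Ioi_id_mul_gaussWeight, integral_const_mul]
  rfl

/-- The difference of the two sides is the first moment of the tail about `x`, which is nonnegative.
-/
lemma mul_gaussTail_le (x : ℝ) : x * gaussTail x ≤ gaussWeight x := by
  have h : 0 ≤ ∫ t in Set.Ioi x, (t - x) * gaussWeight t :=
    setIntegral_nonneg measurableSet_Ioi fun t ht =>
      mul_nonneg (sub_nonneg.2 (le_of_lt ht)) (gaussWeight_pos t).le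
  rw [integral_Ioi_sub_mul_gaussWeight] at h
  linarith

/-- The difference of the two sides is the second moment of the tail about `x`. This Mills-ratio
bound supplies the factor `1 / (1 + x ^ 2)` that keeps the derivative of the Stein solution, even
multiplied by `x`, bounded. -/
lemma mul_gaussWeight_le (x : ℝ) : x * gaussWeight x ≤ (1 + x ^ 2) * gaussTail x := by
  have h : 0 ≤ ∫ t in Set.Ioi x, (t - x) ^ 2 * gaussWeight t :=
    integral_nonneg fun t => mul_nonneg (sq_nonneg _) (gaussWeight_pos t).le
  have h2 : IntegrableOn (fun t => t ^ 2 * gaussWeight t) (Set.Ioi x) :=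
    (integrable_pow_mul_gaussWeight 2).integrableOn
  have h1 : IntegrableOn (fun t => (2 * x) * (t * gaussWeight t)) (Set.Ioi x) := by
    simpa using ((integrable_pow_mul_gaussWeight 1).const_mul (2 * x)).integrableOn
  have h0 : IntegrableOn (fun t => x ^ 2 * gaussWeight t) (Set.Ioi x) :=
    (integrable_gaussWeight.const_mul _).integrableOn
  have e : ∀ t, (t - x) ^ 2 * gaussWeight t =
      t ^ 2 * gaussWeight t - (2 * x) * (t * gaussWeight t) + x ^ 2 * gaussWeight t := by
    intro t; ring
  simp_rw [e] at h
  have h21 := integral_add (h2.sub h1) h0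
  simp only [Pi.sub_apply] at h21
  rw [h21, integral_sub h2 h1, integral_const_mul, integral_const_mul,
    integral_Ioi_sq_mul_gaussWeight, integral_Ioi_id_mul_gaussWeight] at h
  change 0 ≤ x * gaussWeight x + gaussTail x - 2 * x * gaussWeight x + x ^ 2 * gaussTail x at h
  linarith

/-- A bound for the Mills ratio on the positive half-line. -/
def millsBound : ℝ := 1 + (∫ t, gaussWeight t) * Real.exp (1 / 2)

lemma integral_gaussWeight_nonneg : 0 ≤ ∫ t, gaussWeight t :=
  integral_nonneg fun t => (gaussWeight_pos t).le

lemma millsBound_nonneg : 0 ≤ millsBound := by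
  have := mul_nonneg integral_gaussWeight_nonneg (Real.exp_pos (1 / 2)).le
  unfold millsBound; linarith

/-- For `x ≥ 1` this follows from `mul_gaussTail_le`; on `[0, 1]` the tail is at most the total mass
while the weight stays above `exp (-1 / 2)`. The two summands of `millsBound` serve these two cases.
-/
lemma gaussTail_le {x : ℝ} (hx : 0 ≤ x) : gaussTail x ≤ millsBound * gaussWeight x := by
  have hI := integral_gaussWeight_nonneg
  have hw := gaussWeight_pos x
  have ht := gaussTail_nonneg x
  rcases le_total 1 x with h | h
  · have := mul_gaussTail_le x
    have h2 : 0 ≤ (∫ t, gaussWeight t) * Real.exp (1 / 2) * gaussWeight x := by positivity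
    unfold millsBound
    nlinarith
  · have h1 : gaussTail x ≤ ∫ t, gaussWeight t :=
      setIntegral_le_integral integrable_gaussWeight
        (Filter.Eventually.of_forall fun t => (gaussWeight_pos t).le)
    have h2 : 1 ≤ Real.exp (1 / 2) * gaussWeight x := by
      unfold gaussWeight
      rw [← Real.exp_add]
      apply Real.one_le_exp
      nlinarith
    unfold millsBound
    nlinarith

/-- The solution of the Stein equation for a test function that is centred under the Gaussian law. -/
def steinSol (g : ℝ → ℝ) (x : ℝ) : ℝ :=
  -(∫ t in Set.Ioi x, g t * gaussWeight t) / gaussWeight x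

lemma hasDerivAt_integral_Ioi {h : ℝ → ℝ} (hc : Continuous h) (hi : Integrable h) (x : ℝ) :
    HasDerivAt (fun x => ∫ t in Set.Ioi x, h t) (-h x) x := by
  have e : (fun x => ∫ t in Set.Ioi x, h t) =
      fun x => (∫ t in Set.Ioi 0, h t) - ∫ t in (0 : ℝ)..x, h t := by
    funext y
    rw [← intervalIntegral.integral_Ioi_sub_Ioi' hi.integrableOn hi.integrableOn]
    ring
  rw [e]
  have := (intervalIntegral.integral_hasDerivAt_right (hc.intervalIntegrable 0 x)
    hc.stronglyMeasurable.stronglyMeasurableAtFilter hc.continuousAt).const_sub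
    (∫ t in Set.Ioi 0, h t)
  exact this

lemma hasDerivAt_steinSol {g : ℝ → ℝ} (hg : LipschitzWith 1 g) (x : ℝ) :
    HasDerivAt (steinSol g) (x * steinSol g x + g x) x := by
  have h1 := hasDerivAt_integral_Ioi (hg.continuous.mul continuous_gaussWeight)
    (integrable_lipschitz_mul_gaussWeight hg) x
  have hw := (gaussWeight_pos x).ne'
  have := (h1.neg).div (hasDerivAt_gaussWeight x) hw
  refine this.congr_deriv ?_
  simp only [steinSol, Pi.neg_apply, Pi.mul_apply]
  field_simp
  ring

/-- Freezing `g` at the endpoint `x` costs at most `t - x` under the integral, by the Lipschitz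
property. -/
lemma abs_integral_sub_le {g : ℝ → ℝ} (hg : LipschitzWith 1 g) (x : ℝ) :
    |(∫ t in Set.Ioi x, g t * gaussWeight t) - g x * gaussTail x| ≤
      gaussWeight x - x * gaussTail x := by
  have h1 : IntegrableOn (fun t => g t * gaussWeight t) (Set.Ioi x) :=
    (integrable_lipschitz_mul_gaussWeight hg).integrableOn
  have h0 : IntegrableOn (fun t => g x * gaussWeight t) (Set.Ioi x) :=
    (integrable_gaussWeight.const_mul _).integrableOn
  have h2 : IntegrableOn (fun t => (t - x) * gaussWeight t) (Set.Ioi x) := by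
    have a : IntegrableOn (fun t => t * gaussWeight t) (Set.Ioi x) := by
      simpa using (integrable_pow_mul_gaussWeight 1).integrableOn
    simp_rw [sub_mul]
    exact a.sub (integrable_gaussWeight.const_mul x).integrableOn
  rw [← integral_Ioi_sub_mul_gaussWeight, gaussTail, ← integral_const_mul, ← integral_sub h1 h0,
    ← Real.norm_eq_abs]
  refine norm_integral_le_of_norm_le h2 ?_
  filter_upwards [ae_restrict_mem measurableSet_Ioi] with t ht
  have hL : |g t - g x| ≤ |t - x| := by simpa [Real.dist_eq] using hg.dist_le_mul t x
  rw [abs_of_pos (sub_pos.2 (Set.mem_Ioi.1 ht))] at hL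
  rw [← sub_mul, Real.norm_eq_abs, abs_mul, abs_of_pos (gaussWeight_pos t)]
  exact mul_le_mul_of_nonneg_right hL (gaussWeight_pos t).le

/-- The second quantity is the derivative of the solution. The third, `x` times that derivative, is
what a Lipschitz bound for the derivative requires. On this half-line centredness of `g` plays no
role, since the solution is defined through the upper tail. -/
lemma steinSol_bounds_of_nonneg {g : ℝ → ℝ} (hg : LipschitzWith 1 g) {x : ℝ} (hx : 0 ≤ x) :
    |steinSol g x| ≤ 1 + |g 0| * millsBound ∧ |x * steinSol g x + g x| ≤ 1 + |g 0| ∧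
      |x * (x * steinSol g x + g x)| ≤ 2 + |g 0| := by
  set c := |g 0| with hc
  set w := gaussWeight x
  set a := gaussTail x
  set G := ∫ t in Set.Ioi x, g t * gaussWeight t with hG
  have hw : 0 < w := gaussWeight_pos x
  have ha : 0 ≤ a := gaussTail_nonneg x
  have h1 : |G - g x * a| ≤ w - x * a := abs_integral_sub_le hg x
  have h2 : x * w ≤ (1 + x ^ 2) * a := mul_gaussWeight_le x
  have h3 : a ≤ millsBound * w := gaussTail_le hx
  have h4 : 0 ≤ w - x * a := (abs_nonneg _).trans h1
  have hc0 : 0 ≤ c := abs_nonneg _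
  have hgx : |g x| ≤ c + x := by
    have hL : |g x - g 0| ≤ |x| := by simpa [Real.dist_eq] using hg.dist_le_mul x 0
    rw [abs_of_nonneg hx] at hL
    have := abs_sub_abs_le_abs_sub (g x) (g 0); linarith
  -- This is `h2` multiplied by `x ≥ 0` and rearranged.
  have h5 : (1 + x ^ 2) * (w - x * a) ≤ w := by nlinarith
  have hf : steinSol g x = -G / w := rfl
  have key : |x * steinSol g x + g x| ≤ (2 * x + c) * (w - x * a) / w := by
    -- Subtracting and adding `x * g x * a` exposes the cancellation: both terms of the numerator
    -- are now of order `w - x * a`.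
    have e : x * steinSol g x + g x = (g x * (w - x * a) - x * (G - g x * a)) / w := by
      rw [hf]; field_simp; ring
    rw [e, abs_div, abs_of_pos hw]
    gcongr
    calc _ ≤ |g x * (w - x * a)| + |x * (G - g x * a)| := abs_sub _ _
      _ = |g x| * (w - x * a) + x * |G - g x * a| := by
        rw [abs_mul, abs_mul, abs_of_nonneg h4, abs_of_nonneg hx]
      _ ≤ (c + x) * (w - x * a) + x * (w - x * a) := by gcongr
      _ = _ := by ring
  have key2 : (w - x * a) / w ≤ 1 / (1 + x ^ 2) := by
    rw [div_le_div_iff₀ hw (by positivity)]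
    linarith
  have key3 : |x * steinSol g x + g x| ≤ (2 * x + c) / (1 + x ^ 2) := by
    calc _ ≤ (2 * x + c) * ((w - x * a) / w) := by rw [← mul_div_assoc]; exact key
      _ ≤ (2 * x + c) * (1 / (1 + x ^ 2)) := by gcongr
      _ = _ := by ring
  refine ⟨?_, ?_, ?_⟩
  · rw [hf, abs_div, abs_neg, abs_of_pos hw, div_le_iff₀ hw]
    have : |G| ≤ |G - g x * a| + |g x * a| := by
      have := abs_add_le (G - g x * a) (g x * a); simpa using this
    rw [abs_mul, abs_of_nonneg ha] at this
    nlinarith [mul_le_mul_of_nonneg_right hgx ha, mul_le_mul_of_nonneg_left h3 hc0]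
  · refine key3.trans ?_
    rw [div_le_iff₀ (by positivity)]
    nlinarith [sq_nonneg (x - 1), mul_nonneg hc0 (sq_nonneg x)]
  · rw [abs_mul, abs_of_nonneg hx]
    calc _ ≤ x * ((2 * x + c) / (1 + x ^ 2)) := by gcongr
      _ = (2 * x ^ 2 + c * x) / (1 + x ^ 2) := by ring
      _ ≤ 2 + c := by
        rw [div_le_iff₀ (by positivity)]
        nlinarith [mul_nonneg hc0 (sq_nonneg (x - 1)), mul_nonneg hc0 (sq_nonneg x)]

lemma lipschitzWith_comp_neg {g : ℝ → ℝ} (hg : LipschitzWith 1 g) :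
    LipschitzWith 1 fun t => g (-t) := by
  refine LipschitzWith.of_dist_le_mul fun x y => ?_
  simpa [dist_neg_neg] using hg.dist_le_mul (-x) (-y)

/-- Centredness makes the integrals of `g * gaussWeight` over the two sides of `x` opposite, so
reflection exchanges the half-lines up to sign. The bounds on the positive half-line therefore carry
over to the negative one. -/
lemma steinSol_comp_neg {g : ℝ → ℝ} (hg : LipschitzWith 1 g)
    (h0 : ∫ t, g t * gaussWeight t = 0) (x : ℝ) :
    steinSol (fun t => g (-t)) (-x) = -steinSol g x := by
  have h1 : ∫ t in Set.Ioi (-x), g (-t) * gaussWeight t = ∫ t in Set.Iic x, g t * gaussWeight t := by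
    have := integral_comp_neg_Ioi (-x) fun t => g t * gaussWeight t
    simpa [gaussWeight_neg] using this
  have h2 := intervalIntegral.integral_Iic_add_Ioi (b := x)
    (integrable_lipschitz_mul_gaussWeight hg).integrableOn
    (integrable_lipschitz_mul_gaussWeight hg).integrableOn
  rw [h0] at h2
  unfold steinSol
  rw [h1, gaussWeight_neg, show ∫ t in Set.Iic x, g t * gaussWeight t =
    -∫ t in Set.Ioi x, g t * gaussWeight t by linarith]
  ring

lemma steinSol_bounds {g : ℝ → ℝ} (hg : LipschitzWith 1 g) (h0 : ∫ t, g t * gaussWeight t = 0)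
    (x : ℝ) :
    |steinSol g x| ≤ 1 + |g 0| * millsBound ∧ |x * steinSol g x + g x| ≤ 1 + |g 0| ∧
      |x * (x * steinSol g x + g x)| ≤ 2 + |g 0| := by
  rcases le_total 0 x with hx | hx
  · exact steinSol_bounds_of_nonneg hg hx
  · have := steinSol_bounds_of_nonneg (lipschitzWith_comp_neg hg) (neg_nonneg.2 hx)
    rw [steinSol_comp_neg hg h0] at this
    simpa [abs_neg, neg_mul_neg, abs_mul] using this

lemma integral_gaussianReal_eq (g : ℝ → ℝ) :
    ∫ x, g x ∂(gaussianReal 0 1) = (√(2 * Real.pi))⁻¹ * ∫ t, g t * gaussWeight t := by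
  rw [integral_gaussianReal_eq_integral_smul one_ne_zero, ← integral_const_mul]
  congr 1; funext t
  simp only [gaussianPDFReal, gaussWeight, smul_eq_mul]
  simp
  ring

lemma integrable_lipschitz_gaussianReal {g : ℝ → ℝ} (hg : LipschitzWith 1 g) :
    Integrable g (gaussianReal 0 1) := by
  have hid : Integrable (fun x : ℝ => x) (gaussianReal 0 1) :=
    (memLp_id_gaussianReal 1).integrable (by simp)
  refine ((integrable_const |g 0|).add hid.abs).mono' hg.continuous.aestronglyMeasurable
    (Filter.Eventually.of_forall fun t => ?_)
  have h2 : |g t - g 0| ≤ |t| := by simpa [Real.dist_eq] using hg.dist_le_mul t 0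
  have := abs_sub_abs_le_abs_sub (g t) (g 0)
  simp only [Real.norm_eq_abs, Pi.add_apply]
  linarith

/-- The first absolute moment of the standard normal law. -/
def gaussAbsMoment : ℝ := ∫ x, |x| ∂(gaussianReal 0 1)

lemma gaussAbsMoment_nonneg : 0 ≤ gaussAbsMoment := integral_nonneg fun _ => abs_nonneg _

/-- A bound for the solution of the Stein equation and its first two derivatives. -/
def steinConst : ℝ := 4 + gaussAbsMoment + gaussAbsMoment * millsBound

lemma steinConst_pos : 0 < steinConst := by
  have := gaussAbsMoment_nonneg
  have := mul_nonneg gaussAbsMoment_nonneg millsBound_nonneg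
  unfold steinConst; linarith

/-- The solution is built for the centred function `k = g - E g(Z)`. Its value at `0` is at most `E
|Z|`, and this makes the constant independent of `g`. -/
theorem exists_stein_solution {g : ℝ → ℝ} (hg : LipschitzWith 1 g) :
    ∃ f f' : ℝ → ℝ, (∀ x, HasDerivAt f (f' x) x) ∧ (∀ x, |f x| ≤ steinConst) ∧
      (∀ x, |f' x| ≤ steinConst) ∧ (∀ x y, |f' x - f' y| ≤ steinConst * |x - y|) ∧
      ∀ x, f' x - x * f x = g x - ∫ y, g y ∂(gaussianReal 0 1) := by
  set e := ∫ y, g y ∂(gaussianReal 0 1) with he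
  set k : ℝ → ℝ := fun t => g t - e with hk
  have hkL : LipschitzWith 1 k := LipschitzWith.of_dist_le_mul fun x y => by
    simpa [hk] using hg.dist_le_mul x y
  have hk0 : ∫ t, k t * gaussWeight t = 0 := by
    have h1 : ∫ x, k x ∂(gaussianReal 0 1) = 0 := by
      simp only [hk]
      rw [integral_sub (integrable_lipschitz_gaussianReal hg) (integrable_const _)]
      simp [he]
    rw [integral_gaussianReal_eq] at h1
    have : (√(2 * Real.pi))⁻¹ ≠ 0 := by positivity
    exact (mul_eq_zero.1 h1).resolve_left this
  have hkc : |k 0| ≤ gaussAbsMoment := by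
    have hid : Integrable (fun x : ℝ => x) (gaussianReal 0 1) :=
      (memLp_id_gaussianReal 1).integrable (by simp)
    have h1 : k 0 = ∫ x, (g 0 - g x) ∂(gaussianReal 0 1) := by
      rw [integral_sub (integrable_const _) (integrable_lipschitz_gaussianReal hg)]
      simp [hk, he]
    rw [h1, ← Real.norm_eq_abs]
    refine norm_integral_le_of_norm_le hid.abs (Filter.Eventually.of_forall fun t => ?_)
    simpa [Real.dist_eq] using hg.dist_le_mul 0 t
  have hA := millsBound_nonneg
  have hM := gaussAbsMoment_nonneg
  have hAM := mul_nonneg hM hA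
  have hb := fun x => steinSol_bounds hkL hk0 x
  have hkA : |k 0| * millsBound ≤ gaussAbsMoment * millsBound :=
    mul_le_mul_of_nonneg_right hkc hA
  have hd := fun x => hasDerivAt_steinSol hkL x
  refine ⟨steinSol k, fun x => x * steinSol k x + k x, hd, fun x => ?_, fun x => ?_,
    fun x y => ?_, fun x => ?_⟩
  · have := (hb x).1
    unfold steinConst; linarith
  · have := (hb x).2.1
    unfold steinConst; linarith
  -- Since `k` need not be differentiable, only the summand `x * steinSol k x` of the derivative is
  -- differentiated; `k` itself is `1`-Lipschitz and accounts for the missing `1` in `steinConst -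
  -- 1`.
  · have hd2 : ∀ x ∈ (Set.univ : Set ℝ), HasDerivWithinAt (fun x => x * steinSol k x)
        (1 * steinSol k x + x * (x * steinSol k x + k x)) Set.univ x := fun x _ =>
      ((hasDerivAt_id x).mul (hd x)).hasDerivWithinAt
    have hbd : ∀ x ∈ (Set.univ : Set ℝ),
        ‖1 * steinSol k x + x * (x * steinSol k x + k x)‖ ≤ steinConst - 1 := by
      intro x _
      rw [Real.norm_eq_abs, one_mul]
      refine (abs_add_le _ _).trans ?_
      have h1 := (hb x).1
      have h2 := (hb x).2.2
      unfold steinConst; linarith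
    have h1 := convex_univ.norm_image_sub_le_of_norm_hasDerivWithin_le hd2 hbd
      (Set.mem_univ y) (Set.mem_univ x)
    have h2 : |k x - k y| ≤ |x - y| := by simpa [Real.dist_eq] using hkL.dist_le_mul x y
    rw [Real.norm_eq_abs, Real.norm_eq_abs] at h1
    calc _ = |(x * steinSol k x - y * steinSol k y) + (k x - k y)| := by congr 1; ring
      _ ≤ _ := abs_add_le _ _
      _ ≤ (steinConst - 1) * |x - y| + |x - y| := add_le_add h1 h2
      _ = _ := by ring
  · simp [hk]

/-! ### Stein's method for locally dependent sums -/

section LocalStein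

variable {Ω : Type*} [MeasurableSpace Ω] {P : Measure Ω}

/-- A first-order Taylor estimate without a second derivative: the mean value inequality for `t ↦ f
t - f' x * t`, whose derivative is at most `K * |x - y|` on the segment. The expansion point is `x`,
later the full sum, so that the same `f' (T ω)` appears for every summand. -/
lemma abs_sub_sub_deriv_mul_le {f f' : ℝ → ℝ} {K : ℝ} (hd : ∀ x, HasDerivAt f (f' x) x)
    (hL : ∀ x y, |f' x - f' y| ≤ K * |x - y|) (x y : ℝ) :
    |f x - f y - f' x * (x - y)| ≤ K * (x - y) ^ 2 := by
  have hK : 0 ≤ K := by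
    have := (abs_nonneg _).trans (hL 1 0)
    simpa using this
  have hd2 : ∀ t ∈ Set.uIcc x y, HasDerivWithinAt (fun t => f t - f' x * t)
      (f' t - f' x * 1) (Set.uIcc x y) t := fun t _ =>
    ((hd t).sub ((hasDerivAt_id t).const_mul (f' x))).hasDerivWithinAt
  have hb : ∀ t ∈ Set.uIcc x y, ‖f' t - f' x * 1‖ ≤ K * |x - y| := by
    intro t ht
    rw [mul_one, Real.norm_eq_abs]
    refine (hL t x).trans (mul_le_mul_of_nonneg_left ?_ hK)
    rw [abs_sub_comm x y]
    exact Set.abs_sub_left_of_mem_uIcc ht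
  have h := (convex_uIcc x y).norm_image_sub_le_of_norm_hasDerivWithin_le hd2 hb
    Set.right_mem_uIcc Set.left_mem_uIcc
  rw [Real.norm_eq_abs, Real.norm_eq_abs] at h
  calc _ = |f x - f' x * x - (f y - f' x * y)| := by congr 1; ring
    _ ≤ _ := h
    _ = K * (|x - y| * |x - y|) := by ring
    _ = _ := by rw [abs_mul_abs_self]; ring

lemma integrable_mul_bounded {U V : Ω → ℝ} {K : ℝ} (hU : Integrable U P)
    (hV : AEStronglyMeasurable V P) (hb : ∀ ω, |V ω| ≤ K) : Integrable (fun ω => U ω * V ω) P :=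
  hU.mul_bdd hV (Filter.Eventually.of_forall hb)

lemma abs_integral_taylor_le {f f' : ℝ → ℝ} {K : ℝ} (hd : ∀ x, HasDerivAt f (f' x) x)
    (hf : ∀ x, |f x| ≤ K) (hf' : ∀ x, |f' x| ≤ K) (hL : ∀ x y, |f' x - f' y| ≤ K * |x - y|)
    (hm' : Measurable f') {U T S : Ω → ℝ} (hT : AEMeasurable T P) (hS : AEMeasurable S P)
    (hU : Integrable U P) (hUD : Integrable (fun ω => U ω * (T ω - S ω)) P)
    (hUD2 : Integrable (fun ω => |U ω| * (T ω - S ω) ^ 2) P) :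
    |∫ ω, U ω * f (T ω) ∂P - ∫ ω, U ω * f (S ω) ∂P - ∫ ω, U ω * (T ω - S ω) * f' (T ω) ∂P| ≤
      K * ∫ ω, |U ω| * (T ω - S ω) ^ 2 ∂P := by
  have hmf : Measurable f :=
    (continuous_iff_continuousAt.2 fun x => (hd x).continuousAt).measurable
  have i1 : Integrable (fun ω => U ω * f (T ω)) P := integrable_mul_bounded hU
    (hmf.comp_aemeasurable hT).aestronglyMeasurable fun ω => hf _
  have i2 : Integrable (fun ω => U ω * f (S ω)) P := integrable_mul_bounded hU
    (hmf.comp_aemeasurable hS).aestronglyMeasurable fun ω => hf _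
  have i3 : Integrable (fun ω => U ω * (T ω - S ω) * f' (T ω)) P := integrable_mul_bounded hUD
    (hm'.comp_aemeasurable hT).aestronglyMeasurable fun ω => hf' _
  have i12 : Integrable (fun ω => U ω * f (T ω) - U ω * f (S ω)) P := i1.sub i2
  rw [← integral_sub i1 i2, ← integral_sub i12 i3, ← Real.norm_eq_abs, ← integral_const_mul]
  refine norm_integral_le_of_norm_le (hUD2.const_mul K) (Filter.Eventually.of_forall fun ω => ?_)
  have h := abs_sub_sub_deriv_mul_le hd hL (T ω) (S ω)
  rw [Real.norm_eq_abs]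
  calc _ = |U ω * (f (T ω) - f (S ω) - f' (T ω) * (T ω - S ω))| := by congr 1; ring
    _ = |U ω| * |f (T ω) - f (S ω) - f' (T ω) * (T ω - S ω)| := abs_mul _ _
    _ ≤ |U ω| * (K * (T ω - S ω) ^ 2) := by gcongr
    _ = _ := by ring

/-- Used to pass from the full sum `T` to the far sum `S` in the covariance of a near pair with the
derivative of the Stein solution; only the Lipschitz property of `h` makes the error small. -/
lemma abs_cov_sub_cov_le {h : ℝ → ℝ} {K : ℝ} [IsProbabilityMeasure P] (hb : ∀ x, |h x| ≤ K)
    (hL : ∀ x y, |h x - h y| ≤ K * |x - y|) (hm : Measurable h) {U T S : Ω → ℝ}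
    (hT : AEMeasurable T P) (hS : AEMeasurable S P)
    (hU : Integrable U P) (hD : Integrable (fun ω => T ω - S ω) P)
    (hUD : Integrable (fun ω => U ω * (T ω - S ω)) P) :
    |(∫ ω, U ω * h (T ω) ∂P - (∫ ω, U ω ∂P) * ∫ ω, h (T ω) ∂P) -
        (∫ ω, U ω * h (S ω) ∂P - (∫ ω, U ω ∂P) * ∫ ω, h (S ω) ∂P)| ≤
      K * (∫ ω, |U ω * (T ω - S ω)| ∂P + (∫ ω, |U ω| ∂P) * ∫ ω, |T ω - S ω| ∂P) := by
  have hK : 0 ≤ K := (abs_nonneg _).trans (hb 0)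
  have mT := (hm.comp_aemeasurable hT).aestronglyMeasurable (μ := P)
  have mS := (hm.comp_aemeasurable hS).aestronglyMeasurable (μ := P)
  have i1 : Integrable (fun ω => U ω * h (T ω)) P := integrable_mul_bounded hU mT fun ω => hb _
  have i2 : Integrable (fun ω => U ω * h (S ω)) P := integrable_mul_bounded hU mS fun ω => hb _
  have i3 : Integrable (fun ω => h (T ω)) P :=
    (integrable_const K).mono' mT (Filter.Eventually.of_forall fun ω => hb _)
  have i4 : Integrable (fun ω => h (S ω)) P :=
    (integrable_const K).mono' mS (Filter.Eventually.of_forall fun ω => hb _)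
  have e : (∫ ω, U ω * h (T ω) ∂P - (∫ ω, U ω ∂P) * ∫ ω, h (T ω) ∂P) -
        (∫ ω, U ω * h (S ω) ∂P - (∫ ω, U ω ∂P) * ∫ ω, h (S ω) ∂P) =
      (∫ ω, (U ω * h (T ω) - U ω * h (S ω)) ∂P) -
        (∫ ω, U ω ∂P) * ∫ ω, (h (T ω) - h (S ω)) ∂P := by
    rw [integral_sub i1 i2, integral_sub i3 i4]; ring
  have a1 : |∫ ω, (U ω * h (T ω) - U ω * h (S ω)) ∂P| ≤ K * ∫ ω, |U ω * (T ω - S ω)| ∂P := by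
    rw [← Real.norm_eq_abs, ← integral_const_mul]
    refine norm_integral_le_of_norm_le (hUD.abs.const_mul K)
      (Filter.Eventually.of_forall fun ω => ?_)
    rw [← mul_sub, Real.norm_eq_abs, abs_mul, abs_mul]
    calc _ ≤ |U ω| * (K * |T ω - S ω|) := by gcongr; exact hL _ _
      _ = _ := by ring
  have a2 : |∫ ω, (h (T ω) - h (S ω)) ∂P| ≤ K * ∫ ω, |T ω - S ω| ∂P := by
    rw [← Real.norm_eq_abs, ← integral_const_mul]
    exact norm_integral_le_of_norm_le (hD.abs.const_mul K)
      (Filter.Eventually.of_forall fun ω => hL _ _)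
  have a3 : |∫ ω, U ω ∂P| ≤ ∫ ω, |U ω| ∂P := abs_integral_le_integral_abs
  have a4 : 0 ≤ ∫ ω, |U ω| ∂P := integral_nonneg fun ω => abs_nonneg _
  rw [e]
  refine (abs_sub _ _).trans ?_
  rw [abs_mul, mul_add]
  refine add_le_add a1 ?_
  calc _ ≤ (∫ ω, |U ω| ∂P) * (K * ∫ ω, |T ω - S ω| ∂P) :=
        mul_le_mul a3 a2 (abs_nonneg _) a4
    _ = _ := by ring

lemma mul_mul_le_cubes {a b c : ℝ} (ha : 0 ≤ a) (hb : 0 ≤ b) (hc : 0 ≤ c) :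
    a * b * c ≤ (a ^ 3 + b ^ 3 + c ^ 3) / 3 := by
  have : 0 ≤ (a + b + c) * ((a - b) ^ 2 + (b - c) ^ 2 + (a - c) ^ 2) := by positivity
  linarith [show (a + b + c) * ((a - b) ^ 2 + (b - c) ^ 2 + (a - c) ^ 2) =
    2 * (a ^ 3 + b ^ 3 + c ^ 3 - 3 * (a * b * c)) by ring]

lemma integrable_abs_cube {U : Ω → ℝ} (hU : MemLp U 3 P) : Integrable (fun ω => |U ω| ^ 3) P := by
  have := hU.integrable_norm_pow (p := 3) (by norm_num)
  simpa using this

/-- As the three third moments share the bound `s`, the arithmetic–geometric mean inequality loses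
nothing against Hölder. -/
lemma integral_abs_mul_mul_le {U V W : Ω → ℝ} {s : ℝ} (hU : MemLp U 3 P) (hV : MemLp V 3 P)
    (hW : MemLp W 3 P) (hsU : ∫ ω, |U ω| ^ 3 ∂P ≤ s) (hsV : ∫ ω, |V ω| ^ 3 ∂P ≤ s)
    (hsW : ∫ ω, |W ω| ^ 3 ∂P ≤ s) :
    Integrable (fun ω => U ω * V ω * W ω) P ∧ ∫ ω, |U ω * V ω * W ω| ∂P ≤ s := by
  have i1 := integrable_abs_cube hU
  have i2 := integrable_abs_cube hV
  have i3 := integrable_abs_cube hW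
  have i12 : Integrable (fun ω => |U ω| ^ 3 + |V ω| ^ 3) P := i1.add i2
  have i : Integrable (fun ω => (|U ω| ^ 3 + |V ω| ^ 3 + |W ω| ^ 3) / 3) P :=
    (i12.add i3).div_const 3
  have hle : ∀ ω, |U ω * V ω * W ω| ≤ (|U ω| ^ 3 + |V ω| ^ 3 + |W ω| ^ 3) / 3 := fun ω => by
    rw [abs_mul, abs_mul]
    exact mul_mul_le_cubes (abs_nonneg _) (abs_nonneg _) (abs_nonneg _)
  have hi : Integrable (fun ω => U ω * V ω * W ω) P :=
    i.mono' ((hU.1.mul hV.1).mul hW.1) (Filter.Eventually.of_forall hle)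
  refine ⟨hi, ?_⟩
  calc _ ≤ ∫ ω, (|U ω| ^ 3 + |V ω| ^ 3 + |W ω| ^ 3) / 3 ∂P := integral_mono hi.abs i hle
    _ = (∫ ω, |U ω| ^ 3 ∂P + ∫ ω, |V ω| ^ 3 ∂P + ∫ ω, |W ω| ^ 3 ∂P) / 3 := by
      rw [integral_div, integral_add i12 i3, integral_add i1 i2]
    _ ≤ s := by linarith

lemma memLp_three_const [IsProbabilityMeasure P] {s : ℝ} (hs : 0 < s) :
    MemLp (fun _ : Ω => s) 3 P ∧ ∫ _, |s| ^ 3 ∂P ≤ s ^ 3 :=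
  ⟨memLp_const s, by simp [abs_of_pos hs]⟩

/-- The triple-product bound with the constant function `s` as third factor, divided by `s`. -/
lemma integral_abs_mul_le [IsProbabilityMeasure P] {U V : Ω → ℝ} {s : ℝ} (hs : 0 < s)
    (hU : MemLp U 3 P) (hV : MemLp V 3 P) (hsU : ∫ ω, |U ω| ^ 3 ∂P ≤ s ^ 3)
    (hsV : ∫ ω, |V ω| ^ 3 ∂P ≤ s ^ 3) :
    Integrable (fun ω => U ω * V ω) P ∧ ∫ ω, |U ω * V ω| ∂P ≤ s ^ 2 := by
  obtain ⟨hi, hle⟩ := integral_abs_mul_mul_le hU hV (memLp_three_const hs).1 hsU hsV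
    (memLp_three_const hs).2
  refine ⟨?_, ?_⟩
  · have := hi.mul_const s⁻¹
    refine this.congr (Filter.Eventually.of_forall fun ω => ?_)
    simp only; field_simp
  · simp_rw [abs_mul _ s, abs_of_pos hs] at hle
    rw [integral_mul_const] at hle
    exact le_of_mul_le_mul_right (by linarith [pow_succ s 2]) hs

lemma integral_abs_le [IsProbabilityMeasure P] {U : Ω → ℝ} {s : ℝ} (hs : 0 < s)
    (hU : MemLp U 3 P) (hsU : ∫ ω, |U ω| ^ 3 ∂P ≤ s ^ 3) : ∫ ω, |U ω| ∂P ≤ s := by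
  obtain ⟨-, hle⟩ := integral_abs_mul_le hs hU (memLp_three_const hs).1 hsU
    (memLp_three_const hs).2
  simp_rw [abs_mul _ s, abs_of_pos hs] at hle
  rw [integral_mul_const] at hle
  exact le_of_mul_le_mul_right (by linarith [sq s]) hs

variable {I : Type*}

lemma abs_mul_sq_sum_le {J : Finset I} (u : ℝ) (x : I → ℝ) :
    |u| * (∑ j ∈ J, x j) ^ 2 ≤ ∑ j ∈ J, ∑ k ∈ J, |u * x j * x k| := by
  rw [sq, Finset.sum_mul_sum, Finset.mul_sum]
  simp_rw [Finset.mul_sum]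
  refine Finset.sum_le_sum fun j _ => Finset.sum_le_sum fun k _ => ?_
  rw [mul_assoc, abs_mul]
  gcongr
  exact le_abs_self _

lemma integral_abs_mul_sq_sum_le [IsProbabilityMeasure P] {ξ : I → Ω → ℝ} {s : ℝ}
    (hmem : ∀ i, MemLp (ξ i) 3 P) (hs3 : ∀ i, ∫ ω, |ξ i ω| ^ 3 ∂P ≤ s ^ 3) (i : I)
    (J : Finset I) :
    Integrable (fun ω => |ξ i ω| * (∑ j ∈ J, ξ j ω) ^ 2) P ∧
      ∫ ω, |ξ i ω| * (∑ j ∈ J, ξ j ω) ^ 2 ∂P ≤ (J.card : ℝ) ^ 2 * s ^ 3 := by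
  have ht := fun j k => integral_abs_mul_mul_le (hmem i) (hmem j) (hmem k) (hs3 i) (hs3 j) (hs3 k)
  have hI : Integrable (fun ω => ∑ j ∈ J, ∑ k ∈ J, |ξ i ω * ξ j ω * ξ k ω|) P :=
    integrable_finsetSum _ fun j _ => integrable_finsetSum _ fun k _ => (ht j k).1.abs
  have hle := fun ω => abs_mul_sq_sum_le (J := J) (ξ i ω) fun j => ξ j ω
  have hm : AEStronglyMeasurable (fun ω => |ξ i ω| * (∑ j ∈ J, ξ j ω) ^ 2) P := by
    have h1 : AEStronglyMeasurable (fun ω => ∑ j ∈ J, ξ j ω) P :=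
      (memLp_finsetSum J fun j _ => hmem j).1
    exact (hmem i).1.norm.mul (h1.pow 2)
  have hi : Integrable (fun ω => |ξ i ω| * (∑ j ∈ J, ξ j ω) ^ 2) P := by
    refine hI.mono' hm (Filter.Eventually.of_forall fun ω => ?_)
    rw [Real.norm_eq_abs, abs_of_nonneg (by positivity)]
    exact hle ω
  refine ⟨hi, (integral_mono hi hI hle).trans ?_⟩
  rw [integral_finsetSum _ fun j _ => integrable_finsetSum _ fun k _ => (ht j k).1.abs]
  calc _ ≤ ∑ j ∈ J, ∑ k ∈ J, s ^ 3 := by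
        refine Finset.sum_le_sum fun j _ => ?_
        rw [integral_finsetSum _ fun k _ => (ht j k).1.abs]
        exact Finset.sum_le_sum fun k _ => (ht j k).2
    _ = _ := by simp; ring

variable [Fintype I] [DecidableEq I]

/-- The leave-out step of Stein's method: `f` of the full sum is expanded around the full sum
towards the sum over `Jᶜ`. The value at the far sum is nearly uncorrelated with `ξ i` by `h1`, the
linear term is the displayed sum over `J`, and the quadratic error costs `J.card ^ 2` third moments.
-/
lemma abs_integral_mul_sub_sum_le [IsProbabilityMeasure P] {ξ : I → Ω → ℝ} {s b K : ℝ}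
    (hs : 0 < s) (hK : 0 < K)
    (hmem : ∀ i, MemLp (ξ i) 3 P) (hs3 : ∀ i, ∫ ω, |ξ i ω| ^ 3 ∂P ≤ s ^ 3) (i : I)
    (J : Finset I)
    (h1 : ∀ f : ℝ → ℝ, Measurable f → (∀ x, |f x| ≤ 1) →
      |∫ ω, ξ i ω * f (∑ j ∈ Jᶜ, ξ j ω) ∂P| ≤ b)
    {f f' : ℝ → ℝ} (hd : ∀ x, HasDerivAt f (f' x) x)
    (hf : ∀ x, |f x| ≤ K) (hf' : ∀ x, |f' x| ≤ K) (hL : ∀ x y, |f' x - f' y| ≤ K * |x - y|)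
    (hm' : Measurable f') :
    |∫ ω, ξ i ω * f (∑ j, ξ j ω) ∂P -
      ∑ j ∈ J, ∫ ω, ξ i ω * ξ j ω * f' (∑ j, ξ j ω) ∂P| ≤
      K * (b + (J.card : ℝ) ^ 2 * s ^ 3) := by
  have hD : ∀ ω, ∑ j, ξ j ω - ∑ j ∈ Jᶜ, ξ j ω = ∑ j ∈ J, ξ j ω := fun ω => by
    rw [← Finset.sum_add_sum_compl J]; ring
  have hp : ∀ i j, Integrable (fun ω => ξ i ω * ξ j ω) P := fun i j =>
    (integral_abs_mul_le hs (hmem i) (hmem j) (hs3 i) (hs3 j)).1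
  have hTm : AEMeasurable (fun ω => ∑ j, ξ j ω) P :=
    (memLp_finsetSum Finset.univ fun j _ => hmem j).1.aemeasurable
  have hSm : AEMeasurable (fun ω => ∑ j ∈ Jᶜ, ξ j ω) P :=
    (memLp_finsetSum _ fun j _ => hmem j).1.aemeasurable
  obtain ⟨q1, q2⟩ := integral_abs_mul_sq_sum_le hmem hs3 i J
  have hUD : Integrable (fun ω => ξ i ω * ∑ j ∈ J, ξ j ω) P := by
    simp_rw [Finset.mul_sum]
    exact integrable_finsetSum _ fun j _ => hp i j
  have ht := abs_integral_taylor_le (P := P) hd hf hf' hL hm' (U := ξ i) hTm hSm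
    ((hmem i).integrable (by norm_num)) (by simpa only [hD] using hUD)
    (by simpa only [hD] using q1)
  simp only [hD] at ht
  have hmf : Measurable f :=
    (continuous_iff_continuousAt.2 fun x => (hd x).continuousAt).measurable
  -- Near-independence is assumed for test functions bounded by `1`, hence the rescaling by `K`.
  have hb := h1 (fun x => f x / K) (hmf.div_const K) fun x => by
    rw [abs_div, abs_of_pos hK, div_le_one hK]; exact hf x
  simp_rw [← mul_div_assoc] at hb
  rw [integral_div, abs_div, abs_of_pos hK, div_le_iff₀ hK] at hb
  have e : ∫ ω, ξ i ω * (∑ j ∈ J, ξ j ω) * f' (∑ j, ξ j ω) ∂P =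
      ∑ j ∈ J, ∫ ω, ξ i ω * ξ j ω * f' (∑ j, ξ j ω) ∂P := by
    rw [← integral_finsetSum]
    · simp_rw [Finset.mul_sum, Finset.sum_mul]
    · exact fun j _ => integrable_mul_bounded (hp i j)
        (hm'.comp_aemeasurable hTm).aestronglyMeasurable fun ω => hf' _
  rw [e] at ht
  set A := ∫ ω, ξ i ω * f (∑ j, ξ j ω) ∂P
  set B := ∫ ω, ξ i ω * f (∑ j ∈ Jᶜ, ξ j ω) ∂P
  set D := ∑ j ∈ J, ∫ ω, ξ i ω * ξ j ω * f' (∑ j, ξ j ω) ∂P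
  calc |A - D| = |(A - B - D) + B| := by congr 1; ring
    _ ≤ |A - B - D| + |B| := abs_add_le _ _
    _ ≤ K * ((J.card : ℝ) ^ 2 * s ^ 3) + b * K :=
      add_le_add (ht.trans (mul_le_mul_of_nonneg_left q2 hK.le)) hb
    _ = _ := by ring

/-- The indices in `J` are removed from the argument of `h` at the price of `2 * J.card` third
moments, one half from each term of the covariance; what remains is nearly decoupled by `h3`. -/
lemma abs_cov_pair_le [IsProbabilityMeasure P] {ξ : I → Ω → ℝ} {s b K : ℝ}
    (hs : 0 < s) (hK : 0 < K)
    (hmem : ∀ i, MemLp (ξ i) 3 P) (hs3 : ∀ i, ∫ ω, |ξ i ω| ^ 3 ∂P ≤ s ^ 3) (i j : I)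
    (J : Finset I)
    (h3 : ∀ f : ℝ → ℝ, Measurable f → (∀ x, |f x| ≤ 1) →
      |∫ ω, ξ i ω * ξ j ω * f (∑ k ∈ Jᶜ, ξ k ω) ∂P -
        (∫ ω, ξ i ω * ξ j ω ∂P) * ∫ ω, f (∑ k ∈ Jᶜ, ξ k ω) ∂P| ≤ b)
    {h : ℝ → ℝ} (hb : ∀ x, |h x| ≤ K) (hL : ∀ x y, |h x - h y| ≤ K * |x - y|)
    (hm : Measurable h) :
    |∫ ω, ξ i ω * ξ j ω * h (∑ k, ξ k ω) ∂P -
        (∫ ω, ξ i ω * ξ j ω ∂P) * ∫ ω, h (∑ k, ξ k ω) ∂P| ≤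
      K * (b + 2 * J.card * s ^ 3) := by
  have hD : ∀ ω, ∑ j, ξ j ω - ∑ j ∈ Jᶜ, ξ j ω = ∑ j ∈ J, ξ j ω := fun ω => by
    rw [← Finset.sum_add_sum_compl J]; ring
  have hp := integral_abs_mul_le hs (hmem i) (hmem j) (hs3 i) (hs3 j)
  have ht := fun k => integral_abs_mul_mul_le (hmem i) (hmem j) (hmem k) (hs3 i) (hs3 j) (hs3 k)
  have h1 := fun k => (hmem k).integrable (by norm_num : (1 : ℝ≥0∞) ≤ 3)
  have hTm : AEMeasurable (fun ω => ∑ j, ξ j ω) P :=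
    (memLp_finsetSum Finset.univ fun j _ => hmem j).1.aemeasurable
  have hSm : AEMeasurable (fun ω => ∑ j ∈ Jᶜ, ξ j ω) P :=
    (memLp_finsetSum _ fun j _ => hmem j).1.aemeasurable
  have hsum : Integrable (fun ω => ∑ k ∈ J, ξ k ω) P := integrable_finsetSum _ fun k _ => h1 k
  have hUD : Integrable (fun ω => ξ i ω * ξ j ω * ∑ k ∈ J, ξ k ω) P := by
    simp_rw [Finset.mul_sum]
    exact integrable_finsetSum _ fun k _ => (ht k).1
  have hc := abs_cov_sub_cov_le (P := P) hb hL hm hTm hSm hp.1 (by simpa only [hD] using hsum)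
    (by simpa only [hD] using hUD)
  simp only [hD] at hc
  have a1 : ∫ ω, |ξ i ω * ξ j ω * ∑ k ∈ J, ξ k ω| ∂P ≤ J.card * s ^ 3 := by
    calc _ ≤ ∫ ω, ∑ k ∈ J, |ξ i ω * ξ j ω * ξ k ω| ∂P := by
          refine integral_mono hUD.abs (integrable_finsetSum _ fun k _ => (ht k).1.abs) fun ω => ?_
          simp only [Finset.mul_sum]
          exact Finset.abs_sum_le_sum_abs _ _
      _ = ∑ k ∈ J, ∫ ω, |ξ i ω * ξ j ω * ξ k ω| ∂P :=
        integral_finsetSum _ fun k _ => (ht k).1.abs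
      _ ≤ ∑ k ∈ J, s ^ 3 := Finset.sum_le_sum fun k _ => (ht k).2
      _ = _ := by simp
  have a2 : ∫ ω, |∑ k ∈ J, ξ k ω| ∂P ≤ J.card * s := by
    calc _ ≤ ∫ ω, ∑ k ∈ J, |ξ k ω| ∂P :=
          integral_mono hsum.abs (integrable_finsetSum _ fun k _ => (h1 k).abs) fun ω =>
            Finset.abs_sum_le_sum_abs _ _
      _ = ∑ k ∈ J, ∫ ω, |ξ k ω| ∂P := integral_finsetSum _ fun k _ => (h1 k).abs
      _ ≤ ∑ k ∈ J, s := Finset.sum_le_sum fun k _ => integral_abs_le hs (hmem k) (hs3 k)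
      _ = _ := by simp
  have a3 : (∫ ω, |ξ i ω * ξ j ω| ∂P) * ∫ ω, |∑ k ∈ J, ξ k ω| ∂P ≤ J.card * s ^ 3 := by
    calc _ ≤ s ^ 2 * (J.card * s) :=
          mul_le_mul hp.2 a2 (integral_nonneg fun ω => abs_nonneg _) (by positivity)
      _ = _ := by ring
  have hbd := h3 (fun x => h x / K) (hm.div_const K) fun x => by
    rw [abs_div, abs_of_pos hK, div_le_one hK]; exact hb x
  simp_rw [← mul_div_assoc] at hbd
  rw [integral_div, integral_div, ← mul_div_assoc, ← sub_div, abs_div, abs_of_pos hK,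
    div_le_iff₀ hK] at hbd
  set A := ∫ ω, ξ i ω * ξ j ω * h (∑ k, ξ k ω) ∂P -
        (∫ ω, ξ i ω * ξ j ω ∂P) * ∫ ω, h (∑ k, ξ k ω) ∂P
  set B := ∫ ω, ξ i ω * ξ j ω * h (∑ k ∈ Jᶜ, ξ k ω) ∂P -
        (∫ ω, ξ i ω * ξ j ω ∂P) * ∫ ω, h (∑ k ∈ Jᶜ, ξ k ω) ∂P
  calc |A| = |(A - B) + B| := by congr 1; ring
    _ ≤ |A - B| + |B| := abs_add_le _ _
    _ ≤ K * (J.card * s ^ 3 + J.card * s ^ 3) + b * K :=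
      add_le_add (hc.trans (mul_le_mul_of_nonneg_left (add_le_add a1 a3) hK.le)) hbd
    _ = _ := by ring

/-- A normal approximation bound for a sum of locally (almost) independent variables. -/
theorem abs_integral_sub_gaussian_le [IsProbabilityMeasure P] {ξ : I → Ω → ℝ} {s b₁ b₂ b₃ : ℝ}
    (N : I → Finset I) (hs : 0 < s)
    (hmem : ∀ i, MemLp (ξ i) 3 P) (hs3 : ∀ i, ∫ ω, |ξ i ω| ^ 3 ∂P ≤ s ^ 3)
    (hvar : ∫ ω, (∑ i, ξ i ω) ^ 2 ∂P = 1)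
    (h1 : ∀ i, ∀ f : ℝ → ℝ, Measurable f → (∀ x, |f x| ≤ 1) →
      |∫ ω, ξ i ω * f (∑ j ∈ (N i)ᶜ, ξ j ω) ∂P| ≤ b₁)
    (h2 : ∀ i, ∀ j ∈ (N i)ᶜ, |∫ ω, ξ i ω * ξ j ω ∂P| ≤ b₂) (hb2 : 0 ≤ b₂)
    (h3 : ∀ i, ∀ j ∈ N i, ∀ f : ℝ → ℝ, Measurable f → (∀ x, |f x| ≤ 1) →
      |∫ ω, ξ i ω * ξ j ω * f (∑ k ∈ (N i ∪ N j)ᶜ, ξ k ω) ∂P -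
        (∫ ω, ξ i ω * ξ j ω ∂P) * ∫ ω, f (∑ k ∈ (N i ∪ N j)ᶜ, ξ k ω) ∂P| ≤ b₃)
    {g : ℝ → ℝ} (hg : LipschitzWith 1 g) :
    |∫ ω, g (∑ i, ξ i ω) ∂P - ∫ x, g x ∂(gaussianReal 0 1)| ≤
      steinConst * (Fintype.card I * b₁ + (Fintype.card I : ℝ) ^ 2 * b₂ +
        (∑ i, ((N i).card : ℝ)) * b₃ +
        3 * (∑ i, ∑ j ∈ N i, ((N i ∪ N j).card : ℝ)) * s ^ 3) := by
  obtain ⟨f, f', hd, hf, hf', hL, heq⟩ := exists_stein_solution hg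
  have hK := steinConst_pos
  set K := steinConst
  set T : Ω → ℝ := fun ω => ∑ i, ξ i ω with hT
  have hTmem : MemLp T 3 P := memLp_finsetSum _ fun j _ => hmem j
  have hTm : AEMeasurable T P := hTmem.1.aemeasurable
  have hT1 : Integrable T P := hTmem.integrable (by norm_num)
  have hf'c : Continuous f' := by
    refine (LipschitzWith.of_dist_le_mul (K := ⟨K, hK.le⟩) fun x y => ?_).continuous
    rw [Real.dist_eq, Real.dist_eq]
    exact hL x y
  have hm' : Measurable f' := hf'c.measurable
  have hmf : Measurable f :=
    (continuous_iff_continuousAt.2 fun x => (hd x).continuousAt).measurable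
  have hp : ∀ i j, Integrable (fun ω => ξ i ω * ξ j ω) P := fun i j =>
    (integral_abs_mul_le hs (hmem i) (hmem j) (hs3 i) (hs3 j)).1
  have hξ1 : ∀ i, Integrable (ξ i) P := fun i => (hmem i).integrable (by norm_num)
  have mf : AEStronglyMeasurable (fun ω => f (T ω)) P :=
    (hmf.comp_aemeasurable hTm).aestronglyMeasurable
  have mf' : AEStronglyMeasurable (fun ω => f' (T ω)) P :=
    (hm'.comp_aemeasurable hTm).aestronglyMeasurable
  have if' : Integrable (fun ω => f' (T ω)) P :=
    (integrable_const K).mono' mf' (Filter.Eventually.of_forall fun ω => hf' _)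
  have iTf : Integrable (fun ω => T ω * f (T ω)) P := integrable_mul_bounded hT1 mf fun ω => hf _
  have hg1 : Integrable (fun ω => g (T ω)) P := by
    have : Integrable (fun ω => f' (T ω) - T ω * f (T ω) + ∫ y, g y ∂(gaussianReal 0 1)) P :=
      (if'.sub iTf).add (integrable_const _)
    refine this.congr (Filter.Eventually.of_forall fun ω => ?_)
    simp only [heq]; ring
  set E' := ∫ ω, f' (T ω) ∂P with hE'
  have hE'b : |E'| ≤ K := by
    have := norm_integral_le_of_norm_le_const (μ := P) (f := fun ω => f' (T ω))
      (Filter.Eventually.of_forall fun ω => hf' _)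
    simpa using this
  -- The Stein equation evaluated at `T` and integrated, with the factor `T` split into its
  -- summands.
  have e1 : ∫ ω, g (T ω) ∂P - ∫ x, g x ∂(gaussianReal 0 1) =
      E' - ∑ i, ∫ ω, ξ i ω * f (T ω) ∂P := by
    have a : ∑ i, ∫ ω, ξ i ω * f (T ω) ∂P = ∫ ω, T ω * f (T ω) ∂P := by
      rw [← integral_finsetSum _ fun i _ => integrable_mul_bounded (hξ1 i) mf fun ω => hf _]
      simp_rw [hT, Finset.sum_mul]
    rw [a, hE', ← integral_sub if' iTf]
    simp_rw [heq]
    rw [integral_sub hg1 (integrable_const _)]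
    simp
  -- Unit variance: near and far pairs together contribute `1`.
  have e2 : ∑ i, ∑ j ∈ N i, ∫ ω, ξ i ω * ξ j ω ∂P =
      1 - ∑ i, ∑ j ∈ (N i)ᶜ, ∫ ω, ξ i ω * ξ j ω ∂P := by
    rw [eq_sub_iff_add_eq, ← Finset.sum_add_distrib, ← hvar]
    simp_rw [Finset.sum_add_sum_compl]
    have : ∀ ω, (∑ i, ξ i ω) ^ 2 = ∑ i, ∑ j, ξ i ω * ξ j ω := fun ω => by
      rw [sq, Finset.sum_mul_sum]
    simp_rw [this]
    rw [integral_finsetSum _ fun i _ => integrable_finsetSum _ fun j _ => hp i j]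
    exact Finset.sum_congr rfl fun i _ => (integral_finsetSum _ fun j _ => hp i j).symm
  have bA := fun i => abs_integral_mul_sub_sum_le hs hK hmem hs3 i (N i) (h1 i) hd hf hf' hL hm'
  have bB := fun i j (hj : j ∈ N i) => abs_cov_pair_le hs hK hmem hs3 i j (N i ∪ N j)
    (h3 i j hj) hf' hL hm'
  -- Writing `E'` as `E'` times the variance splits the Stein error into three: covariances of far
  -- pairs, covariances of near pairs with `f' (T ω)`, and Taylor remainders.
  have e3 : E' - ∑ i, ∫ ω, ξ i ω * f (T ω) ∂P =
      E' * (∑ i, ∑ j ∈ (N i)ᶜ, ∫ ω, ξ i ω * ξ j ω ∂P) -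
        (∑ i, ∑ j ∈ N i, (∫ ω, ξ i ω * ξ j ω * f' (T ω) ∂P - (∫ ω, ξ i ω * ξ j ω ∂P) * E')) -
        ∑ i, (∫ ω, ξ i ω * f (T ω) ∂P - ∑ j ∈ N i, ∫ ω, ξ i ω * ξ j ω * f' (T ω) ∂P) := by
    simp_rw [Finset.sum_sub_distrib, ← Finset.sum_mul]
    rw [e2]; ring
  rw [e1, e3]
  have c1 : |E' * (∑ i, ∑ j ∈ (N i)ᶜ, ∫ ω, ξ i ω * ξ j ω ∂P)| ≤
      K * ((Fintype.card I : ℝ) ^ 2 * b₂) := by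
    rw [abs_mul]
    refine mul_le_mul hE'b ?_ (abs_nonneg _) hK.le
    refine (Finset.abs_sum_le_sum_abs _ _).trans ?_
    calc _ ≤ ∑ _i : I, (Fintype.card I : ℝ) * b₂ := by
          refine Finset.sum_le_sum fun i _ => (Finset.abs_sum_le_sum_abs _ _).trans ?_
          calc _ ≤ ∑ _j ∈ (N i)ᶜ, b₂ := Finset.sum_le_sum fun j hj => h2 i j hj
            _ = ((N i)ᶜ.card : ℝ) * b₂ := by simp
            _ ≤ _ := by
              gcongr
              exact Finset.card_le_univ _
      _ = _ := by simp; ring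
  have c2 : |∑ i, ∑ j ∈ N i,
      (∫ ω, ξ i ω * ξ j ω * f' (T ω) ∂P - (∫ ω, ξ i ω * ξ j ω ∂P) * E')| ≤
      K * ((∑ i, ((N i).card : ℝ)) * b₃ +
        2 * (∑ i, ∑ j ∈ N i, ((N i ∪ N j).card : ℝ)) * s ^ 3) := by
    refine (Finset.abs_sum_le_sum_abs _ _).trans ?_
    calc _ ≤ ∑ i, ∑ j ∈ N i, K * (b₃ + 2 * ((N i ∪ N j).card : ℝ) * s ^ 3) := by
          refine Finset.sum_le_sum fun i _ => (Finset.abs_sum_le_sum_abs _ _).trans ?_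
          exact Finset.sum_le_sum fun j hj => bB i j hj
      _ = _ := by
        simp_rw [← Finset.mul_sum, Finset.sum_add_distrib, ← Finset.sum_mul, ← Finset.mul_sum]
        simp [← Finset.sum_mul]
  have c3 : |∑ i, (∫ ω, ξ i ω * f (T ω) ∂P - ∑ j ∈ N i, ∫ ω, ξ i ω * ξ j ω * f' (T ω) ∂P)| ≤
      K * (Fintype.card I * b₁ + (∑ i, ∑ j ∈ N i, ((N i ∪ N j).card : ℝ)) * s ^ 3) := by
    refine (Finset.abs_sum_le_sum_abs _ _).trans ?_
    calc _ ≤ ∑ i, K * (b₁ + ((N i).card : ℝ) ^ 2 * s ^ 3) := Finset.sum_le_sum fun i _ => bA i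
      _ = K * (Fintype.card I * b₁ + (∑ i, ((N i).card : ℝ) ^ 2) * s ^ 3) := by
        rw [← Finset.mul_sum, Finset.sum_add_distrib, ← Finset.sum_mul]
        simp
      _ ≤ _ := by
        gcongr with i hi
        -- The Taylor error counts triples with both partners in `N i`; these are among the triples
        -- of the covariance error, so a single count serves both.
        calc ((N i).card : ℝ) ^ 2 = ∑ j ∈ N i, ((N i).card : ℝ) := by simp; ring
          _ ≤ _ := Finset.sum_le_sum fun j _ => by
            exact_mod_cast Finset.card_le_card Finset.subset_union_left
  refine (abs_sub _ _).trans ((add_le_add ((abs_sub _ _).trans (add_le_add c1 c2)) c3).trans ?_)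
  apply le_of_eq; ring

end LocalStein

/-! ### Decoupling under beta-mixing -/

section Decoupling

/-- A bound for the difference of two expectations in terms of the total variation distance. -/
lemma ofReal_abs_integral_sub_le {E : Type*} [MeasurableSpace E] {μ ν : Measure E}
    [IsProbabilityMeasure μ] [IsProbabilityMeasure ν] {c : ℝ≥0∞}
    (hc : ∀ S, MeasurableSet S → ENNReal.ofReal |μ.real S - ν.real S| ≤ c) {F : E → ℝ}
    (hF : Measurable F) (hμ : Integrable F μ) (hν : Integrable F ν) {p : ℝ} (hp : 1 ≤ p) :
    ENNReal.ofReal |∫ x, F x ∂μ - ∫ x, F x ∂ν| ≤ (2 * c) ^ (1 - 1 / p) *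
      (eLpNorm F (ENNReal.ofReal p) μ + eLpNorm F (ENNReal.ofReal p) ν) := by
  have hp0 : 0 < p := by linarith
  have hexp : 0 ≤ 1 - 1 / p := by
    rw [sub_nonneg, div_le_one hp0]; exact hp
  set l : Measure E := μ + ν with hl
  have hμl : μ ≤ l := Measure.le_add_right le_rfl
  have hνl : ν ≤ l := Measure.le_add_left le_rfl
  have aμ : μ ≪ l := hμl.absolutelyContinuous
  have aν : ν ≪ l := hνl.absolutelyContinuous
  set a : E → ℝ := fun x => (μ.rnDeriv l x).toReal with ha
  set b : E → ℝ := fun x => (ν.rnDeriv l x).toReal with hb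
  have ma : Measurable a := (Measure.measurable_rnDeriv _ _).ennreal_toReal
  have mb : Measurable b := (Measure.measurable_rnDeriv _ _).ennreal_toReal
  have ia : Integrable a l := Measure.integrable_toReal_rnDeriv
  have ib : Integrable b l := Measure.integrable_toReal_rnDeriv
  -- `a` and `b` are the densities with respect to `l = μ + ν`, so `π` below is the variation
  -- measure of `μ - ν`. Its mass is controlled by `c`, and it is dominated by `l` because both
  -- densities lie in `[0, 1]`.
  set w : E → ℝ≥0∞ := fun x => ENNReal.ofReal |a x - b x| with hw
  have mw : Measurable w := by fun_prop
  set π : Measure E := l.withDensity w with hπ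
  have h1 : ENNReal.ofReal |∫ x, F x ∂μ - ∫ x, F x ∂ν| ≤ eLpNorm F 1 π := by
    have i1 : Integrable (fun x => a x * F x) l := (integrable_toReal_rnDeriv_mul_iff aμ).2 hμ
    have i2 : Integrable (fun x => b x * F x) l := (integrable_toReal_rnDeriv_mul_iff aν).2 hν
    rw [← integral_toReal_rnDeriv_mul aμ, ← integral_toReal_rnDeriv_mul aν, ← integral_sub i1 i2,
      ← Real.enorm_eq_ofReal_abs, eLpNorm_one_eq_lintegral_enorm, hπ,
      lintegral_withDensity_eq_lintegral_mul _ mw (by fun_prop)]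
    refine (enorm_integral_le_lintegral_enorm _).trans (lintegral_mono fun x => ?_)
    rw [← sub_mul, enorm_mul, Real.enorm_eq_ofReal_abs]
    rfl
  have h2 : π Set.univ ≤ 2 * min c 1 := by
    have e0 : π Set.univ = ENNReal.ofReal (∫ x, |(a - b) x| ∂l) := by
      rw [ofReal_integral_eq_lintegral_ofReal (ia.sub ib).abs
        (Filter.Eventually.of_forall fun x => abs_nonneg _), hπ,
        withDensity_apply _ MeasurableSet.univ, Measure.restrict_univ]
      rfl
    -- A Hahn set for `μ - ν`. As both measures have mass one, the two halves contribute equally and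
    -- the total variation is twice the difference on `S`.
    set S : Set E := {x | b x ≤ a x} with hS
    have mS : MeasurableSet S := measurableSet_le mb ma
    have e1 : ∫ x in S, |(a - b) x| ∂l = μ.real S - ν.real S := by
      rw [← Measure.setIntegral_toReal_rnDeriv aμ, ← Measure.setIntegral_toReal_rnDeriv aν,
        ← integral_sub ia.integrableOn ib.integrableOn]
      exact setIntegral_congr_fun mS fun x hx => abs_of_nonneg (sub_nonneg.2 hx)
    have e2 : ∫ x in Sᶜ, |(a - b) x| ∂l = ν.real Sᶜ - μ.real Sᶜ := by
      rw [← Measure.setIntegral_toReal_rnDeriv aμ, ← Measure.setIntegral_toReal_rnDeriv aν,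
        ← integral_sub ib.integrableOn ia.integrableOn]
      refine setIntegral_congr_fun mS.compl fun x hx => ?_
      have hx' : a x < b x := not_le.1 hx
      simp only [Pi.sub_apply]
      rw [abs_of_neg (sub_neg.2 hx'), neg_sub]
    have e : ∫ x, |(a - b) x| ∂l = 2 * (μ.real S - ν.real S) := by
      rw [← integral_add_compl mS (ia.sub ib).abs, e1, e2, probReal_compl_eq_one_sub mS,
        probReal_compl_eq_one_sub mS]
      ring
    have hb1 : |μ.real S - ν.real S| ≤ 1 := by
      rw [abs_le]
      constructor <;> linarith [measureReal_nonneg (μ := μ) (s := S), measureReal_nonneg (μ := ν) (s := S),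
        measureReal_le_one (μ := μ) (s := S), measureReal_le_one (μ := ν) (s := S)]
    rw [e0, e, ENNReal.ofReal_mul (by norm_num), ENNReal.ofReal_ofNat]
    gcongr
    refine (ENNReal.ofReal_le_ofReal (le_abs_self _)).trans (le_min (hc S mS) ?_)
    exact ENNReal.ofReal_le_one.2 hb1
  have h3 : π ≤ l := by
    have hle : w ≤ᵐ[l] 1 := by
      filter_upwards [Measure.rnDeriv_le_one_of_le hμl, Measure.rnDeriv_le_one_of_le hνl]
        with x h1 h2
      have h1' : a x ≤ 1 := ENNReal.toReal_le_of_le_ofReal zero_le_one (by simpa using h1)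
      have h2' : b x ≤ 1 := ENNReal.toReal_le_of_le_ofReal zero_le_one (by simpa using h2)
      have h3 : 0 ≤ a x := ENNReal.toReal_nonneg
      have h4 : 0 ≤ b x := ENNReal.toReal_nonneg
      refine ENNReal.ofReal_le_one.2 ?_
      rw [abs_le]
      constructor <;> linarith
    calc π ≤ l.withDensity 1 := withDensity_mono hle
      _ = l := withDensity_one
  have hp1 : (1 : ℝ≥0∞) ≤ ENNReal.ofReal p := by simpa using hp
  have h4 : eLpNorm F (ENNReal.ofReal p) l ≤
      eLpNorm F (ENNReal.ofReal p) μ + eLpNorm F (ENNReal.ofReal p) ν := by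
    have hne : ENNReal.ofReal p ≠ 0 := by simpa using hp0
    simp only [eLpNorm_eq_lintegral_rpow_enorm_toReal hne ENNReal.ofReal_ne_top, hl,
      lintegral_add_measure, ENNReal.toReal_ofReal hp0.le]
    exact ENNReal.rpow_add_le_add_rpow _ _ (by positivity) (by rw [div_le_one hp0]; exact hp)
  have : IsFiniteMeasure π := ⟨lt_of_le_of_lt (h3 _) (measure_lt_top _ _)⟩
  -- Hölder's inequality against the variation measure: the small mass of `π` enters with the
  -- exponent `1 - 1 / p`.
  have h5 := eLpNorm_le_eLpNorm_mul_rpow_measure_univ (μ := π) hp1 hF.aestronglyMeasurable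
  refine (h1.trans h5).trans ?_
  rw [ENNReal.toReal_one, ENNReal.toReal_ofReal hp0.le, mul_comm, show (1 : ℝ) / 1 = 1 by norm_num]
  gcongr
  · exact h2.trans (by gcongr; exact min_le_left _ _)
  · exact (eLpNorm_mono_measure _ h3).trans h4

/-- Finite unions of rectangles. -/
def rectUnions (E₁ E₂ : Type*) [MeasurableSpace E₁] [MeasurableSpace E₂] : Set (Set (E₁ × E₂)) :=
  {S | ∃ (p q : ℕ) (a : E₁ → Fin p) (b : E₂ → Fin q) (R : Set (Fin p × Fin q)),
    Measurable a ∧ Measurable b ∧ S = {z | (a z.1, b z.2) ∈ R}}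

variable {E₁ E₂ : Type*} [MeasurableSpace E₁] [MeasurableSpace E₂]

/-- Pairing the two labellings of each coordinate gives a common refinement, on which every Boolean
operation becomes one on sets of labels. -/
lemma rectUnions_combine {S T : Set (E₁ × E₂)} (hS : S ∈ rectUnions E₁ E₂)
    (hT : T ∈ rectUnions E₁ E₂) (φ : Prop → Prop → Prop) :
    {z | φ (z ∈ S) (z ∈ T)} ∈ rectUnions E₁ E₂ := by
  obtain ⟨p, q, a, b, R, ha, hb, rfl⟩ := hS
  obtain ⟨p', q', a', b', R', ha', hb', rfl⟩ := hT
  refine ⟨p * p', q * q', fun x => finProdFinEquiv (a x, a' x), fun y => finProdFinEquiv (b y, b' y),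
    {w | φ (((finProdFinEquiv.symm w.1).1, (finProdFinEquiv.symm w.2).1) ∈ R)
      (((finProdFinEquiv.symm w.1).2, (finProdFinEquiv.symm w.2).2) ∈ R')}, ?_, ?_, ?_⟩
  · exact (measurable_of_finite _).comp (ha.prodMk ha')
  · exact (measurable_of_finite _).comp (hb.prodMk hb')
  · ext z; simp only [Set.mem_ofPred_eq, Equiv.symm_apply_apply]

lemma prod_mem_rectUnions {s : Set E₁} {t : Set E₂} (hs : MeasurableSet s) (ht : MeasurableSet t) :
    s ×ˢ t ∈ rectUnions E₁ E₂ := by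
  classical
  refine ⟨2, 2, fun x => if x ∈ s then 0 else 1, fun y => if y ∈ t then 0 else 1, {(0, 0)},
    Measurable.ite hs measurable_const measurable_const,
    Measurable.ite ht measurable_const measurable_const, ?_⟩
  ext z
  simp

lemma isSetRing_rectUnions : IsSetRing (rectUnions E₁ E₂) where
  empty_mem := by simpa using prod_mem_rectUnions (E₂ := E₂) (MeasurableSet.empty (α := E₁)) MeasurableSet.empty
  union_mem _ _ hS hT := rectUnions_combine hS hT fun x y => x ∨ y
  sdiff_mem _ _ hS hT := rectUnions_combine hS hT fun x y => x ∧ ¬ y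

lemma measurableSet_of_mem_rectUnions {S : Set (E₁ × E₂)} (hS : S ∈ rectUnions E₁ E₂) :
    MeasurableSet S := by
  obtain ⟨p, q, a, b, R, ha, hb, rfl⟩ := hS
  exact (((ha.comp measurable_fst).prodMk (hb.comp measurable_snd)) (Set.toFinite R).measurableSet)

lemma generateFrom_rectUnions :
    (inferInstance : MeasurableSpace (E₁ × E₂)) = MeasurableSpace.generateFrom (rectUnions E₁ E₂) := by
  refine le_antisymm ?_ (MeasurableSpace.generateFrom_le fun S hS =>
    measurableSet_of_mem_rectUnions hS)
  change Prod.instMeasurableSpace ≤ _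
  rw [← generateFrom_prod]
  refine MeasurableSpace.generateFrom_mono ?_
  rintro _ ⟨s, hs, t, ht, rfl⟩
  exact prod_mem_rectUnions hs ht

lemma isFinitePartition_preimage {Ω : Type*} {F : MeasurableSpace Ω} {p : ℕ} {a : Ω → Fin p}
    (ha : Measurable[F] a) : IsFinitePartition F fun i => a ⁻¹' {i} := by
  refine ⟨fun i => ha (measurableSet_singleton i), fun i j hij => ?_, ?_⟩
  · exact Disjoint.preimage _ (by simpa using hij)
  · ext ω; simp

lemma measureReal_preimage_eq_sum {E : Type*} [MeasurableSpace E] {μ : Measure E}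
    [IsFiniteMeasure μ] {p : Type*} [Fintype p] [MeasurableSpace p] [MeasurableSingletonClass p]
    {a : E → p} (ha : Measurable a) (R : Finset p) :
    μ.real (a ⁻¹' R) = ∑ r ∈ R, μ.real (a ⁻¹' {r}) :=
  (sum_measureReal_preimage_singleton R fun r _ => ha (measurableSet_singleton r)).symm

variable {Ω : Type*} {F₁ F₂ : MeasurableSpace Ω} [mΩ : MeasurableSpace Ω] {P : Measure Ω}

/-- The labellings pull back along `X` and `Y` to finite partitions admissible in `betaCoeff`. The
difference on `S` is a partial sum over their cells; bounding it by the full absolute sum gives the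
factor `2`, which cancels the `1 / 2` of the definition. -/
lemma ofReal_abs_sub_le_of_mem_rectUnions [IsProbabilityMeasure P]
    (h₁ : F₁ ≤ mΩ) (h₂ : F₂ ≤ mΩ) {X : Ω → E₁} {Y : Ω → E₂}
    (hX : Measurable[F₁] X) (hY : Measurable[F₂] Y) {S : Set (E₁ × E₂)}
    (hS : S ∈ rectUnions E₁ E₂) :
    ENNReal.ofReal |(P.map fun ω => (X ω, Y ω)).real S - ((P.map X).prod (P.map Y)).real S| ≤
      2 * betaCoeff P F₁ F₂ := by
  classical
  have hX' : Measurable X := hX.mono h₁ le_rfl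
  have hY' : Measurable Y := hY.mono h₂ le_rfl
  have := Measure.isProbabilityMeasure_map (μ := P) hX'.aemeasurable
  have := Measure.isProbabilityMeasure_map (μ := P) hY'.aemeasurable
  have := Measure.isProbabilityMeasure_map (μ := P) (hX'.prodMk hY').aemeasurable
  obtain ⟨p, q, a, b, R, ha, hb, rfl⟩ := hS
  set A : Fin p → Set Ω := fun i => (a ∘ X) ⁻¹' {i}
  set B : Fin q → Set Ω := fun j => (b ∘ Y) ⁻¹' {j}
  have hA : IsFinitePartition F₁ A := isFinitePartition_preimage (ha.comp hX)
  have hB : IsFinitePartition F₂ B := isFinitePartition_preimage (hb.comp hY)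
  have hab : Measurable fun z : E₁ × E₂ => (a z.1, b z.2) := by fun_prop
  have e : {z : E₁ × E₂ | (a z.1, b z.2) ∈ R} =
      (fun z : E₁ × E₂ => (a z.1, b z.2)) ⁻¹' (R.toFinset : Set (Fin p × Fin q)) := by
    ext z; simp
  have hle : ENNReal.ofReal ((1 / 2) *
      ∑ i, ∑ j, |P.real (A i ∩ B j) - P.real (A i) * P.real (B j)|) ≤ betaCoeff P F₁ F₂ := by
    unfold betaCoeff
    exact le_iSup_of_le p <| le_iSup_of_le q <| le_iSup_of_le A <| le_iSup_of_le B <|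
      le_iSup_of_le hA <| le_iSup_of_le hB le_rfl
  rw [e, measureReal_preimage_eq_sum hab, measureReal_preimage_eq_sum hab,
    ← Finset.sum_sub_distrib]
  have e1 : ∀ r : Fin p × Fin q, (P.map fun ω => (X ω, Y ω)).real
      ((fun z : E₁ × E₂ => (a z.1, b z.2)) ⁻¹' {r}) = P.real (A r.1 ∩ B r.2) := fun r => by
    rw [map_measureReal_apply (hX'.prodMk hY') (hab (measurableSet_singleton r))]
    congr 1
    ext ω; simp [A, B, Prod.ext_iff]
  have e2 : ∀ r : Fin p × Fin q, ((P.map X).prod (P.map Y)).real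
      ((fun z : E₁ × E₂ => (a z.1, b z.2)) ⁻¹' {r}) = P.real (A r.1) * P.real (B r.2) := fun r => by
    have : (fun z : E₁ × E₂ => (a z.1, b z.2)) ⁻¹' {r} = (a ⁻¹' {r.1}) ×ˢ (b ⁻¹' {r.2}) := by
      ext z; simp [Prod.ext_iff]
    rw [this, measureReal_prod_prod, map_measureReal_apply hX' (ha (measurableSet_singleton _)),
      map_measureReal_apply hY' (hb (measurableSet_singleton _))]
    rfl
  simp_rw [e1, e2]
  calc _ ≤ ENNReal.ofReal (∑ r : Fin p × Fin q,
        |P.real (A r.1 ∩ B r.2) - P.real (A r.1) * P.real (B r.2)|) := by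
        refine ENNReal.ofReal_le_ofReal ((Finset.abs_sum_le_sum_abs _ _).trans ?_)
        exact Finset.sum_le_sum_of_subset_of_nonneg (Finset.subset_univ _)
          fun _ _ _ => abs_nonneg _
    _ = 2 * ENNReal.ofReal ((1 / 2) *
      ∑ i, ∑ j, |P.real (A i ∩ B j) - P.real (A i) * P.real (B j)|) := by
        rw [← ENNReal.ofReal_ofNat 2, ← ENNReal.ofReal_mul (by norm_num), ← mul_assoc,
          Fintype.sum_prod_type]
        norm_num
    _ ≤ _ := by gcongr

/-- Finite unions of rectangles form a ring generating the product sigma-algebra. Approximation with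
respect to `μ + ν` makes the symmetric difference small for the joint law and the product law at
once. -/
lemma ofReal_abs_sub_le_betaCoeff [IsProbabilityMeasure P]
    (h₁ : F₁ ≤ mΩ) (h₂ : F₂ ≤ mΩ) {X : Ω → E₁} {Y : Ω → E₂}
    (hX : Measurable[F₁] X) (hY : Measurable[F₂] Y) {S : Set (E₁ × E₂)}
    (hS : MeasurableSet S) :
    ENNReal.ofReal |(P.map fun ω => (X ω, Y ω)).real S - ((P.map X).prod (P.map Y)).real S| ≤
      2 * betaCoeff P F₁ F₂ := by
  have hX' : Measurable X := hX.mono h₁ le_rfl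
  have hY' : Measurable Y := hY.mono h₂ le_rfl
  have := Measure.isProbabilityMeasure_map (μ := P) hX'.aemeasurable
  have := Measure.isProbabilityMeasure_map (μ := P) hY'.aemeasurable
  have := Measure.isProbabilityMeasure_map (μ := P) (hX'.prodMk hY').aemeasurable
  set μ := P.map fun ω => (X ω, Y ω)
  set ν := (P.map X).prod (P.map Y)
  refine ENNReal.le_of_forall_pos_le_add fun ε hε _ => ?_
  obtain ⟨T, hT, hTS⟩ := exists_measure_symmDiff_lt_of_generateFrom_isSetRing (μ := μ + ν)
    isSetRing_rectUnions ⟨{Set.univ}, Set.countable_singleton _, by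
      rw [Set.singleton_subset_iff, ← Set.univ_prod_univ]
      exact prod_mem_rectUnions MeasurableSet.univ MeasurableSet.univ, by simp⟩
    generateFrom_rectUnions hS (ENNReal.coe_pos.2 hε)
  have mT := measurableSet_of_mem_rectUnions hT
  have a1 := abs_measureReal_sub_le_measureReal_symmDiff (μ := μ) mT.nullMeasurableSet hS.nullMeasurableSet
  have a2 := abs_measureReal_sub_le_measureReal_symmDiff (μ := ν) mT.nullMeasurableSet hS.nullMeasurableSet
  have hb := ofReal_abs_sub_le_of_mem_rectUnions (P := P) h₁ h₂ hX hY hT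
  have key : |μ.real S - ν.real S| ≤ |μ.real T - ν.real T| + (μ.real (symmDiff T S) + ν.real (symmDiff T S)) := by
    have e : μ.real S - ν.real S = (μ.real T - ν.real T) - ((μ.real T - μ.real S) - (ν.real T - ν.real S)) := by ring
    rw [e]
    refine (abs_sub _ _).trans ?_
    gcongr
    exact (abs_sub _ _).trans (add_le_add a1 a2)
  calc _ ≤ ENNReal.ofReal (|μ.real T - ν.real T| + (μ.real (symmDiff T S) + ν.real (symmDiff T S))) :=
        ENNReal.ofReal_le_ofReal key
    _ = ENNReal.ofReal |μ.real T - ν.real T| + (μ + ν) (symmDiff T S) := by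
        rw [ENNReal.ofReal_add (abs_nonneg _) (by positivity), ENNReal.ofReal_add (by positivity) (by positivity),
          ofReal_measureReal, ofReal_measureReal]
        rfl
    _ ≤ _ := add_le_add hb hTS.le

/-- Decoupling: replacing a random pair by an independent one. -/
theorem ofReal_abs_integral_sub_prod_le [IsProbabilityMeasure P]
    (h₁ : F₁ ≤ mΩ) (h₂ : F₂ ≤ mΩ) {X : Ω → E₁} {Y : Ω → E₂}
    (hX : Measurable[F₁] X) (hY : Measurable[F₂] Y) {F : E₁ × E₂ → ℝ} (hF : Measurable F)
    (hi : Integrable (fun ω => F (X ω, Y ω)) P) (hj : Integrable F ((P.map X).prod (P.map Y)))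
    {p : ℝ} (hp : 1 ≤ p) :
    ENNReal.ofReal |∫ ω, F (X ω, Y ω) ∂P - ∫ z, F z ∂((P.map X).prod (P.map Y))| ≤
      4 * betaCoeff P F₁ F₂ ^ (1 - 1 / p) * (eLpNorm (fun ω => F (X ω, Y ω)) (ENNReal.ofReal p) P +
        eLpNorm F (ENNReal.ofReal p) ((P.map X).prod (P.map Y))) := by
  have hX' : Measurable X := hX.mono h₁ le_rfl
  have hY' : Measurable Y := hY.mono h₂ le_rfl
  have hXY := hX'.prodMk hY'
  have := Measure.isProbabilityMeasure_map (μ := P) hX'.aemeasurable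
  have := Measure.isProbabilityMeasure_map (μ := P) hY'.aemeasurable
  have := Measure.isProbabilityMeasure_map (μ := P) hXY.aemeasurable
  have hexp : 0 ≤ 1 - 1 / p := by
    rw [sub_nonneg, div_le_one (by linarith)]; exact hp
  have hexp1 : 1 - 1 / p ≤ 1 := by
    have : 0 ≤ 1 / p := by positivity
    linarith
  have h := ofReal_abs_integral_sub_le
    (fun S hS => ofReal_abs_sub_le_betaCoeff (P := P) h₁ h₂ hX hY hS) hF
    ((integrable_map_measure hF.aestronglyMeasurable hXY.aemeasurable).2 hi) hj hp
  rw [integral_map hXY.aemeasurable hF.aestronglyMeasurable,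
    eLpNorm_map_measure hF.aestronglyMeasurable hXY.aemeasurable] at h
  refine h.trans ?_
  rw [← mul_assoc, show (2 : ℝ≥0∞) * 2 = 4 by norm_num, ENNReal.mul_rpow_of_nonneg _ _ hexp]
  gcongr
  -- The exponent is at most `1`, so the constant can be chosen independently of `p`; this keeps the
  -- final constant independent of `δ`.
  · calc (4 : ℝ≥0∞) ^ (1 - 1 / p) ≤ 4 ^ (1 : ℝ) :=
        ENNReal.rpow_le_rpow_of_exponent_le (by norm_num) hexp1
      _ = 4 := ENNReal.rpow_one _
  · exact le_rfl

end Decoupling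

/-! ### Counting index vectors -/

section Counting

variable {I : Type*} [EMetricSpace I] {m : ℝ≥0} {q : ℕ} {v : Fin q → I}

lemma mConnected_of_edist_le {a b : Fin q} (h : edist (v a) (v b) ≤ m) :
    MConnected m v (v a) (v b) :=
  Relation.TransGen.single ⟨⟨a, rfl⟩, ⟨b, rfl⟩, h⟩

lemma mConnected_refl (a : Fin q) : MConnected m v (v a) (v a) :=
  mConnected_of_edist_le (by simp)

lemma MConnected.symm {x y : I} (h : MConnected m v x y) : MConnected m v y x := by
  unfold MConnected at h ⊢
  rw [← Relation.transGen_swap]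
  exact Relation.TransGen.mono (fun x y hxy => ⟨hxy.2.1, hxy.1, edist_comm x y ▸ hxy.2.2⟩) _ _ h

lemma MConnected.trans {x y z : I} (h : MConnected m v x y) (h' : MConnected m v y z) :
    MConnected m v x z :=
  Relation.TransGen.trans h h'

lemma profile_eq_of_mConnected (hq : 0 < q) (h : ∀ a b, MConnected m v (v a) (v b)) :
    profile m v = [q] := by
  classical
  have : Nonempty (Fin q) := ⟨⟨0, hq⟩⟩
  have e : positionClasses m v = {Finset.univ} := by
    unfold positionClasses
    simp only [h, Finset.filter_true]
    exact Finset.image_const Finset.univ_nonempty _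
  simp [profile, e]

/-- The classes partition the positions: in the count of positions by fibres of `j ↦` its class, the
fibre over a class is the class itself, because connectedness is an equivalence on entries. -/
lemma sum_profile : (profile m v).sum = q := by
  classical
  have e : (profile m v).sum = ∑ Q ∈ positionClasses m v, Q.card := by
    rw [← Multiset.sum_coe, profile, Multiset.sort_eq]
    rfl
  rw [e]
  set f : Fin q → Finset (Fin q) := fun j => Finset.univ.filter fun j' => MConnected m v (v j) (v j')
  have h := Finset.card_eq_sum_card_image f Finset.univ
  rw [Finset.card_univ, Fintype.card_fin] at h
  change ∑ Q ∈ Finset.univ.image f, Q.card = q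
  conv_rhs => rw [h]
  refine Finset.sum_congr rfl fun Q hQ => ?_
  obtain ⟨a, -, rfl⟩ := Finset.mem_image.1 hQ
  congr 1
  ext b
  simp only [f, Finset.mem_filter, Finset.mem_univ, true_and]
  constructor
  · intro hab
    ext c
    simp only [Finset.mem_filter, Finset.mem_univ, true_and]
    exact ⟨fun h => hab.trans h, fun h => hab.symm.trans h⟩
  · intro hab
    have : b ∈ Finset.univ.filter fun j' => MConnected m v (v b) (v j') := by
      simpa using mConnected_refl b
    rw [hab] at this
    simpa using this

lemma two_le_of_mem_profile (h : ∀ a, ∃ b, b ≠ a ∧ edist (v a) (v b) ≤ m) {k : ℕ}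
    (hk : k ∈ profile m v) : 2 ≤ k := by
  classical
  simp only [profile, Multiset.mem_sort, Multiset.mem_map, Finset.mem_val] at hk
  obtain ⟨Q, hQ, rfl⟩ := hk
  obtain ⟨a, -, rfl⟩ := Finset.mem_image.1 hQ
  obtain ⟨b, hb, hab⟩ := h a
  refine Finset.one_lt_card.2 ⟨a, ?_, b, ?_, hb.symm⟩
  · simpa using mConnected_refl a
  · simpa using mConnected_of_edist_le hab

/-- With every part at least `2`, the only partitions of `4` are `4` and `2 + 2`. -/
lemma profile_eq_of_no_isolated {v : Fin 4 → I}
    (h : ∀ a, ∃ b, b ≠ a ∧ edist (v a) (v b) ≤ m) :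
    profile m v = [4] ∨ profile m v = [2, 2] := by
  have hs : (profile m v).sum = 4 := sum_profile
  have h2 := fun k (hk : k ∈ profile m v) => two_le_of_mem_profile h hk
  generalize profile m v = L at hs h2
  match L with
  | [] => simp at hs
  | [a] => left; simpa using hs
  | [a, b] =>
    right
    have ha := h2 a (by simp)
    have hb := h2 b (by simp)
    simp only [List.sum_cons, List.sum_nil] at hs
    congr <;> omega
  | a :: b :: c :: t =>
    have ha := h2 a (by simp)
    have hb := h2 b (by simp)
    have hc := h2 c (by simp)
    simp only [List.sum_cons] at hs
    omega

variable [Fintype I]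

/-- The length is a free `q` tied to `L.sum` by an equation, so that explicit vectors of numeral
length can be supplied. -/
lemma card_le_tau_of_sum {q : ℕ} {L : List ℕ} (hL : L.sum = q) {S : Type*} [Finite S]
    (φ : S → Fin q → I) (hφ : Function.Injective φ) (h : ∀ s, profile m (φ s) = L) :
    Nat.card S ≤ tau I m L := by
  subst hL
  exact Nat.card_le_card_of_injective (fun s => (⟨φ s, h s⟩ : {v : Fin L.sum → I // profile m v = L}))
    fun s t hst => hφ (congrArg Subtype.val hst)

open Classical in
/-- The nodes within distance `m`. -/
def ball (m : ℝ≥0) (i : I) : Finset I := Finset.univ.filter fun j => edist i j ≤ m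

lemma mem_ball {i j : I} : j ∈ ball m i ↔ edist i j ≤ m := by simp [ball]

/-- Diagonal pairs cause no exception: a profile counts positions, so `(i, i)` also has profile
`[2]`. -/
lemma card_sum_ball_le : ∑ i : I, (ball m i).card ≤ tau I m [2] := by
  classical
  rw [← Finset.card_sigma, ← Fintype.card_coe, ← Nat.card_eq_fintype_card]
  refine card_le_tau_of_sum (q := 2) rfl (fun s => ![s.1.1, s.1.2]) ?_ ?_
  · rintro ⟨⟨i, j⟩, _⟩ ⟨⟨i', j'⟩, _⟩ h
    have h0 := congrFun h 0
    have h1 := congrFun h 1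
    simp at h0 h1
    simp [h0, h1]
  · rintro ⟨⟨i, j⟩, h⟩
    simp only [Finset.mem_sigma, Finset.mem_univ, true_and, mem_ball] at h
    have h01 : MConnected m ![i, j] (![i, j] 0) (![i, j] 1) := mConnected_of_edist_le h
    refine profile_eq_of_mConnected two_pos fun a b => ?_
    fin_cases a <;> fin_cases b
    · exact mConnected_refl 0
    · exact h01
    · exact h01.symm
    · exact mConnected_refl 1

open Classical in
-- In a triple counted here `j` is near `i` and `k` is near `i` or `j`, so all three positions are
-- connected to the first.
lemma card_sum_ball_union_le :
    ∑ i : I, ∑ j ∈ ball m i, (ball m i ∪ ball m j).card ≤ tau I m [3] := by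
  simp_rw [← Finset.card_sigma]
  rw [← Fintype.card_coe, ← Nat.card_eq_fintype_card]
  refine card_le_tau_of_sum (q := 3) rfl (fun s => ![s.1.1, s.1.2.1, s.1.2.2]) ?_ ?_
  · rintro ⟨⟨i, j, k⟩, _⟩ ⟨⟨i', j', k'⟩, _⟩ h
    have h0 := congrFun h 0
    have h1 := congrFun h 1
    have h2 := congrFun h 2
    simp at h0 h1 h2
    simp [h0, h1, h2]
  · rintro ⟨⟨i, j, k⟩, h⟩
    simp only [Finset.mem_sigma, Finset.mem_univ, true_and, mem_ball, Finset.mem_union] at h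
    have h01 : MConnected m ![i, j, k] (![i, j, k] 0) (![i, j, k] 1) := mConnected_of_edist_le h.1
    have h02 : MConnected m ![i, j, k] (![i, j, k] 0) (![i, j, k] 2) := by
      rcases h.2 with h2 | h2
      · exact mConnected_of_edist_le h2
      · have h12 : MConnected m ![i, j, k] (![i, j, k] 1) (![i, j, k] 2) :=
          mConnected_of_edist_le h2
        exact h01.trans h12
    have h0 : ∀ a, MConnected m ![i, j, k] (![i, j, k] 0) (![i, j, k] a) := by
      intro a
      fin_cases a
      · exact mConnected_refl 0
      · exact h01
      · exact h02
    exact profile_eq_of_mConnected three_pos fun a b => (h0 a).symm.trans (h0 b)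

/-- No entry of the index vector `(i, k, j, l)` is far from the others. -/
def NoIsolated (m : ℝ≥0) (a : (I × I) × (I × I)) : Prop :=
  ∀ s : Fin 4, ∃ t, t ≠ s ∧
    edist (![a.1.1, a.1.2, a.2.1, a.2.2] s) (![a.1.1, a.1.2, a.2.1, a.2.2] t) ≤ m

open Classical in
lemma card_noIsolated_le :
    (Finset.univ.filter fun a : (I × I) × (I × I) => NoIsolated m a).card ≤
      tau I m [4] + tau I m [2, 2] := by
  set φ : (I × I) × (I × I) → Fin 4 → I := fun a => ![a.1.1, a.1.2, a.2.1, a.2.2] with hφ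
  have hinj : Function.Injective φ := by
    rintro ⟨⟨i, k⟩, j, l⟩ ⟨⟨i', k'⟩, j', l'⟩ h
    have h0 := congrFun h 0
    have h1 := congrFun h 1
    have h2 := congrFun h 2
    have h3 := congrFun h 3
    simp [φ] at h0 h1 h2 h3
    simp [h0, h1, h2, h3]
  have hc : ∀ L : List ℕ, L.sum = 4 →
      (Finset.univ.filter fun a => profile m (φ a) = L).card ≤ tau I m L := fun L hL => by
    rw [← Fintype.card_subtype, ← Nat.card_eq_fintype_card]
    exact card_le_tau_of_sum hL (fun s : {a // profile m (φ a) = L} => φ s.1)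
      (hinj.comp Subtype.val_injective) fun s => s.2
  calc _ ≤ ((Finset.univ.filter fun a => profile m (φ a) = [4]) ∪
        (Finset.univ.filter fun a => profile m (φ a) = [2, 2])).card := by
        refine Finset.card_le_card fun a ha => ?_
        simp only [Finset.mem_union, Finset.mem_filter, Finset.mem_univ, true_and] at ha ⊢
        exact profile_eq_of_no_isolated ha
    _ ≤ _ := (Finset.card_union_le _ _).trans (add_le_add (hc _ rfl) (hc _ rfl))

/-- A constant vector has this profile. Positivity matters because of `0 * ∞ = 0`: it ensures that a
finite term in the bound forces the factor multiplying `tau` to be finite. -/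
lemma tau_singleton_pos [Nonempty I] {q : ℕ} (hq : 0 < q) : 0 < tau I m [q] := by
  obtain ⟨i⟩ := ‹Nonempty I›
  have := card_le_tau_of_sum (m := m) (L := [q]) (q := q) (by simp) (fun _ : Unit => fun _ => i)
    (fun _ _ _ => rfl) fun _ =>
      profile_eq_of_mConnected hq fun a b => mConnected_of_edist_le (a := a) (b := b) (by simp)
  exact lt_of_lt_of_le (by simp) this

end Counting

/-! ### Moments of the kernel and of its projections -/

section Moments

/-- Jensen's inequality for integrating out one variable. -/
lemma eLpNorm_integral_prod_le {E₁ E₂ : Type*} [MeasurableSpace E₁] [MeasurableSpace E₂]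
    {μ : Measure E₁} {ν : Measure E₂} [IsProbabilityMeasure μ] [IsProbabilityMeasure ν]
    {F : E₁ × E₂ → ℝ} (hF : Measurable F) {p : ℝ} (hp : 1 ≤ p) :
    eLpNorm (fun x => ∫ y, F (x, y) ∂ν) (ENNReal.ofReal p) μ ≤
      eLpNorm F (ENNReal.ofReal p) (μ.prod ν) := by
  have hp0 : 0 < p := by linarith
  have hne : ENNReal.ofReal p ≠ 0 := by simpa using hp0
  have hp1 : (1 : ℝ≥0∞) ≤ ENNReal.ofReal p := by simpa using hp
  simp only [eLpNorm_eq_lintegral_rpow_enorm_toReal hne ENNReal.ofReal_ne_top,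
    ENNReal.toReal_ofReal hp0.le]
  rw [lintegral_prod _ (by fun_prop)]
  gcongr with x
  have hx : Measurable fun y => F (x, y) := by fun_prop
  have h1 : ‖∫ y, F (x, y) ∂ν‖ₑ ≤ eLpNorm (fun y => F (x, y)) (ENNReal.ofReal p) ν := by
    refine (enorm_integral_le_lintegral_enorm _).trans ?_
    rw [← eLpNorm_one_eq_lintegral_enorm]
    exact eLpNorm_le_eLpNorm_of_exponent_le hp1 hx.aestronglyMeasurable
  rw [eLpNorm_eq_lintegral_rpow_enorm_toReal hne ENNReal.ofReal_ne_top,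
    ENNReal.toReal_ofReal hp0.le] at h1
  calc _ ≤ ((∫⁻ y, ‖F (x, y)‖ₑ ^ p ∂ν) ^ (1 / p)) ^ p := by gcongr
    _ = _ := by rw [← ENNReal.rpow_mul, one_div_mul_cancel hp0.ne', ENNReal.rpow_one]

lemma eLpNorm_mul_le_mul {Z : Type*} [MeasurableSpace Z] {Q : Measure Z} {f g : Z → ℝ}
    (hf : AEStronglyMeasurable f Q) (hg : AEStronglyMeasurable g Q) {q : ℝ} (hq : 0 < q) :
    eLpNorm (fun z => f z * g z) (ENNReal.ofReal (q / 2)) Q ≤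
      eLpNorm f (ENNReal.ofReal q) Q * eLpNorm g (ENNReal.ofReal q) Q := by
  have : ENNReal.HolderTriple (ENNReal.ofReal q) (ENNReal.ofReal q) (ENNReal.ofReal (q / 2)) := by
    refine ⟨?_⟩
    rw [← ENNReal.ofReal_inv_of_pos hq, ← ENNReal.ofReal_inv_of_pos (by positivity),
      ← ENNReal.ofReal_add (by positivity) (by positivity)]
    congr 1
    field_simp
    norm_num
  have h := eLpNorm_smul_le_mul_eLpNorm (p := ENNReal.ofReal q) (q := ENNReal.ofReal q)
    (r := ENNReal.ofReal (q / 2)) hg hf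
  rw [show (fun z => f z * g z) = f • g from rfl]
  exact h

lemma eLpNorm_one_mul_le_mul {Z : Type*} [MeasurableSpace Z] {Q : Measure Z} {f g : Z → ℝ}
    (hf : AEStronglyMeasurable f Q) (hg : AEStronglyMeasurable g Q) :
    eLpNorm (fun z => f z * g z) 1 Q ≤ eLpNorm f 2 Q * eLpNorm g 2 Q := by
  have := eLpNorm_mul_le_mul hf hg (q := 2) two_pos
  simpa using this

lemma ofReal_abs_integral_le_eLpNorm {Z : Type*} [MeasurableSpace Z] {Q : Measure Z} {f : Z → ℝ} :
    ENNReal.ofReal |∫ z, f z ∂Q| ≤ eLpNorm f 1 Q := by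
  rw [← Real.enorm_eq_ofReal_abs, eLpNorm_one_eq_lintegral_enorm]
  exact enorm_integral_le_lintegral_enorm _

variable {Ω I E : Type*} [MeasurableSpace Ω] {P : Measure Ω} [MeasurableSpace E]
  {X : I → Ω → E} {H : E → E → ℝ}

lemma IsKernel.comp {Z : Type*} [MeasurableSpace Z] (hH : IsKernel P X H) {u v : Z → E}
    (hu : Measurable u) (hv : Measurable v) : Measurable fun z => H (u z) (v z) :=
  hH.1.comp (hu.prodMk hv)

lemma eLpNorm_kernel_le {i j : I} (hij : i ≠ j) (p : ℝ) :
    eLpNorm (fun ω => H (X i ω) (X j ω)) (ENNReal.ofReal p) P ≤ momentSup P X H p :=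
  (le_max_left _ _).trans <| le_iSup_of_le i <| le_iSup_of_le j <| le_iSup_of_le hij le_rfl

lemma eLpNorm_kernel_prod_le {i j : I} (hij : i ≠ j) (p : ℝ) :
    eLpNorm (fun z : E × E => H z.1 z.2) (ENNReal.ofReal p) ((P.map (X i)).prod (P.map (X j))) ≤
      momentSup P X H p :=
  (le_max_right _ _).trans <| le_iSup_of_le i <| le_iSup_of_le j <| le_iSup_of_le hij le_rfl

lemma Hhat_eq (hX : ∀ i, Measurable (X i)) (hH : IsKernel P X H) (k : I) (x : E) :
    Hhat P X H k x = ∫ y, H x y ∂(P.map (X k)) := by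
  have hm : Measurable fun y => H x y := hH.comp measurable_const measurable_id
  rw [integral_map (hX k).aemeasurable hm.aestronglyMeasurable]
  simp only [Hhat, hH.2.1 _ x]

variable [IsProbabilityMeasure P]

lemma measurable_Hhat (hX : ∀ i, Measurable (X i)) (hH : IsKernel P X H) (k : I) :
    Measurable (Hhat P X H k) := by
  have h : Measurable fun z : E × Ω => H (X k z.2) z.1 :=
    hH.comp ((hX k).comp measurable_snd) measurable_fst
  exact (h.stronglyMeasurable.integral_prod_right').measurable

lemma theta_eq (hX : ∀ i, Measurable (X i)) (hH : IsKernel P X H) (i k : I) :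
    theta P X H i k = ∫ x, Hhat P X H k x ∂(P.map (X i)) := by
  rw [integral_map (hX i).aemeasurable (measurable_Hhat hX hH k).aestronglyMeasurable]
  rfl

lemma isProbabilityMeasure_law (hX : ∀ i, Measurable (X i)) (i : I) :
    IsProbabilityMeasure (P.map (X i)) :=
  Measure.isProbabilityMeasure_map (hX i).aemeasurable

lemma eLpNorm_Hhat_le_prod (hX : ∀ i, Measurable (X i)) (hH : IsKernel P X H) (i k : I)
    {p : ℝ} (hp : 1 ≤ p) :
    eLpNorm (Hhat P X H k) (ENNReal.ofReal p) (P.map (X i)) ≤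
      eLpNorm (fun z : E × E => H z.1 z.2) (ENNReal.ofReal p)
        ((P.map (X i)).prod (P.map (X k))) := by
  have := isProbabilityMeasure_law (P := P) hX i
  have := isProbabilityMeasure_law (P := P) hX k
  have e : Hhat P X H k = fun x => ∫ y, H x y ∂(P.map (X k)) := funext fun x => Hhat_eq hX hH k x
  rw [e]
  exact eLpNorm_integral_prod_le (F := fun z : E × E => H z.1 z.2) hH.1 hp

lemma integrable_kernel_prod (hX : ∀ i, Measurable (X i)) (hH : IsKernel P X H) {i k : I}
    (hik : i ≠ k) :
    Integrable (fun z : E × E => H z.1 z.2) ((P.map (X i)).prod (P.map (X k))) := by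
  have := isProbabilityMeasure_law (P := P) hX i
  have := isProbabilityMeasure_law (P := P) hX k
  exact (hH.2.2 i k hik).integrable (by norm_num)

lemma memLp_Hhat (hX : ∀ i, Measurable (X i)) (hH : IsKernel P X H) {i k : I} (hik : i ≠ k) :
    MemLp (Hhat P X H k) 2 (P.map (X i)) := by
  refine ⟨(measurable_Hhat hX hH k).aestronglyMeasurable, lt_of_le_of_lt ?_ (hH.2.2 i k hik).2⟩
  simpa using eLpNorm_Hhat_le_prod hX hH i k (p := 2) (by norm_num)

lemma integrable_Hhat (hX : ∀ i, Measurable (X i)) (hH : IsKernel P X H) {i k : I} (hik : i ≠ k) :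
    Integrable (Hhat P X H k) (P.map (X i)) := by
  have := isProbabilityMeasure_law (P := P) hX i
  exact (memLp_Hhat hX hH hik).integrable (by norm_num)

lemma theta_symm (hX : ∀ i, Measurable (X i)) (hH : IsKernel P X H) {i k : I} (hik : i ≠ k) :
    theta P X H i k = theta P X H k i := by
  have := isProbabilityMeasure_law (P := P) hX i
  have := isProbabilityMeasure_law (P := P) hX k
  rw [theta_eq hX hH, theta_eq hX hH]
  simp_rw [Hhat_eq hX hH]
  rw [integral_integral_swap (integrable_kernel_prod hX hH hik)]
  simp_rw [hH.2.1]

lemma eLpNorm_Hhat_le (hX : ∀ i, Measurable (X i)) (hH : IsKernel P X H) {i k : I} (hik : i ≠ k)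
    {p : ℝ} (hp : 1 ≤ p) :
    eLpNorm (Hhat P X H k) (ENNReal.ofReal p) (P.map (X i)) ≤ momentSup P X H p :=
  (eLpNorm_Hhat_le_prod hX hH i k hp).trans (eLpNorm_kernel_prod_le hik p)

lemma enorm_theta_le (hX : ∀ i, Measurable (X i)) (hH : IsKernel P X H) {i k : I} (hik : i ≠ k)
    {p : ℝ} (hp : 1 ≤ p) : ‖theta P X H i k‖ₑ ≤ momentSup P X H p := by
  have := isProbabilityMeasure_law (P := P) hX i
  rw [theta_eq hX hH, Real.enorm_eq_ofReal_abs]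
  refine (ofReal_abs_integral_le_eLpNorm.trans ?_).trans (eLpNorm_Hhat_le hX hH hik hp)
  exact eLpNorm_le_eLpNorm_of_exponent_le (by simpa using hp)
    (measurable_Hhat hX hH k).aestronglyMeasurable

/-- The completely degenerate part of the kernel. -/
def degKernel (P : Measure Ω) (X : I → Ω → E) (H : E → E → ℝ) (i k : I) (x y : E) : ℝ :=
  H x y - Hhat P X H k x - Hhat P X H i y + theta P X H i k

lemma degKernel_symm (hX : ∀ i, Measurable (X i)) (hH : IsKernel P X H) {i k : I} (hik : i ≠ k)
    (x y : E) : degKernel P X H i k x y = degKernel P X H k i y x := by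
  unfold degKernel
  rw [theta_symm hX hH hik, hH.2.1 x y]; ring

lemma measurable_degKernel (hX : ∀ i, Measurable (X i)) (hH : IsKernel P X H) (i k : I)
    {Z : Type*} [MeasurableSpace Z] {u v : Z → E} (hu : Measurable u) (hv : Measurable v) :
    Measurable fun z => degKernel P X H i k (u z) (v z) :=
  (((hH.comp hu hv).sub ((measurable_Hhat hX hH k).comp hu)).sub
    ((measurable_Hhat hX hH i).comp hv)).add_const _

/-- Only the two marginals under `Q` and the norm of `H` itself matter. The general `Q` covers both
the law of the sample and the partly decoupled law used below. -/
lemma eLpNorm_degKernel_le (hX : ∀ i, Measurable (X i)) (hH : IsKernel P X H) {i k : I}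
    (hik : i ≠ k) {Z : Type*} [MeasurableSpace Z] {Q : Measure Z} [IsProbabilityMeasure Q]
    {u v : Z → E} (hu : Measurable u) (hv : Measurable v) (hmu : Q.map u = P.map (X i))
    (hmv : Q.map v = P.map (X k)) {p : ℝ} (hp : 1 ≤ p)
    (hM : eLpNorm (fun z => H (u z) (v z)) (ENNReal.ofReal p) Q ≤ momentSup P X H p) :
    eLpNorm (fun z => degKernel P X H i k (u z) (v z)) (ENNReal.ofReal p) Q ≤
      4 * momentSup P X H p := by
  have hp1 : (1 : ℝ≥0∞) ≤ ENNReal.ofReal p := by simpa using hp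
  have m1 := (hH.comp hu hv).aestronglyMeasurable (μ := Q)
  have m2 := ((measurable_Hhat hX hH k).comp hu).aestronglyMeasurable (μ := Q)
  have m3 := ((measurable_Hhat hX hH i).comp hv).aestronglyMeasurable (μ := Q)
  have b2 : eLpNorm (Hhat P X H k ∘ u) (ENNReal.ofReal p) Q ≤ momentSup P X H p := by
    rw [← eLpNorm_map_measure (measurable_Hhat hX hH k).aestronglyMeasurable hu.aemeasurable, hmu]
    exact eLpNorm_Hhat_le hX hH hik hp
  have b3 : eLpNorm (Hhat P X H i ∘ v) (ENNReal.ofReal p) Q ≤ momentSup P X H p := by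
    rw [← eLpNorm_map_measure (measurable_Hhat hX hH i).aestronglyMeasurable hv.aemeasurable, hmv]
    exact eLpNorm_Hhat_le hX hH hik.symm hp
  have b4 : eLpNorm (fun _ : Z => theta P X H i k) (ENNReal.ofReal p) Q ≤ momentSup P X H p := by
    rw [eLpNorm_const _ (by simp; linarith) (NeZero.ne Q)]
    simpa using enorm_theta_le hX hH hik hp
  calc _ ≤ ((momentSup P X H p + momentSup P X H p) + momentSup P X H p) + momentSup P X H p := by
        refine (eLpNorm_add_le ((m1.sub m2).sub m3) aestronglyMeasurable_const hp1).trans ?_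
        refine add_le_add ((eLpNorm_sub_le (m1.sub m2) m3 hp1).trans ?_) b4
        exact add_le_add ((eLpNorm_sub_le m1 m2 hp1).trans (add_le_add hM b2)) b3
    _ = _ := by ring

/-- Complete degeneracy, the reason isolated indices contribute nothing after decoupling. It holds
only for almost every `y`, since Fubini gives integrability of the section `H · y` only almost
everywhere. -/
lemma integral_degKernel_eq_zero (hX : ∀ i, Measurable (X i)) (hH : IsKernel P X H) {i k : I}
    (hik : i ≠ k) : ∀ᵐ y ∂(P.map (X k)), ∫ x, degKernel P X H i k x y ∂(P.map (X i)) = 0 := by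
  have := isProbabilityMeasure_law (P := P) hX i
  have := isProbabilityMeasure_law (P := P) hX k
  filter_upwards [(integrable_kernel_prod hX hH hik).prod_left_ae] with y hy
  have h1 := integrable_Hhat hX hH hik
  have h12 : Integrable (fun x => H x y - Hhat P X H k x) (P.map (X i)) := hy.sub h1
  have h123 : Integrable (fun x => H x y - Hhat P X H k x - Hhat P X H i y) (P.map (X i)) :=
    h12.sub (integrable_const _)
  unfold degKernel
  rw [integral_add h123 (integrable_const _), integral_sub h12 (integrable_const _), integral_sub hy h1, ← theta_eq hX hH,
    Hhat_eq hX hH]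
  simp [hH.2.1 y]

end Moments

/-! ### The Hoeffding decomposition -/

section Hoeffding

variable {Ω I E : Type*} [MeasurableSpace E] {X : I → Ω → E}

lemma measurable_sigmaGen {J : Finset I} {i : I} (hi : i ∈ J) : Measurable[sigmaGen X J] (X i) :=
  Measurable.of_comap_le (le_iSup₂_of_le i hi le_rfl)

variable [MeasurableSpace Ω] {P : Measure Ω} {H : E → E → ℝ}

lemma sigmaGen_le (hX : ∀ i, Measurable (X i)) (J : Finset I) :
    sigmaGen X J ≤ ‹MeasurableSpace Ω› :=
  iSup₂_le fun i _ => (hX i).comap_le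

lemma IsBetaMixing.betaCoeff_le [EMetricSpace I] {β : ℕ∞ → ℕ∞ → ℝ≥0 → ℝ≥0∞}
    (h : IsBetaMixing P X β) {J₁ J₂ : Finset I} {n₁ n₂ : ℕ∞} {m : ℝ≥0}
    (h₁ : (J₁.card : ℕ∞) ≤ n₁) (h₂ : (J₂.card : ℕ∞) ≤ n₂)
    (hd : ∀ i ∈ J₁, ∀ j ∈ J₂, (m : ℝ≥0∞) ≤ edist i j) :
    betaCoeff P (sigmaGen X J₁) (sigmaGen X J₂) ≤ β n₁ n₂ m := by
  refine le_trans ?_ (h n₁ n₂ m)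
  have hJ : (J₁, J₂) ∈ separatedPairs I n₁ n₂ m :=
    ⟨h₁, h₂, le_iInf₂ fun i hi => le_iInf₂ fun j hj => hd i hi j hj⟩
  exact le_iSup₂_of_le (f := fun (J : Finset I × Finset I) (_ : J ∈ separatedPairs I n₁ n₂ m) =>
    betaCoeff P (sigmaGen X J.1) (sigmaGen X J.2)) (J₁, J₂) hJ le_rfl

variable [IsProbabilityMeasure P]

lemma eLpNorm_degKernel_sample_le (hX : ∀ i, Measurable (X i)) (hH : IsKernel P X H) {i k : I}
    (hik : i ≠ k) {p : ℝ} (hp : 1 ≤ p) :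
    eLpNorm (fun ω => degKernel P X H i k (X i ω) (X k ω)) (ENNReal.ofReal p) P ≤
      4 * momentSup P X H p :=
  eLpNorm_degKernel_le hX hH hik (hX i) (hX k) rfl rfl hp (eLpNorm_kernel_le hik p)

lemma ofReal_abs_integral_degKernel_mul_le_sq (hX : ∀ i, Measurable (X i)) (hH : IsKernel P X H)
    {i k j l : I} (hik : i ≠ k) (hjl : j ≠ l) :
    ENNReal.ofReal |∫ ω, degKernel P X H i k (X i ω) (X k ω) *
      degKernel P X H j l (X j ω) (X l ω) ∂P| ≤ 16 * momentSup P X H 2 ^ 2 := by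
  refine ofReal_abs_integral_le_eLpNorm.trans ((eLpNorm_one_mul_le_mul
    (measurable_degKernel hX hH i k (hX i) (hX k)).aestronglyMeasurable
    (measurable_degKernel hX hH j l (hX j) (hX l)).aestronglyMeasurable).trans ?_)
  have h1 := eLpNorm_degKernel_sample_le hX hH hik (p := 2) (by norm_num)
  have h2 := eLpNorm_degKernel_sample_le hX hH hjl (p := 2) (by norm_num)
  rw [ENNReal.ofReal_ofNat] at h1 h2
  calc _ ≤ (4 * momentSup P X H 2) * (4 * momentSup P X H 2) := mul_le_mul' h1 h2
    _ = _ := by ring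

lemma one_sub_inv_eq {δ : ℝ} (hδ : 0 < δ) : 1 - 1 / ((2 + δ) / 2) = δ / (2 + δ) := by
  field_simp; ring

/-- The variable at the isolated index `i` is decoupled from the triple at `k, j, l`, whose internal
dependence is left untouched; under the decoupled law the expectation vanishes. The constant is `4 *
(16 + 16)`. -/
lemma ofReal_abs_integral_degKernel_mul_le [EMetricSpace I] {β : ℕ∞ → ℕ∞ → ℝ≥0 → ℝ≥0∞}
    (hβ : IsBetaMixing P X β)
    (hX : ∀ i, Measurable (X i)) (hH : IsKernel P X H) (hM : momentSup P X H 2 ≠ ⊤)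
    {i k j l : I} (hik : i ≠ k) (hjl : j ≠ l) {m : ℝ≥0} (dk : (m : ℝ≥0∞) ≤ edist i k)
    (dj : (m : ℝ≥0∞) ≤ edist i j) (dl : (m : ℝ≥0∞) ≤ edist i l) {δ : ℝ} (hδ : 0 < δ) :
    ENNReal.ofReal |∫ ω, degKernel P X H i k (X i ω) (X k ω) *
      degKernel P X H j l (X j ω) (X l ω) ∂P| ≤
        128 * (momentSup P X H (2 + δ) ^ 2 * β 1 3 m ^ (δ / (2 + δ))) := by
  classical
  set J₁ : Finset I := {i}
  set J₂ : Finset I := {k, j, l}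
  set Y : Ω → E × E × E := fun ω => (X k ω, X j ω, X l ω) with hY
  have mX : Measurable[sigmaGen X J₁] (X i) := measurable_sigmaGen (by simp [J₁])
  have mY : Measurable[sigmaGen X J₂] Y := by
    refine Measurable.prodMk ?_ (Measurable.prodMk ?_ ?_) <;>
      exact measurable_sigmaGen (by simp [J₂])
  have mY' : Measurable Y := mY.mono (sigmaGen_le hX J₂) le_rfl
  have := isProbabilityMeasure_law (P := P) hX i
  have := isProbabilityMeasure_law (P := P) hX k
  have : IsProbabilityMeasure (P.map Y) := Measure.isProbabilityMeasure_map mY'.aemeasurable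
  set Q := (P.map (X i)).prod (P.map Y) with hQ
  set f : E × E × E × E → ℝ := fun z => degKernel P X H i k z.1 z.2.1
  set g : E × E × E × E → ℝ := fun z => degKernel P X H j l z.2.2.1 z.2.2.2
  have mf : Measurable f := measurable_degKernel hX hH i k (by fun_prop) (by fun_prop)
  have mg : Measurable g := measurable_degKernel hX hH j l (by fun_prop) (by fun_prop)
  have q2 : Q.map (fun z => z.2) = P.map Y := by
    rw [hQ, Measure.map_snd_prod]; simp
  have qc : ∀ (u : E × E × E → E), Measurable u →
      Q.map (fun z => u z.2) = P.map (fun ω => u (Y ω)) := fun u hu => by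
    rw [show (fun z : E × E × E × E => u z.2) = u ∘ fun z => z.2 from rfl,
      ← Measure.map_map hu measurable_snd, q2, Measure.map_map hu mY']
    rfl
  have q1 : Q.map (fun z => z.1) = P.map (X i) := by
    rw [hQ, Measure.map_fst_prod]; simp
  have q12 : Q.map (fun z => (z.1, z.2.1)) = (P.map (X i)).prod (P.map (X k)) := by
    have h := Measure.map_prod_map (P.map (X i)) (P.map Y) (f := id) (g := fun y : E × E × E => y.1)
      measurable_id measurable_fst
    rw [Measure.map_id, Measure.map_map measurable_fst mY'] at h
    exact h.symm
  -- Under `Q` the arguments of `f` are independent, whereas those of `g` keep the joint law from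
  -- the sample. Hence `momentSup` has to include both kinds of moments.
  have bf : ∀ p : ℝ, 1 ≤ p → eLpNorm f (ENNReal.ofReal p) Q ≤ 4 * momentSup P X H p := by
    intro p hp
    refine eLpNorm_degKernel_le hX hH hik (by fun_prop) (by fun_prop) q1 (qc _ measurable_fst) hp ?_
    have := eLpNorm_map_measure (μ := Q) (p := ENNReal.ofReal p)
      (f := fun z : E × E × E × E => (z.1, z.2.1))
      (g := fun z : E × E => H z.1 z.2) hH.1.aestronglyMeasurable (by fun_prop)
    rw [q12] at this
    exact this.symm.le.trans (eLpNorm_kernel_prod_le hik p)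
  have bg : ∀ p : ℝ, 1 ≤ p → eLpNorm g (ENNReal.ofReal p) Q ≤ 4 * momentSup P X H p := by
    intro p hp
    refine eLpNorm_degKernel_le hX hH hjl (by fun_prop) (by fun_prop) (qc (fun y => y.2.1) (by fun_prop))
      (qc (fun y => y.2.2) (by fun_prop)) hp ?_
    have e1 := eLpNorm_map_measure (μ := Q) (p := ENNReal.ofReal p)
      (f := fun z : E × E × E × E => z.2)
      (g := fun z : E × E × E => H z.2.1 z.2.2)
      (hH.comp (by fun_prop) (by fun_prop)).aestronglyMeasurable (by fun_prop)
    have e2 := eLpNorm_map_measure (μ := P) (p := ENNReal.ofReal p) (f := Y)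
      (g := fun z : E × E × E => H z.2.1 z.2.2)
      (hH.comp (by fun_prop) (by fun_prop)).aestronglyMeasurable mY'.aemeasurable
    rw [q2, e2] at e1
    exact e1.symm.le.trans (eLpNorm_kernel_le hjl p)
  have iQ : Integrable (fun z => f z * g z) Q := by
    rw [← memLp_one_iff_integrable]
    refine ⟨(mf.mul mg).aestronglyMeasurable, lt_of_le_of_lt
      (eLpNorm_one_mul_le_mul mf.aestronglyMeasurable mg.aestronglyMeasurable) ?_⟩
    have h1 := bf 2 (by norm_num)
    have h2 := bg 2 (by norm_num)
    rw [ENNReal.ofReal_ofNat] at h1 h2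
    refine lt_of_le_of_lt (mul_le_mul' h1 h2) (lt_top_iff_ne_top.2 ?_)
    finiteness
  have iP : Integrable (fun ω => f (X i ω, Y ω) * g (X i ω, Y ω)) P := by
    rw [← memLp_one_iff_integrable]
    have m1 := measurable_degKernel hX hH i k (hX i) (hX k)
    have m2 := measurable_degKernel hX hH j l (hX j) (hX l)
    refine ⟨(m1.mul m2).aestronglyMeasurable, lt_of_le_of_lt
      (eLpNorm_one_mul_le_mul m1.aestronglyMeasurable m2.aestronglyMeasurable) ?_⟩
    have h1 := eLpNorm_degKernel_sample_le hX hH hik (p := 2) (by norm_num)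
    have h2 := eLpNorm_degKernel_sample_le hX hH hjl (p := 2) (by norm_num)
    rw [ENNReal.ofReal_ofNat] at h1 h2
    refine lt_of_le_of_lt (mul_le_mul' h1 h2) (lt_top_iff_ne_top.2 ?_)
    finiteness
  -- The isolated variable is integrated first; `g` does not depend on it.
  have hz : ∫ z, f z * g z ∂Q = 0 := by
    rw [hQ, integral_prod_symm _ iQ]
    refine integral_eq_zero_of_ae ?_
    have hk : ∀ᵐ y ∂(P.map Y), ∫ x, degKernel P X H i k x y.1 ∂(P.map (X i)) = 0 := by
      have := integral_degKernel_eq_zero hX hH hik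
      have e : P.map (X k) = (P.map Y).map (fun y => y.1) := by
        rw [Measure.map_map measurable_fst mY']; rfl
      rw [e] at this
      exact ae_of_ae_map measurable_fst.aemeasurable this
    filter_upwards [hk] with y hy
    simp only [f, g]
    rw [integral_mul_const, hy, zero_mul]
    rfl
  have hp : (1 : ℝ) ≤ (2 + δ) / 2 := by linarith
  have hc := ofReal_abs_integral_sub_prod_le (P := P) (sigmaGen_le hX J₁) (sigmaGen_le hX J₂)
    mX mY (mf.mul mg) iP iQ hp
  have hb : betaCoeff P (sigmaGen X J₁) (sigmaGen X J₂) ≤ β 1 3 m := by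
    refine hβ.betaCoeff_le (by simp [J₁]) (by exact_mod_cast Finset.card_le_three) ?_
    intro a ha b hb
    simp only [J₁, J₂, Finset.mem_singleton, Finset.mem_insert] at ha hb
    subst ha
    rcases hb with rfl | rfl | rfl <;> assumption
  change ENNReal.ofReal |_ - ∫ z, f z * g z ∂Q| ≤ _ at hc
  rw [hz, sub_zero, one_sub_inv_eq hδ] at hc
  refine hc.trans ?_
  have h2δ : (0 : ℝ) < 2 + δ := by linarith
  have n1 : eLpNorm (fun ω => (f * g) (X i ω, Y ω)) (ENNReal.ofReal ((2 + δ) / 2)) P ≤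
      (4 * momentSup P X H (2 + δ)) * (4 * momentSup P X H (2 + δ)) :=
    (eLpNorm_mul_le_mul (measurable_degKernel hX hH i k (hX i) (hX k)).aestronglyMeasurable
      (measurable_degKernel hX hH j l (hX j) (hX l)).aestronglyMeasurable h2δ).trans
      (mul_le_mul' (eLpNorm_degKernel_sample_le hX hH hik (by linarith))
        (eLpNorm_degKernel_sample_le hX hH hjl (by linarith)))
  have n2 : eLpNorm (f * g) (ENNReal.ofReal ((2 + δ) / 2)) Q ≤
      (4 * momentSup P X H (2 + δ)) * (4 * momentSup P X H (2 + δ)) :=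
    (eLpNorm_mul_le_mul mf.aestronglyMeasurable mg.aestronglyMeasurable h2δ).trans
      (mul_le_mul' (bf _ (by linarith)) (bg _ (by linarith)))
  calc _ ≤ 4 * β 1 3 m ^ (δ / (2 + δ)) *
        ((4 * momentSup P X H (2 + δ)) * (4 * momentSup P X H (2 + δ)) +
          (4 * momentSup P X H (2 + δ)) * (4 * momentSup P X H (2 + δ))) := by
        gcongr
    _ = _ := by ring

end Hoeffding

/-! ### Second moment of the degenerate part, and moments of the projection -/

section Remainder

variable {Ω I E : Type*} [MeasurableSpace Ω] {P : Measure Ω} [MeasurableSpace E]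
  {X : I → Ω → E} {H : E → E → ℝ} [IsProbabilityMeasure P]

lemma ofReal_abs_integral_pair_le [EMetricSpace I] {β : ℕ∞ → ℕ∞ → ℝ≥0 → ℝ≥0∞}
    (hβ : IsBetaMixing P X β)
    (hX : ∀ i, Measurable (X i)) (hH : IsKernel P X H) (hM : momentSup P X H 2 ≠ ⊤)
    {m : ℝ≥0} {δ : ℝ} (hδ : 0 < δ) (a : (I × I) × (I × I)) (h1 : a.1.2 ≠ a.1.1)
    (h2 : a.2.2 ≠ a.2.1) (hN : ¬ NoIsolated m a) :
    ENNReal.ofReal |∫ ω, degKernel P X H a.1.1 a.1.2 (X a.1.1 ω) (X a.1.2 ω) *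
      degKernel P X H a.2.1 a.2.2 (X a.2.1 ω) (X a.2.2 ω) ∂P| ≤
        128 * (momentSup P X H (2 + δ) ^ 2 * β 1 3 m ^ (δ / (2 + δ))) := by
  obtain ⟨⟨i, k⟩, j, l⟩ := a
  simp only at h1 h2 ⊢
  unfold NoIsolated at hN
  push Not at hN
  obtain ⟨s, hs⟩ := hN
  have hs' : ∀ t, t ≠ s → (m : ℝ≥0∞) ≤ edist (![i, k, j, l] s) (![i, k, j, l] t) :=
    fun t ht => (hs t ht).le
  have key : ∀ {i k j l : I}, i ≠ k → j ≠ l → (m : ℝ≥0∞) ≤ edist i k → (m : ℝ≥0∞) ≤ edist i j →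
      (m : ℝ≥0∞) ≤ edist i l → ENNReal.ofReal |∫ ω, degKernel P X H i k (X i ω) (X k ω) *
      degKernel P X H j l (X j ω) (X l ω) ∂P| ≤
        128 * (momentSup P X H (2 + δ) ^ 2 * β 1 3 m ^ (δ / (2 + δ))) :=
    fun hik hjl d1 d2 d3 => ofReal_abs_integral_degKernel_mul_le hβ hX hH hM hik hjl d1 d2 d3 hδ
  -- Whichever entry is isolated, symmetry of `degKernel` and commutativity of the product bring it
  -- to the front.
  fin_cases s
  · exact key h1.symm h2.symm (hs' 1 (by decide)) (hs' 2 (by decide)) (hs' 3 (by decide))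
  · simp_rw [degKernel_symm hX hH h1.symm]
    exact key h1 h2.symm (hs' 0 (by decide)) (hs' 2 (by decide)) (hs' 3 (by decide))
  · simp_rw [mul_comm (degKernel P X H i k _ _)]
    exact key h2.symm h1.symm (hs' 3 (by decide)) (hs' 0 (by decide)) (hs' 1 (by decide))
  · simp_rw [mul_comm (degKernel P X H i k _ _), degKernel_symm hX hH h2.symm]
    exact key h2 h1.symm (hs' 2 (by decide)) (hs' 0 (by decide)) (hs' 1 (by decide))

lemma memLp_degKernel_sample (hX : ∀ i, Measurable (X i)) (hH : IsKernel P X H)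
    (hM : momentSup P X H 2 ≠ ⊤) {i k : I} (hik : i ≠ k) :
    MemLp (fun ω => degKernel P X H i k (X i ω) (X k ω)) 2 P := by
  refine ⟨(measurable_degKernel hX hH i k (hX i) (hX k)).aestronglyMeasurable, ?_⟩
  have h := eLpNorm_degKernel_sample_le hX hH hik (p := 2) (by norm_num)
  rw [ENNReal.ofReal_ofNat] at h
  exact lt_of_le_of_lt h (lt_top_iff_ne_top.2 (by finiteness))

lemma memLp_Hhat_sample (hX : ∀ i, Measurable (X i)) (hH : IsKernel P X H) {i k : I}
    (hik : i ≠ k) : MemLp (fun ω => Hhat P X H k (X i ω)) 2 P :=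
  (memLp_map_measure_iff (measurable_Hhat hX hH k).aestronglyMeasurable (hX i).aemeasurable).1
    (memLp_Hhat hX hH hik)

variable [Fintype I]

open Classical in
/-- The degenerate part of the U-statistic. -/
def degSum (P : Measure Ω) (X : I → Ω → E) (H : E → E → ℝ) (ω : Ω) : ℝ :=
  ∑ a : I × I with a.2 ≠ a.1, degKernel P X H a.1 a.2 (X a.1 ω) (X a.2 ω)

lemma measurable_degSum (hX : ∀ i, Measurable (X i)) (hH : IsKernel P X H) :
    Measurable (degSum P X H) :=
  Finset.measurable_fun_sum _ fun a _ => measurable_degKernel hX hH a.1 a.2 (hX a.1) (hX a.2)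

open Classical in
lemma sum_sum_ne_eq (f : I → I → ℝ) :
    ∑ i, ∑ k with k ≠ i, f i k = ∑ a : I × I with a.2 ≠ a.1, f a.1 a.2 := by
  simp_rw [Finset.sum_filter]
  rw [Fintype.sum_prod_type]

open Classical in
lemma sum_sum_ne_comm (f : I → I → ℝ) :
    ∑ i, ∑ k with k ≠ i, f k i = ∑ i, ∑ k with k ≠ i, f i k := by
  simp_rw [Finset.sum_filter]
  rw [Finset.sum_comm]
  simp_rw [ne_comm]

open Classical in
/-- The Hoeffding decomposition. -/
lemma uStat_sub_eq (hX : ∀ i, Measurable (X i)) (hH : IsKernel P X H)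
    (hn : 2 ≤ Fintype.card I) (ω : Ω) :
    uStat X H ω - ∑ i, ∑ k with k ≠ i, theta P X H i k =
      2 * ((Fintype.card I : ℝ) - 1) * ∑ i, proj P X H i ω + degSum P X H ω := by
  have hn1 : (Fintype.card I : ℝ) - 1 ≠ 0 := by
    have : (2 : ℝ) ≤ Fintype.card I := by exact_mod_cast hn
    linarith
  have e1 : ((Fintype.card I : ℝ) - 1) * ∑ i, proj P X H i ω =
      ∑ i, ∑ k with k ≠ i, (Hhat P X H k (X i ω) - theta P X H i k) := by
    rw [Finset.mul_sum]
    refine Finset.sum_congr rfl fun i _ => ?_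
    rw [proj, ← mul_assoc, mul_inv_cancel₀ hn1, one_mul]
  -- After relabelling, the projections onto the two arguments have the same sum; hence the factor
  -- `2` in front of the linear part.
  have e2 := sum_sum_ne_comm fun i k => Hhat P X H k (X i ω) - theta P X H i k
  have e3 : degSum P X H ω = ∑ i, ∑ k with k ≠ i, (H (X i ω) (X k ω) - theta P X H i k -
      (Hhat P X H k (X i ω) - theta P X H i k) - (Hhat P X H i (X k ω) - theta P X H k i)) := by
    rw [degSum, ← sum_sum_ne_eq fun i k => degKernel P X H i k (X i ω) (X k ω)]
    refine Finset.sum_congr rfl fun i _ => Finset.sum_congr rfl fun k hk => ?_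
    have hik : k ≠ i := (Finset.mem_filter.1 hk).2
    rw [theta_symm hX hH hik, degKernel]; ring
  rw [mul_assoc, e1, e3]
  simp only [Finset.sum_sub_distrib] at e2 ⊢
  rw [uStat]
  linarith

/-- The `L¹` norm is bounded by the `L²` norm, whose square expands over quadruples: those without
isolated entry are few and are bounded by second moments, while mixing handles all the others. -/
theorem eLpNorm_degSum_le [EMetricSpace I] {β : ℕ∞ → ℕ∞ → ℝ≥0 → ℝ≥0∞}
    (hβ : IsBetaMixing P X β)
    (hX : ∀ i, Measurable (X i)) (hH : IsKernel P X H) (hM : momentSup P X H 2 ≠ ⊤)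
    {m : ℝ≥0} {δ : ℝ} (hδ : 0 < δ) :
    eLpNorm (degSum P X H) 1 P ≤ (128 * (((tau I m [4] : ℝ≥0∞) + (tau I m [2, 2] : ℝ≥0∞)) *
      momentSup P X H 2 ^ 2 + (Fintype.card I : ℝ≥0∞) ^ 4 * (momentSup P X H (2 + δ) ^ 2 *
        β 1 3 m ^ (δ / (2 + δ))))) ^ (1 / 2 : ℝ) := by
  classical
  set D : Finset (I × I) := Finset.univ.filter fun a => a.2 ≠ a.1 with hD
  set G : I × I → Ω → ℝ := fun a ω => degKernel P X H a.1 a.2 (X a.1 ω) (X a.2 ω) with hG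
  set B := momentSup P X H (2 + δ) ^ 2 * β 1 3 m ^ (δ / (2 + δ)) with hB
  set M := momentSup P X H 2 ^ 2 with hM2
  have hne : ∀ a ∈ D, a.2 ≠ a.1 := fun a ha => (Finset.mem_filter.1 ha).2
  have hmem : ∀ a ∈ D, MemLp (G a) 2 P := fun a ha =>
    memLp_degKernel_sample hX hH hM (hne a ha).symm
  have hR : degSum P X H = fun ω => ∑ a ∈ D, G a ω := by
    funext ω
    simp only [degSum, hD, hG]
  have hRmem : MemLp (degSum P X H) 2 P := by
    rw [hR]; exact memLp_finsetSum _ hmem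
  have hsq : ∫ ω, (degSum P X H ω) ^ 2 ∂P = ∑ a ∈ D, ∑ b ∈ D, ∫ ω, G a ω * G b ω ∂P := by
    rw [hR]
    simp_rw [sq, Finset.sum_mul_sum]
    have hi : ∀ a ∈ D, ∀ b ∈ D, Integrable (fun ω => G a ω * G b ω) P := fun a ha b hb =>
      (hmem a ha).integrable_mul (hmem b hb)
    rw [integral_finsetSum _ fun a ha => integrable_finsetSum _ fun b hb => hi a ha b hb]
    exact Finset.sum_congr rfl fun a ha => integral_finsetSum _ fun b hb => hi a ha b hb
  have hpair : ∀ a ∈ D, ∀ b ∈ D, ENNReal.ofReal |∫ ω, G a ω * G b ω ∂P| ≤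
      (if NoIsolated m (a, b) then 16 * M else 0) + 128 * B := by
    intro a ha b hb
    split_ifs with h
    · exact (ofReal_abs_integral_degKernel_mul_le_sq hX hH (hne a ha).symm (hne b hb).symm).trans
        le_self_add
    · rw [zero_add]
      exact ofReal_abs_integral_pair_le hβ hX hH hM hδ (a, b) (hne a ha) (hne b hb) h
  have hle : ENNReal.ofReal (∫ ω, (degSum P X H ω) ^ 2 ∂P) ≤
      128 * (((tau I m [4] : ℝ≥0∞) + (tau I m [2, 2] : ℝ≥0∞)) * M +
        (Fintype.card I : ℝ≥0∞) ^ 4 * B) := by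
    rw [hsq]
    calc _ ≤ ENNReal.ofReal (∑ a ∈ D, ∑ b ∈ D, |∫ ω, G a ω * G b ω ∂P|) := by
          refine ENNReal.ofReal_le_ofReal (Finset.sum_le_sum fun a _ =>
            Finset.sum_le_sum fun b _ => le_abs_self _)
      _ = ∑ a ∈ D, ∑ b ∈ D, ENNReal.ofReal |∫ ω, G a ω * G b ω ∂P| := by
          rw [ENNReal.ofReal_sum_of_nonneg fun a _ => Finset.sum_nonneg fun b _ => abs_nonneg _]
          exact Finset.sum_congr rfl fun a _ =>
            ENNReal.ofReal_sum_of_nonneg fun b _ => abs_nonneg _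
      _ ≤ ∑ a ∈ D, ∑ b ∈ D, ((if NoIsolated m (a, b) then 16 * M else 0) + 128 * B) :=
          Finset.sum_le_sum fun a ha => Finset.sum_le_sum fun b hb => hpair a ha b hb
      _ ≤ ∑ a : I × I, ∑ b : I × I, ((if NoIsolated m (a, b) then 16 * M else 0) + 128 * B) :=
          (Finset.sum_le_sum fun a _ => Finset.sum_le_sum_of_subset (Finset.subset_univ _)).trans
            (Finset.sum_le_sum_of_subset (Finset.subset_univ _))
      _ = ((Finset.univ.filter fun a : (I × I) × (I × I) => NoIsolated m a).card : ℝ≥0∞) *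
            (16 * M) + (Fintype.card I : ℝ≥0∞) ^ 4 * (128 * B) := by
          rw [← Fintype.sum_prod_type' fun a b => (if NoIsolated m (a, b) then 16 * M else 0) + 128 * B,
            Finset.sum_add_distrib, ← Finset.sum_filter]
          simp only [Finset.sum_const, nsmul_eq_mul, Finset.card_univ, Fintype.card_prod]
          push_cast
          ring
      _ ≤ ((tau I m [4] : ℝ≥0∞) + (tau I m [2, 2] : ℝ≥0∞)) * (128 * M) +
            (Fintype.card I : ℝ≥0∞) ^ 4 * (128 * B) := by
          gcongr
          · exact_mod_cast card_noIsolated_le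
          · norm_num
      _ = _ := by ring
  have h2 : eLpNorm (degSum P X H) 2 P = (ENNReal.ofReal (∫ ω, (degSum P X H ω) ^ 2 ∂P)) ^ (1 / 2 : ℝ) := by
    rw [hRmem.eLpNorm_eq_integral_rpow_norm (by norm_num) (by norm_num),
      ENNReal.ofReal_rpow_of_nonneg (integral_nonneg fun _ => sq_nonneg _) (by norm_num)]
    simp
  calc _ ≤ eLpNorm (degSum P X H) 2 P :=
        eLpNorm_le_eLpNorm_of_exponent_le (by norm_num) hRmem.1
    _ ≤ _ := by rw [h2]; gcongr

open Classical in
/-- The centred projection as a function of the state. -/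
def projFun (P : Measure Ω) (X : I → Ω → E) (H : E → E → ℝ) (i : I) (x : E) : ℝ :=
  ((Fintype.card I : ℝ) - 1)⁻¹ * ∑ k with k ≠ i, (Hhat P X H k x - theta P X H i k)

lemma measurable_projFun (hX : ∀ i, Measurable (X i)) (hH : IsKernel P X H) (i : I) :
    Measurable (projFun P X H i) :=
  (Finset.measurable_fun_sum _ fun k _ => (measurable_Hhat hX hH k).sub_const _).const_mul _

lemma memLp_proj (hX : ∀ i, Measurable (X i)) (hH : IsKernel P X H) (i : I) :
    MemLp (proj P X H i) 2 P := by
  classical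
  have h : MemLp (fun ω => ∑ k with k ≠ i, (Hhat P X H k (X i ω) - theta P X H i k)) 2 P :=
    memLp_finsetSum _ fun k hk =>
      (memLp_Hhat_sample hX hH (Finset.mem_filter.1 hk).2.symm).sub (memLp_const _)
  convert h.const_mul ((Fintype.card I : ℝ) - 1)⁻¹ using 1
  funext ω
  unfold proj
  congr

lemma integral_proj (hX : ∀ i, Measurable (X i)) (hH : IsKernel P X H) (i : I) :
    ∫ ω, proj P X H i ω ∂P = 0 := by
  classical
  unfold proj
  have h1 : ∀ k ∈ Finset.univ.filter fun k => k ≠ i, Integrable (fun ω => Hhat P X H k (X i ω)) P :=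
    fun k hk => (memLp_Hhat_sample hX hH (Finset.mem_filter.1 hk).2.symm).integrable (by norm_num)
  have h2 : ∀ k ∈ Finset.univ.filter fun k => k ≠ i,
      Integrable (fun ω => Hhat P X H k (X i ω) - theta P X H i k) P :=
    fun k hk => (h1 k hk).sub (integrable_const _)
  rw [integral_const_mul, integral_finsetSum _ h2, Finset.sum_eq_zero, mul_zero]
  intro k hk
  rw [integral_sub (h1 k hk) (integrable_const _)]
  simp [theta]

/-- The projection is an average of `n - 1` centred variables, so Minkowski's inequality gives a
bound free of `n`. -/
lemma eLpNorm_proj_le (hX : ∀ i, Measurable (X i)) (hH : IsKernel P X H)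
    (hn : 2 ≤ Fintype.card I) (i : I) {p : ℝ} (hp : 1 ≤ p) :
    eLpNorm (proj P X H i) (ENNReal.ofReal p) P ≤ 2 * momentSup P X H p := by
  classical
  have hp1 : (1 : ℝ≥0∞) ≤ ENNReal.ofReal p := by simpa using hp
  set D : Finset I := Finset.univ.filter fun k => k ≠ i with hD
  have hk : ∀ k ∈ D, eLpNorm (fun ω => Hhat P X H k (X i ω) - theta P X H i k)
      (ENNReal.ofReal p) P ≤ 2 * momentSup P X H p := by
    intro k hk
    have hik : i ≠ k := (Finset.mem_filter.1 hk).2.symm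
    have m1 := ((measurable_Hhat hX hH k).comp (hX i)).aestronglyMeasurable (μ := P)
    refine (eLpNorm_sub_le m1 aestronglyMeasurable_const hp1).trans ?_
    rw [two_mul]
    refine add_le_add ?_ ?_
    · rw [← eLpNorm_map_measure (measurable_Hhat hX hH k).aestronglyMeasurable (hX i).aemeasurable]
      exact eLpNorm_Hhat_le hX hH hik hp
    · rw [eLpNorm_const _ (by simp; linarith) (NeZero.ne P)]
      simpa using enorm_theta_le hX hH hik hp
  have hsum : eLpNorm (fun ω => ∑ k ∈ D, (Hhat P X H k (X i ω) - theta P X H i k))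
      (ENNReal.ofReal p) P ≤ D.card * (2 * momentSup P X H p) := by
    have e : (fun ω => ∑ k ∈ D, (Hhat P X H k (X i ω) - theta P X H i k)) =
        ∑ k ∈ D, fun ω => (Hhat P X H k (X i ω) - theta P X H i k) := by
      funext ω; simp
    rw [e]
    refine (eLpNorm_sum_le (fun k _ => (((measurable_Hhat hX hH k).comp
      (hX i)).sub_const _).aestronglyMeasurable) hp1).trans ((Finset.sum_le_sum hk).trans ?_)
    simp
  have hcard : (D.card : ℝ) = (Fintype.card I : ℝ) - 1 := by
    rw [hD, Finset.filter_ne', Finset.card_erase_of_mem (Finset.mem_univ _), Finset.card_univ,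
      Nat.cast_sub (by omega)]
    simp
  have hpos : (0 : ℝ) < D.card := by
    rw [hcard]
    have : (2 : ℝ) ≤ Fintype.card I := by exact_mod_cast hn
    linarith
  have e : proj P X H i = (D.card : ℝ)⁻¹ • fun ω => ∑ k ∈ D, (Hhat P X H k (X i ω) - theta P X H i k) := by
    funext ω
    simp only [proj, Pi.smul_apply, smul_eq_mul, hcard]
    rfl
  rw [e, eLpNorm_const_smul]
  have e2 : ‖(D.card : ℝ)⁻¹‖ₑ = (D.card : ℝ≥0∞)⁻¹ := by
    rw [enorm_inv hpos.ne', Real.enorm_natCast]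
  have hD0 : (D.card : ℝ≥0∞) ≠ 0 := by
    have : D.card ≠ 0 := by exact_mod_cast hpos.ne'
    exact_mod_cast this
  rw [e2]
  calc _ ≤ (D.card : ℝ≥0∞)⁻¹ * (D.card * (2 * momentSup P X H p)) := by gcongr
    _ = _ := by
      rw [← mul_assoc, ENNReal.inv_mul_cancel hD0 (ENNReal.natCast_ne_top _), one_mul]

end Remainder

/-! ### Covariance inequalities -/

section Covariance

variable {Ω : Type*} {F₁ F₂ : MeasurableSpace Ω} [mΩ : MeasurableSpace Ω] {P : Measure Ω}
  [IsProbabilityMeasure P]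

/-- Decoupling applied to `(u, t) ↦ u * f t`. Since `f` is bounded by `1`, only the moment of `U`
enters, and it is the same under the joint and the product law; hence `8 = 4 * 2`. -/
lemma ofReal_abs_cov_bounded_le (h₁ : F₁ ≤ mΩ) (h₂ : F₂ ≤ mΩ) {U T : Ω → ℝ}
    (hU : Measurable[F₁] U) (hT : Measurable[F₂] T) (hi : Integrable U P) {f : ℝ → ℝ}
    (hf : Measurable f) (hb : ∀ x, |f x| ≤ 1) {p : ℝ} (hp : 1 ≤ p) :
    ENNReal.ofReal |∫ ω, U ω * f (T ω) ∂P - (∫ ω, U ω ∂P) * ∫ ω, f (T ω) ∂P| ≤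
      8 * betaCoeff P F₁ F₂ ^ (1 - 1 / p) * eLpNorm U (ENNReal.ofReal p) P := by
  have mU : Measurable U := hU.mono h₁ le_rfl
  have mT : Measurable T := hT.mono h₂ le_rfl
  have := Measure.isProbabilityMeasure_map (μ := P) mU.aemeasurable
  have := Measure.isProbabilityMeasure_map (μ := P) mT.aemeasurable
  set Q := (P.map U).prod (P.map T) with hQ
  set F : ℝ × ℝ → ℝ := fun z => z.1 * f z.2 with hF
  have mF : Measurable F := by fun_prop
  have hle : ∀ z : ℝ × ℝ, ‖F z‖ ≤ ‖z.1‖ := fun z => by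
    rw [norm_mul]
    exact mul_le_of_le_one_right (norm_nonneg _) (hb _)
  have q1 : Q.map Prod.fst = P.map U := by rw [hQ, Measure.map_fst_prod]; simp
  have iU : Integrable (fun z : ℝ × ℝ => z.1) Q := by
    have h : Integrable (fun x : ℝ => x) (Q.map Prod.fst) := by
      rw [q1]
      exact (integrable_map_measure measurable_id.aestronglyMeasurable mU.aemeasurable).2 hi
    exact (integrable_map_measure measurable_id.aestronglyMeasurable
      measurable_fst.aemeasurable).1 h
  have iQ : Integrable F Q :=
    iU.mono mF.aestronglyMeasurable (Filter.Eventually.of_forall hle)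
  have iP : Integrable (fun ω => F (U ω, T ω)) P :=
    integrable_mul_bounded hi (hf.comp mT).aestronglyMeasurable fun ω => hb _
  have h := ofReal_abs_integral_sub_prod_le (P := P) h₁ h₂ hU hT mF iP iQ hp
  have e : ∫ z, F z ∂Q = (∫ ω, U ω ∂P) * ∫ ω, f (T ω) ∂P := by
    rw [hQ, hF, integral_prod_mul (fun x : ℝ => x) f,
      integral_map (f := fun x : ℝ => x) mU.aemeasurable measurable_id.aestronglyMeasurable,
      integral_map mT.aemeasurable hf.aestronglyMeasurable]
  rw [e] at h
  refine h.trans ?_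
  have n1 : eLpNorm (fun ω => F (U ω, T ω)) (ENNReal.ofReal p) P ≤
      eLpNorm U (ENNReal.ofReal p) P := eLpNorm_mono fun ω => hle (U ω, T ω)
  have n2 : eLpNorm F (ENNReal.ofReal p) Q ≤ eLpNorm U (ENNReal.ofReal p) P := by
    have e1 := eLpNorm_map_measure (μ := Q) (p := ENNReal.ofReal p) (f := Prod.fst)
      (g := fun x : ℝ => x) measurable_id.aestronglyMeasurable measurable_fst.aemeasurable
    have e2 := eLpNorm_map_measure (μ := P) (p := ENNReal.ofReal p) (f := U)
      (g := fun x : ℝ => x) measurable_id.aestronglyMeasurable mU.aemeasurable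
    rw [q1, e2] at e1
    exact (eLpNorm_mono hle).trans e1.symm.le
  calc _ ≤ 4 * betaCoeff P F₁ F₂ ^ (1 - 1 / p) *
        (eLpNorm U (ENNReal.ofReal p) P + eLpNorm U (ENNReal.ofReal p) P) := by gcongr
    _ = _ := by ring

lemma ofReal_abs_cov_le (h₁ : F₁ ≤ mΩ) (h₂ : F₂ ≤ mΩ) {U V : Ω → ℝ}
    (hU : Measurable[F₁] U) (hV : Measurable[F₂] V) (hU2 : MemLp U 2 P) (hV2 : MemLp V 2 P)
    {q : ℝ} (hq : 2 ≤ q) :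
    ENNReal.ofReal |∫ ω, U ω * V ω ∂P - (∫ ω, U ω ∂P) * ∫ ω, V ω ∂P| ≤
      8 * betaCoeff P F₁ F₂ ^ (1 - 1 / (q / 2)) *
        (eLpNorm U (ENNReal.ofReal q) P * eLpNorm V (ENNReal.ofReal q) P) := by
  have mU : Measurable U := hU.mono h₁ le_rfl
  have mV : Measurable V := hV.mono h₂ le_rfl
  have := Measure.isProbabilityMeasure_map (μ := P) mU.aemeasurable
  have := Measure.isProbabilityMeasure_map (μ := P) mV.aemeasurable
  set Q := (P.map U).prod (P.map V) with hQ
  have q1 : Q.map Prod.fst = P.map U := by rw [hQ, Measure.map_fst_prod]; simp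
  have q2 : Q.map Prod.snd = P.map V := by rw [hQ, Measure.map_snd_prod]; simp
  have mid : ∀ μ : Measure ℝ, AEStronglyMeasurable (fun x : ℝ => x) μ :=
    fun μ => measurable_id.aestronglyMeasurable
  have iU : Integrable (fun x : ℝ => x) (P.map U) :=
    (integrable_map_measure (mid _) mU.aemeasurable).2 (hU2.integrable (by norm_num))
  have iV : Integrable (fun x : ℝ => x) (P.map V) :=
    (integrable_map_measure (mid _) mV.aemeasurable).2 (hV2.integrable (by norm_num))
  have h := ofReal_abs_integral_sub_prod_le (P := P) h₁ h₂ hU hV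
    (F := fun z : ℝ × ℝ => z.1 * z.2) (by fun_prop) (hU2.integrable_mul hV2) (iU.mul_prod iV)
    (p := q / 2) (by linarith)
  have e : ∫ z : ℝ × ℝ, z.1 * z.2 ∂Q = (∫ ω, U ω ∂P) * ∫ ω, V ω ∂P := by
    rw [hQ, integral_prod_mul (fun x : ℝ => x) (fun x : ℝ => x),
      integral_map mU.aemeasurable (mid _), integral_map mV.aemeasurable (mid _)]
  rw [e] at h
  refine h.trans ?_
  have hq0 : 0 < q := by linarith
  have n1 : eLpNorm (fun ω => U ω * V ω) (ENNReal.ofReal (q / 2)) P ≤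
      eLpNorm U (ENNReal.ofReal q) P * eLpNorm V (ENNReal.ofReal q) P :=
    eLpNorm_mul_le_mul mU.aestronglyMeasurable mV.aestronglyMeasurable hq0
  have n2 : eLpNorm (fun z : ℝ × ℝ => z.1 * z.2) (ENNReal.ofReal (q / 2)) Q ≤
      eLpNorm U (ENNReal.ofReal q) P * eLpNorm V (ENNReal.ofReal q) P := by
    refine (eLpNorm_mul_le_mul measurable_fst.aestronglyMeasurable
      measurable_snd.aestronglyMeasurable hq0).trans (le_of_eq ?_)
    have e1 := eLpNorm_map_measure (μ := Q) (p := ENNReal.ofReal q) (f := Prod.fst)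
      (g := fun x : ℝ => x) (mid _) measurable_fst.aemeasurable
    have e2 := eLpNorm_map_measure (μ := P) (p := ENNReal.ofReal q) (f := U)
      (g := fun x : ℝ => x) (mid _) mU.aemeasurable
    have e3 := eLpNorm_map_measure (μ := Q) (p := ENNReal.ofReal q) (f := Prod.snd)
      (g := fun x : ℝ => x) (mid _) measurable_snd.aemeasurable
    have e4 := eLpNorm_map_measure (μ := P) (p := ENNReal.ofReal q) (f := V)
      (g := fun x : ℝ => x) (mid _) mV.aemeasurable
    rw [q1, e2] at e1
    rw [q2, e4] at e3
    exact congrArg₂ (· * ·) e1.symm e3.symm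
  calc _ ≤ 4 * betaCoeff P F₁ F₂ ^ (1 - 1 / (q / 2)) *
        (eLpNorm U (ENNReal.ofReal q) P * eLpNorm V (ENNReal.ofReal q) P +
          eLpNorm U (ENNReal.ofReal q) P * eLpNorm V (ENNReal.ofReal q) P) := by gcongr
    _ = _ := by ring

end Covariance

/-! ### Normal approximation of the projection and of the U-statistic -/

section Projection

variable {Ω I E : Type*} [MeasurableSpace Ω] {P : Measure Ω} [MeasurableSpace E]
  {X : I → Ω → E} {H : E → E → ℝ} [Fintype I]

/-- The standardised summands of the projection. -/
def stdProj (P : Measure Ω) (X : I → Ω → E) (H : E → E → ℝ) (i : I) (ω : Ω) : ℝ :=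
  (nu P X H)⁻¹ * proj P X H i ω

variable [IsProbabilityMeasure P]

lemma measurable_stdProj (hX : ∀ i, Measurable (X i)) (hH : IsKernel P X H) {J : Finset I} {i : I}
    (hi : i ∈ J) : Measurable[sigmaGen X J] (stdProj P X H i) :=
  ((measurable_projFun hX hH i).const_mul (nu P X H)⁻¹).comp (measurable_sigmaGen hi)

lemma measurable_sum_stdProj (hX : ∀ i, Measurable (X i)) (hH : IsKernel P X H) (J : Finset I) :
    Measurable[sigmaGen X J] fun ω => ∑ j ∈ J, stdProj P X H j ω := by
  have h := fun j (hj : j ∈ J) => measurable_stdProj hX hH hj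
  let _ : MeasurableSpace Ω := sigmaGen X J
  exact Finset.measurable_fun_sum J h

lemma memLp_stdProj (hX : ∀ i, Measurable (X i)) (hH : IsKernel P X H) (i : I) :
    MemLp (stdProj P X H i) 2 P := (memLp_proj hX hH i).const_mul _

lemma integral_stdProj (hX : ∀ i, Measurable (X i)) (hH : IsKernel P X H) (i : I) :
    ∫ ω, stdProj P X H i ω ∂P = 0 := by
  unfold stdProj
  rw [integral_const_mul, integral_proj hX hH, mul_zero]

lemma eLpNorm_stdProj_le (hX : ∀ i, Measurable (X i)) (hH : IsKernel P X H)
    (hn : 2 ≤ Fintype.card I) (hν : 0 < nu P X H) (i : I) {p : ℝ} (hp : 1 ≤ p) :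
    eLpNorm (stdProj P X H i) (ENNReal.ofReal p) P ≤
      2 * (momentSup P X H p / ENNReal.ofReal (nu P X H)) := by
  have e : stdProj P X H i = (nu P X H)⁻¹ • proj P X H i := rfl
  rw [e, eLpNorm_const_smul, enorm_inv hν.ne', Real.enorm_eq_ofReal hν.le]
  calc _ ≤ (ENNReal.ofReal (nu P X H))⁻¹ * (2 * momentSup P X H p) := by
        gcongr
        exact eLpNorm_proj_le hX hH hn i hp
    _ = _ := by rw [div_eq_mul_inv]; ring

/-- The projections are centred, so `nu ^ 2` is the second moment of their sum. -/
lemma integral_sq_sum_stdProj (hX : ∀ i, Measurable (X i)) (hH : IsKernel P X H)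
    (hν : 0 < nu P X H) : ∫ ω, (∑ i, stdProj P X H i ω) ^ 2 ∂P = 1 := by
  have hm : MemLp (fun ω => ∑ i, proj P X H i ω) 2 P :=
    memLp_finsetSum _ fun i _ => memLp_proj hX hH i
  have h0 : ∫ ω, ∑ i, proj P X H i ω ∂P = 0 := by
    rw [integral_finsetSum _ fun i _ => (memLp_proj hX hH i).integrable (by norm_num)]
    exact Finset.sum_eq_zero fun i _ => integral_proj hX hH i
  have hv : variance (fun ω => ∑ i, proj P X H i ω) P = ∫ ω, (∑ i, proj P X H i ω) ^ 2 ∂P := by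
    rw [variance_eq_integral hm.1.aemeasurable, h0]
    simp
  have hν2 : nu P X H ^ 2 = ∫ ω, (∑ i, proj P X H i ω) ^ 2 ∂P := by
    rw [← hv, nu, Real.sq_sqrt (variance_nonneg _ _)]
  simp_rw [stdProj, ← Finset.mul_sum, mul_pow]
  rw [integral_const_mul, ← hν2, inv_pow, inv_mul_cancel₀ (by positivity)]

variable [EMetricSpace I] {β : ℕ∞ → ℕ∞ → ℝ≥0 → ℝ≥0∞} {m : ℝ≥0} {δ : ℝ}

open Classical in
lemma ofReal_abs_integral_stdProj_mul_le (hβ : IsBetaMixing P X β)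
    (hX : ∀ i, Measurable (X i)) (hH : IsKernel P X H) (hn : 2 ≤ Fintype.card I)
    (hν : 0 < nu P X H) (hδ : 0 < δ) (i : I) {f : ℝ → ℝ} (hf : Measurable f)
    (hb : ∀ x, |f x| ≤ 1) :
    ENNReal.ofReal |∫ ω, stdProj P X H i ω * f (∑ j ∈ (ball m i)ᶜ, stdProj P X H j ω) ∂P| ≤
      16 * (momentSup P X H (1 + δ) / ENNReal.ofReal (nu P X H) * β 1 ⊤ m ^ (δ / (1 + δ))) := by
  have h := ofReal_abs_cov_bounded_le (P := P) (sigmaGen_le hX {i}) (sigmaGen_le hX (ball m i)ᶜ)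
    (measurable_stdProj hX hH (Finset.mem_singleton_self i)) (measurable_sum_stdProj hX hH _)
    ((memLp_stdProj hX hH i).integrable (by norm_num)) hf hb (p := 1 + δ) (by linarith)
  rw [integral_stdProj hX hH, zero_mul, sub_zero] at h
  have hc : betaCoeff P (sigmaGen X {i}) (sigmaGen X (ball m i)ᶜ) ≤ β 1 ⊤ m := by
    refine hβ.betaCoeff_le (by simp) le_top fun a ha b hb => ?_
    rw [Finset.mem_singleton.1 ha]
    rw [Finset.mem_compl, mem_ball, not_le] at hb
    exact hb.le
  have e : 1 - 1 / (1 + δ) = δ / (1 + δ) := by field_simp; ring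
  rw [e] at h
  refine h.trans ?_
  calc _ ≤ 8 * β 1 ⊤ m ^ (δ / (1 + δ)) *
        (2 * (momentSup P X H (1 + δ) / ENNReal.ofReal (nu P X H))) := by
        gcongr
        exact eLpNorm_stdProj_le hX hH hn hν i (by linarith)
    _ = _ := by ring

lemma ofReal_abs_integral_stdProj_pair_le (hβ : IsBetaMixing P X β)
    (hX : ∀ i, Measurable (X i)) (hH : IsKernel P X H) (hn : 2 ≤ Fintype.card I)
    (hν : 0 < nu P X H) (hδ : 0 < δ) {i j : I} (hij : (m : ℝ≥0∞) ≤ edist i j) :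
    ENNReal.ofReal |∫ ω, stdProj P X H i ω * stdProj P X H j ω ∂P| ≤
      32 * ((momentSup P X H (2 + δ) / ENNReal.ofReal (nu P X H)) ^ 2 *
        β 1 1 m ^ (δ / (2 + δ))) := by
  have h := ofReal_abs_cov_le (P := P) (sigmaGen_le hX {i}) (sigmaGen_le hX {j})
    (measurable_stdProj hX hH (Finset.mem_singleton_self i))
    (measurable_stdProj hX hH (Finset.mem_singleton_self j))
    (memLp_stdProj hX hH i) (memLp_stdProj hX hH j) (q := 2 + δ) (by linarith)
  rw [integral_stdProj hX hH, zero_mul, sub_zero, one_sub_inv_eq hδ] at h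
  have hc : betaCoeff P (sigmaGen X {i}) (sigmaGen X {j}) ≤ β 1 1 m := by
    refine hβ.betaCoeff_le (by simp) (by simp) fun a ha b hb => ?_
    rw [Finset.mem_singleton.1 ha, Finset.mem_singleton.1 hb]
    exact hij
  refine h.trans ?_
  calc _ ≤ 8 * β 1 1 m ^ (δ / (2 + δ)) *
        ((2 * (momentSup P X H (2 + δ) / ENNReal.ofReal (nu P X H))) *
          (2 * (momentSup P X H (2 + δ) / ENNReal.ofReal (nu P X H)))) := by
        gcongr
        · exact eLpNorm_stdProj_le hX hH hn hν i (by linarith)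
        · exact eLpNorm_stdProj_le hX hH hn hν j (by linarith)
    _ = _ := by ring

open Classical in
lemma ofReal_abs_cov_stdProj_pair_le (hβ : IsBetaMixing P X β)
    (hX : ∀ i, Measurable (X i)) (hH : IsKernel P X H) (hn : 2 ≤ Fintype.card I)
    (hν : 0 < nu P X H) (hδ : 0 < δ) (i j : I) {f : ℝ → ℝ} (hf : Measurable f)
    (hb : ∀ x, |f x| ≤ 1) :
    ENNReal.ofReal |∫ ω, stdProj P X H i ω * stdProj P X H j ω *
        f (∑ k ∈ (ball m i ∪ ball m j)ᶜ, stdProj P X H k ω) ∂P -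
      (∫ ω, stdProj P X H i ω * stdProj P X H j ω ∂P) *
        ∫ ω, f (∑ k ∈ (ball m i ∪ ball m j)ᶜ, stdProj P X H k ω) ∂P| ≤
      32 * ((momentSup P X H (2 + δ) / ENNReal.ofReal (nu P X H)) ^ 2 *
        β 2 ⊤ m ^ (δ / (2 + δ))) := by
  have mi := measurable_stdProj hX hH (P := P) (H := H) (J := {i, j}) (i := i) (by simp)
  have mj := measurable_stdProj hX hH (P := P) (H := H) (J := {i, j}) (i := j) (by simp)
  have h := ofReal_abs_cov_bounded_le (P := P) (sigmaGen_le hX {i, j})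
    (sigmaGen_le hX (ball m i ∪ ball m j)ᶜ)
    (mi.mul mj) (measurable_sum_stdProj hX hH _)
    ((memLp_stdProj hX hH i).integrable_mul (memLp_stdProj hX hH j)) hf hb
    (p := (2 + δ) / 2) (by linarith)
  rw [one_sub_inv_eq hδ] at h
  have hc : betaCoeff P (sigmaGen X {i, j}) (sigmaGen X (ball m i ∪ ball m j)ᶜ) ≤ β 2 ⊤ m := by
    refine hβ.betaCoeff_le (by exact_mod_cast Finset.card_le_two) le_top fun a ha b hb => ?_
    rw [Finset.mem_compl, Finset.mem_union, not_or, mem_ball, mem_ball, not_le, not_le] at hb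
    rw [Finset.mem_insert, Finset.mem_singleton] at ha
    rcases ha with rfl | rfl
    · exact hb.1.le
    · exact hb.2.le
  refine h.trans ?_
  calc _ ≤ 8 * β 2 ⊤ m ^ (δ / (2 + δ)) *
        ((2 * (momentSup P X H (2 + δ) / ENNReal.ofReal (nu P X H))) *
          (2 * (momentSup P X H (2 + δ) / ENNReal.ofReal (nu P X H)))) := by
        gcongr
        refine (eLpNorm_mul_le_mul (memLp_stdProj hX hH i).1 (memLp_stdProj hX hH j).1
          (by linarith)).trans (mul_le_mul' ?_ ?_)
        · exact eLpNorm_stdProj_le hX hH hn hν i (by linarith)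
        · exact eLpNorm_stdProj_le hX hH hn hν j (by linarith)
    _ = _ := by ring

lemma integral_abs_cube_le {Z : Type*} [MeasurableSpace Z] {Q : Measure Z} {f : Z → ℝ} {s : ℝ}
    (hs : 0 ≤ s) (hf : MemLp f 3 Q) (h : eLpNorm f 3 Q ≤ ENNReal.ofReal s) :
    ∫ z, |f z| ^ 3 ∂Q ≤ s ^ 3 := by
  rw [hf.eLpNorm_eq_integral_rpow_norm (by norm_num) (by norm_num),
    ENNReal.ofReal_le_ofReal_iff hs] at h
  have h0 : 0 ≤ ∫ z, |f z| ^ 3 ∂Q := integral_nonneg fun z => by positivity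
  simp only [Real.norm_eq_abs, ENNReal.toReal_ofNat] at h
  have e : ∫ z, |f z| ^ (3 : ℝ) ∂Q = ∫ z, |f z| ^ 3 ∂Q := by
    congr 1; funext z; exact_mod_cast Real.rpow_natCast _ 3
  rw [e] at h
  calc ∫ z, |f z| ^ 3 ∂Q = ((∫ z, |f z| ^ 3 ∂Q) ^ (3 : ℝ)⁻¹) ^ 3 := by
        rw [← Real.rpow_natCast, ← Real.rpow_mul h0]; norm_num
    _ ≤ s ^ 3 := by gcongr

/-- The Stein bound fed with the mixing estimates, balls of radius `m` serving as neighbourhoods.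
The terms are assumed finite because that bound takes real constants; their coefficients are
nonzero, so each `Bᵢ` and `S` is finite as well. -/
theorem ofReal_abs_integral_sum_stdProj_sub_le (hβ : IsBetaMixing P X β)
    (hX : ∀ i, Measurable (X i)) (hH : IsKernel P X H) (hn : 2 ≤ Fintype.card I)
    (hν : 0 < nu P X H) (hδ : 0 < δ) {t₂ t₃ t₄ t₅ : ℝ≥0∞}
    (ht₂ : (Fintype.card I : ℝ≥0∞) * (momentSup P X H (1 + δ) / ENNReal.ofReal (nu P X H) *
      β 1 ⊤ m ^ (δ / (1 + δ))) = t₂)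
    (ht₃ : (Fintype.card I : ℝ≥0∞) ^ 2 * ((momentSup P X H (2 + δ) /
      ENNReal.ofReal (nu P X H)) ^ 2 * β 1 1 m ^ (δ / (2 + δ))) = t₃)
    (ht₄ : (tau I m [2] : ℝ≥0∞) * ((momentSup P X H (2 + δ) /
      ENNReal.ofReal (nu P X H)) ^ 2 * β 2 ⊤ m ^ (δ / (2 + δ))) = t₄)
    (ht₅ : (tau I m [3] : ℝ≥0∞) * (momentSup P X H 3 / ENNReal.ofReal (nu P X H)) ^ 3 = t₅)
    (h₂ : t₂ ≠ ⊤) (h₃ : t₃ ≠ ⊤) (h₄ : t₄ ≠ ⊤) (h₅ : t₅ ≠ ⊤)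
    {g : ℝ → ℝ} (hg : LipschitzWith 1 g) :
    ENNReal.ofReal |∫ ω, g (∑ i, stdProj P X H i ω) ∂P - ∫ x, g x ∂(gaussianReal 0 1)| ≤
      ENNReal.ofReal steinConst * (32 * (t₂ + t₃ + t₄ + t₅)) := by
  classical
  have hI : Nonempty I := Fintype.card_pos_iff.1 (by omega)
  have c1 : (Fintype.card I : ℝ≥0∞) ≠ 0 := by exact_mod_cast Fintype.card_ne_zero
  have c2 : (tau I m [2] : ℝ≥0∞) ≠ 0 := by exact_mod_cast (tau_singleton_pos two_pos).ne'
  have c3 : (tau I m [3] : ℝ≥0∞) ≠ 0 := by exact_mod_cast (tau_singleton_pos three_pos).ne'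
  set B₁ := momentSup P X H (1 + δ) / ENNReal.ofReal (nu P X H) * β 1 ⊤ m ^ (δ / (1 + δ))
  set B₂ := (momentSup P X H (2 + δ) / ENNReal.ofReal (nu P X H)) ^ 2 * β 1 1 m ^ (δ / (2 + δ))
  set B₃ := (momentSup P X H (2 + δ) / ENNReal.ofReal (nu P X H)) ^ 2 * β 2 ⊤ m ^ (δ / (2 + δ))
  set S := momentSup P X H 3 / ENNReal.ofReal (nu P X H)
  have f1 : B₁ ≠ ⊤ := fun h => h₂ (by rw [← ht₂, h, ENNReal.mul_top c1])
  have f2 : B₂ ≠ ⊤ := fun h => h₃ (by rw [← ht₃, h, ENNReal.mul_top (pow_ne_zero 2 c1)])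
  have f3 : B₃ ≠ ⊤ := fun h => h₄ (by rw [← ht₄, h, ENNReal.mul_top c2])
  have f4 : S ≠ ⊤ := fun h => h₅ (by rw [← ht₅, h, ENNReal.top_pow three_ne_zero, ENNReal.mul_top c3])
  set s : ℝ := 2 * S.toReal with hs
  have hsS : ENNReal.ofReal s = 2 * S := by
    rw [hs, ENNReal.ofReal_mul (by norm_num), ENNReal.ofReal_toReal f4, ENNReal.ofReal_ofNat]
  have hs0 : 0 ≤ s := by positivity
  have h3 : ∀ i, eLpNorm (stdProj P X H i) 3 P ≤ ENNReal.ofReal s := fun i => by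
    have := eLpNorm_stdProj_le hX hH hn hν i (p := 3) (by norm_num)
    rw [ENNReal.ofReal_ofNat] at this
    rw [hsS]; exact this
  have hmem : ∀ i, MemLp (stdProj P X H i) 3 P := fun i =>
    ⟨(memLp_stdProj hX hH i).1, lt_of_le_of_lt (h3 i) ENNReal.ofReal_lt_top⟩
  have hvar := integral_sq_sum_stdProj hX hH hν
  -- A zero third-moment bound would make every summand vanish almost surely, against unit variance.
  have hspos : 0 < s := by
    refine lt_of_le_of_ne hs0 fun h => ?_
    have hz : ∀ i, stdProj P X H i =ᵐ[P] 0 := fun i => by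
      have := h3 i
      rw [← h, ENNReal.ofReal_zero, nonpos_iff_eq_zero] at this
      exact (eLpNorm_eq_zero_iff (hmem i).1 (by norm_num)).1 this
    have hz' : ∫ ω, (∑ i, stdProj P X H i ω) ^ 2 ∂P = 0 := by
      refine integral_eq_zero_of_ae ?_
      filter_upwards [ae_all_iff.2 hz] with ω hω
      simp [hω]
    rw [hvar] at hz'
    exact one_ne_zero hz'
  have toR : ∀ {x : ℝ} {c B : ℝ≥0∞}, c * B ≠ ⊤ → ENNReal.ofReal |x| ≤ c * B →
      |x| ≤ (c * B).toReal := fun hB h => (ENNReal.ofReal_le_iff_le_toReal hB).1 h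
  have key := abs_integral_sub_gaussian_le (P := P) (ξ := stdProj P X H)
    (b₁ := (16 * B₁).toReal) (b₂ := (32 * B₂).toReal) (b₃ := (32 * B₃).toReal)
    (ball m) hspos hmem (fun i => integral_abs_cube_le hs0 (hmem i) (h3 i)) hvar
    (fun i f hf hb => toR (by finiteness) (by
      convert ofReal_abs_integral_stdProj_mul_le hβ hX hH hn hν hδ i hf hb))
    (fun i j hj => toR (by finiteness)
      (ofReal_abs_integral_stdProj_pair_le hβ hX hH hn hν hδ (by
        rw [Finset.mem_compl, mem_ball, not_le] at hj; exact hj.le)))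
    ENNReal.toReal_nonneg
    (fun i j _ f hf hb => toR (by finiteness) (by
      convert ofReal_abs_cov_stdProj_pair_le hβ hX hH hn hν hδ i j hf hb))
    hg
  refine (ENNReal.ofReal_le_ofReal key).trans ?_
  have hK := steinConst_pos
  rw [ENNReal.ofReal_mul hK.le]
  gcongr
  have e2 : ((∑ i : I, (ball m i).card : ℕ) : ℝ≥0∞) ≤ tau I m [2] :=
    Nat.cast_le.2 (card_sum_ball_le (I := I) (m := m))
  have e3 : ((∑ i : I, ∑ j ∈ ball m i, (ball m i ∪ ball m j).card : ℕ) : ℝ≥0∞) ≤ tau I m [3] := by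
    have := card_sum_ball_union_le (I := I) (m := m)
    refine Nat.cast_le.2 (le_trans (le_of_eq ?_) this)
    congr
  have d2 : ∑ i : I, ((ball m i).card : ℝ) = ((∑ i : I, (ball m i).card : ℕ) : ℝ) := by
    simp only [Nat.cast_sum]
  have d3 : (∑ i : I, ∑ j ∈ ball m i, ((ball m i ∪ ball m j).card : ℝ)) =
      ((∑ i : I, ∑ j ∈ ball m i, (ball m i ∪ ball m j).card : ℕ) : ℝ) := by
    simp only [Nat.cast_sum]
  rw [d2, d3]
  generalize ∑ i : I, (ball m i).card = N₂ at e2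
  generalize ∑ i : I, ∑ j ∈ ball m i, (ball m i ∪ ball m j).card = N₃ at e3
  have a1 : ENNReal.ofReal (Fintype.card I * (16 * B₁).toReal) = 16 * t₂ := by
    rw [ENNReal.ofReal_mul (Nat.cast_nonneg _), ENNReal.ofReal_natCast,
      ENNReal.ofReal_toReal (by finiteness), ← ht₂]
    ring
  have a2 : ENNReal.ofReal ((Fintype.card I : ℝ) ^ 2 * (32 * B₂).toReal) = 32 * t₃ := by
    rw [ENNReal.ofReal_mul (by positivity), ENNReal.ofReal_pow (by positivity),
      ENNReal.ofReal_natCast, ENNReal.ofReal_toReal (by finiteness), ← ht₃]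
    ring
  have a3 : ENNReal.ofReal ((N₂ : ℝ) * (32 * B₃).toReal) ≤ 32 * t₄ := by
    rw [ENNReal.ofReal_mul (Nat.cast_nonneg _), ENNReal.ofReal_natCast,
      ENNReal.ofReal_toReal (by finiteness), ← ht₄]
    calc _ ≤ (tau I m [2] : ℝ≥0∞) * (32 * B₃) := by gcongr
      _ = _ := by ring
  have a4 : ENNReal.ofReal (3 * (N₃ : ℝ) * s ^ 3) ≤ 24 * t₅ := by
    rw [mul_assoc, ENNReal.ofReal_mul (by norm_num), ENNReal.ofReal_mul (Nat.cast_nonneg _),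
      ENNReal.ofReal_natCast, ENNReal.ofReal_pow hs0, hsS, ENNReal.ofReal_ofNat, ← ht₅]
    calc _ ≤ 3 * ((tau I m [3] : ℝ≥0∞) * (2 * S) ^ 3) := by gcongr
      _ = _ := by ring
  rw [ENNReal.ofReal_add (by positivity) (by positivity),
    ENNReal.ofReal_add (by positivity) (by positivity),
    ENNReal.ofReal_add (by positivity) (by positivity), a1, a2]
  calc _ ≤ 16 * t₂ + 32 * t₃ + 32 * t₄ + 24 * t₅ := by gcongr
    _ ≤ 32 * t₂ + 32 * t₃ + 32 * t₄ + 32 * t₅ := by gcongr <;> norm_num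
    _ = _ := by ring

end Projection

/-! ### Assembly of the Wasserstein bound -/

section Main

variable {Ω I E : Type*} [MeasurableSpace Ω] {P : Measure Ω} {X : I → Ω → E} {H : E → E → ℝ}
  [Fintype I]

/-- For `n ≥ 2` one has `2 * (n - 1) ≥ n`. -/
lemma inv_normalization_le (hn : 2 ≤ Fintype.card I) (hν : 0 < nu P X H) :
    ‖(2 * ((Fintype.card I : ℝ) - 1) * nu P X H)⁻¹‖ₑ ≤
      1 / (ENNReal.ofReal (nu P X H) * Fintype.card I) := by
  have h2 : (2 : ℝ) ≤ Fintype.card I := by exact_mod_cast hn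
  have hpos : 0 < nu P X H * Fintype.card I := by positivity
  have hle : nu P X H * Fintype.card I ≤ 2 * ((Fintype.card I : ℝ) - 1) * nu P X H := by
    nlinarith
  rw [enorm_inv (hpos.trans_le hle).ne', Real.enorm_eq_ofReal (hpos.trans_le hle).le, one_div,
    ← ENNReal.ofReal_natCast, ← ENNReal.ofReal_mul hν.le]
  exact ENNReal.inv_le_inv.2 (ENNReal.ofReal_le_ofReal hle)

variable [MeasurableSpace E] [IsProbabilityMeasure P]

lemma normalized_eq (hX : ∀ i, Measurable (X i)) (hH : IsKernel P X H)
    (hn : 2 ≤ Fintype.card I) (hν : 0 < nu P X H) (ω : Ω) :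
    normalized P X H ω = ∑ i, stdProj P X H i ω +
      (2 * ((Fintype.card I : ℝ) - 1) * nu P X H)⁻¹ * degSum P X H ω := by
  have hn1 : (Fintype.card I : ℝ) - 1 ≠ 0 := by
    have : (2 : ℝ) ≤ Fintype.card I := by exact_mod_cast hn
    linarith
  rw [normalized, uStat_sub_eq hX hH hn]
  simp_rw [stdProj, ← Finset.mul_sum]
  field_simp

lemma measurable_sum_stdProj_univ (hX : ∀ i, Measurable (X i)) (hH : IsKernel P X H) :
    Measurable fun ω => ∑ i, stdProj P X H i ω :=
  (measurable_sum_stdProj hX hH Finset.univ).mono (sigmaGen_le hX _) le_rfl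

lemma measurable_normalized (hX : ∀ i, Measurable (X i)) (hH : IsKernel P X H)
    (hn : 2 ≤ Fintype.card I) (hν : 0 < nu P X H) : Measurable (normalized P X H) := by
  rw [show normalized P X H = _ from funext (normalized_eq hX hH hn hν)]
  exact (measurable_sum_stdProj_univ hX hH).add ((measurable_degSum hX hH).const_mul _)

variable [EMetricSpace I] {β : ℕ∞ → ℕ∞ → ℝ≥0 → ℝ≥0∞} {m : ℝ≥0} {δ : ℝ}

lemma eLpNorm_normalized_sub_le (hβ : IsBetaMixing P X β)
    (hX : ∀ i, Measurable (X i)) (hH : IsKernel P X H) (hn : 2 ≤ Fintype.card I)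
    (hν : 0 < nu P X H) (hM : momentSup P X H 2 ≠ ⊤) (hδ : 0 < δ) :
    eLpNorm (fun ω => normalized P X H ω - ∑ i, stdProj P X H i ω) 1 P ≤
      12 * (1 / (ENNReal.ofReal (nu P X H) * Fintype.card I) *
        (((tau I m [4] : ℝ≥0∞) + (tau I m [2, 2] : ℝ≥0∞)) * momentSup P X H 2 ^ 2 +
          (Fintype.card I : ℝ≥0∞) ^ 4 * momentSup P X H (2 + δ) ^ 2 *
            β 1 3 m ^ (δ / (2 + δ))) ^ (1 / 2 : ℝ)) := by
  set c := (2 * ((Fintype.card I : ℝ) - 1) * nu P X H)⁻¹ with hc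
  have e : (fun ω => normalized P X H ω - ∑ i, stdProj P X H i ω) = c • degSum P X H := by
    funext ω
    rw [normalized_eq hX hH hn hν, add_sub_cancel_left]
    rfl
  have h128 : (128 : ℝ≥0∞) ^ (1 / 2 : ℝ) ≤ 12 := by
    calc (128 : ℝ≥0∞) ^ (1 / 2 : ℝ) ≤ ((12 : ℝ≥0∞) ^ (2 : ℝ)) ^ (1 / 2 : ℝ) := by
          gcongr
          rw [ENNReal.rpow_ofNat]; norm_num
      _ = 12 := by rw [← ENNReal.rpow_mul]; norm_num
  rw [e, eLpNorm_const_smul]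
  have h := eLpNorm_degSum_le (m := m) hβ hX hH hM hδ
  rw [ENNReal.mul_rpow_of_nonneg _ _ (by norm_num), ← mul_assoc] at h
  calc _ ≤ 1 / (ENNReal.ofReal (nu P X H) * Fintype.card I) * (12 * _) :=
        mul_le_mul' (inv_normalization_le hn hν) (h.trans (mul_le_mul_left h128 _))
    _ = _ := by ring

/-- The constant in the bound for the Wasserstein distance. -/
def wassersteinConst : ℝ≥0 := 12 + 32 * steinConst.toNNReal

theorem wasserstein_normalized_le (hβ : IsBetaMixing P X β)
    (hX : ∀ i, Measurable (X i)) (hH : IsKernel P X H) (hn : 2 ≤ Fintype.card I)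
    (hν : 0 < nu P X H) (hδ : 0 < δ) :
    wasserstein (P.map (normalized P X H)) (gaussianReal 0 1) ≤ wassersteinConst *
      (1 / (ENNReal.ofReal (nu P X H) * Fintype.card I) *
        (((tau I m [4] : ℝ≥0∞) + (tau I m [2, 2] : ℝ≥0∞)) * momentSup P X H 2 ^ 2 +
          (Fintype.card I : ℝ≥0∞) ^ 4 * momentSup P X H (2 + δ) ^ 2 *
            β 1 3 m ^ (δ / (2 + δ))) ^ (1 / 2 : ℝ) +
      Fintype.card I / ENNReal.ofReal (nu P X H) * momentSup P X H (1 + δ) *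
        β 1 ⊤ m ^ (δ / (1 + δ)) +
      (Fintype.card I : ℝ≥0∞) ^ 2 / ENNReal.ofReal (nu P X H) ^ 2 * momentSup P X H (2 + δ) ^ 2 *
        β 1 1 m ^ (δ / (2 + δ)) +
      (tau I m [2] : ℝ≥0∞) / ENNReal.ofReal (nu P X H) ^ 2 * momentSup P X H (2 + δ) ^ 2 *
        β 2 ⊤ m ^ (δ / (2 + δ)) +
      (tau I m [3] : ℝ≥0∞) / ENNReal.ofReal (nu P X H) ^ 3 * momentSup P X H 3 ^ 3) := by
  have hI : Nonempty I := Fintype.card_pos_iff.1 (by omega)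
  set t₁ := 1 / (ENNReal.ofReal (nu P X H) * Fintype.card I) *
        (((tau I m [4] : ℝ≥0∞) + (tau I m [2, 2] : ℝ≥0∞)) * momentSup P X H 2 ^ 2 +
          (Fintype.card I : ℝ≥0∞) ^ 4 * momentSup P X H (2 + δ) ^ 2 *
            β 1 3 m ^ (δ / (2 + δ))) ^ (1 / 2 : ℝ) with ht₁
  set t₂ := Fintype.card I / ENNReal.ofReal (nu P X H) * momentSup P X H (1 + δ) *
        β 1 ⊤ m ^ (δ / (1 + δ)) with ht₂
  set t₃ := (Fintype.card I : ℝ≥0∞) ^ 2 / ENNReal.ofReal (nu P X H) ^ 2 *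
    momentSup P X H (2 + δ) ^ 2 * β 1 1 m ^ (δ / (2 + δ)) with ht₃
  set t₄ := (tau I m [2] : ℝ≥0∞) / ENNReal.ofReal (nu P X H) ^ 2 * momentSup P X H (2 + δ) ^ 2 *
        β 2 ⊤ m ^ (δ / (2 + δ)) with ht₄
  set t₅ := (tau I m [3] : ℝ≥0∞) / ENNReal.ofReal (nu P X H) ^ 3 * momentSup P X H 3 ^ 3 with ht₅
  -- An infinite right-hand side makes the claim trivial; otherwise every term is finite, and
  -- finiteness of the moments is read off from the terms.
  by_cases htop : t₁ + t₂ + t₃ + t₄ + t₅ = ⊤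
  · have hC : (wassersteinConst : ℝ≥0∞) ≠ 0 := by
      have : wassersteinConst ≠ 0 := by unfold wassersteinConst; positivity
      exact_mod_cast this
    rw [htop, ENNReal.mul_top hC]
    exact le_top
  simp only [ENNReal.add_eq_top, not_or] at htop
  obtain ⟨⟨⟨⟨h₁, h₂⟩, h₃⟩, h₄⟩, h₅⟩ := htop
  -- An infinite second moment would make `t₁` infinite, since `tau I m [4]` is positive.
  have hM : momentSup P X H 2 ≠ ⊤ := by
    intro h
    apply h₁
    have c4 : (tau I m [4] : ℝ≥0∞) ≠ 0 := by exact_mod_cast (tau_singleton_pos four_pos).ne'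
    have c : (tau I m [4] : ℝ≥0∞) + (tau I m [2, 2] : ℝ≥0∞) ≠ 0 := by simp [c4]
    rw [ht₁, h, ENNReal.top_pow two_ne_zero, ENNReal.mul_top c, top_add,
      ENNReal.top_rpow_of_pos (by norm_num), ENNReal.mul_top]
    simp [ENNReal.mul_eq_top]
  set T : Ω → ℝ := fun ω => ∑ i, stdProj P X H i ω with hT
  have hTmem : MemLp T 2 P := memLp_finsetSum _ fun i _ => memLp_stdProj hX hH i
  have hTi : Integrable T P := hTmem.integrable (by norm_num)
  have hWm := measurable_normalized hX hH hn hν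
  have hdiff := eLpNorm_normalized_sub_le (m := m) hβ hX hH hn hν hM hδ
  rw [← ht₁] at hdiff
  have hDi : Integrable (fun ω => normalized P X H ω - T ω) P := by
    rw [← memLp_one_iff_integrable]
    exact ⟨(hWm.sub (measurable_sum_stdProj_univ hX hH)).aestronglyMeasurable,
      lt_of_le_of_lt hdiff (lt_top_iff_ne_top.2 (by finiteness))⟩
  have hWi : Integrable (normalized P X H) P := by
    have := hDi.add hTi
    refine this.congr (Filter.Eventually.of_forall fun ω => ?_)
    simp
  have hlip : ∀ {g : ℝ → ℝ} {Y : Ω → ℝ}, LipschitzWith 1 g → Integrable Y P →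
      Integrable (fun ω => g (Y ω)) P := by
    intro g Y hg hY
    refine ((integrable_const |g 0|).add hY.abs).mono'
      (hg.continuous.comp_aestronglyMeasurable hY.1) (Filter.Eventually.of_forall fun ω => ?_)
    have h2 : |g (Y ω) - g 0| ≤ |Y ω| := by simpa [Real.dist_eq] using hg.dist_le_mul (Y ω) 0
    have := abs_sub_abs_le_abs_sub (g (Y ω)) (g 0)
    simp only [Real.norm_eq_abs, Pi.add_apply]
    linarith
  unfold wasserstein
  rw [if_pos ⟨(integrable_map_measure measurable_id.aestronglyMeasurable hWm.aemeasurable).2 hWi,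
    (memLp_id_gaussianReal 1).integrable (by simp)⟩]
  refine iSup₂_le fun g hg => ?_
  rw [integral_map hWm.aemeasurable hg.continuous.aestronglyMeasurable]
  have a1 : ENNReal.ofReal |∫ ω, g (normalized P X H ω) ∂P - ∫ ω, g (T ω) ∂P| ≤ 12 * t₁ := by
    rw [← integral_sub (hlip hg hWi) (hlip hg hTi)]
    refine ofReal_abs_integral_le_eLpNorm.trans ((eLpNorm_mono fun ω => ?_).trans hdiff)
    simpa [Real.dist_eq] using hg.dist_le_mul (normalized P X H ω) (T ω)
  have a2 := ofReal_abs_integral_sum_stdProj_sub_le (t₂ := t₂) (t₃ := t₃) (t₄ := t₄) (t₅ := t₅)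
    (m := m) hβ hX hH hn hν hδ
    (by rw [ht₂]; simp only [div_eq_mul_inv]; ring)
    (by rw [ht₃]; simp only [div_eq_mul_inv, ENNReal.inv_pow]; ring)
    (by rw [ht₄]; simp only [div_eq_mul_inv, ENNReal.inv_pow]; ring)
    (by rw [ht₅]; simp only [div_eq_mul_inv, ENNReal.inv_pow]; ring) h₂ h₃ h₄ h₅ hg
  calc _ ≤ ENNReal.ofReal (|∫ ω, g (normalized P X H ω) ∂P - ∫ ω, g (T ω) ∂P| +
        |∫ ω, g (T ω) ∂P - ∫ x, g x ∂(gaussianReal 0 1)|) :=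
        ENNReal.ofReal_le_ofReal (abs_sub_le _ _ _)
    _ ≤ 12 * t₁ + ENNReal.ofReal steinConst * (32 * (t₂ + t₃ + t₄ + t₅)) := by
        rw [ENNReal.ofReal_add (abs_nonneg _) (abs_nonneg _)]
        exact add_le_add a1 a2
    _ ≤ wassersteinConst * (t₁ + t₂ + t₃ + t₄ + t₅) := by
        have e : (wassersteinConst : ℝ≥0∞) = 12 + 32 * ENNReal.ofReal steinConst := by
          unfold wassersteinConst; push_cast; rfl
        rw [e, show (12 + 32 * ENNReal.ofReal steinConst) * (t₁ + t₂ + t₃ + t₄ + t₅) =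
          12 * t₁ + ENNReal.ofReal steinConst * (32 * (t₂ + t₃ + t₄ + t₅)) +
          (12 * (t₂ + t₃ + t₄ + t₅) + 32 * ENNReal.ofReal steinConst * t₁) by ring]
        exact le_self_add

end Main

end UStat

end

open UStat
theorem mainTheorem3 :
    ∃ C : ℝ≥0, ∀ (d : ℕ) (Ω : Type*) [MeasurableSpace Ω] (P : Measure Ω) [IsProbabilityMeasure P]
      (I : ℕ → Type*) [∀ n, Fintype (I n)] [∀ n, EMetricSpace (I n)]
      (X : (n : ℕ) → I n → Ω → EuclideanSpace ℝ (Fin d))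
      (H : ℕ → EuclideanSpace ℝ (Fin d) → EuclideanSpace ℝ (Fin d) → ℝ)
      (βn : ℕ → ℕ∞ → ℕ∞ → ℝ≥0 → ℝ≥0∞) (β : ℕ∞ → ℕ∞ → ℝ≥0 → ℝ≥0∞),
      (∀ n, Fintype.card (I n) = n) →
      (∀ n i, Measurable (X n i)) →
      (∀ n (i j : I n), i ≠ j → 1 ≤ edist i j) →
      (∀ n, IsBetaMixing P (X n) (βn n)) →
      (∀ n₁ n₂ m, β n₁ n₂ m = ⨆ n, βn n n₁ n₂ m) →
      (∀ n, IsKernel P (X n) (H n)) →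
      ∀ (δ : ℝ) (m : ℝ≥0) (n : ℕ), 0 < δ → 1 ≤ m → 2 ≤ n → 0 < nu P (X n) (H n) →
        ∀ (ν : ℝ≥0∞) (M : ℝ → ℝ≥0∞) (τ : List ℕ → ℝ≥0∞),
        ν = ENNReal.ofReal (nu P (X n) (H n)) →
        (∀ p, M p = momentSup P (X n) (H n) p) →
        (∀ L, τ L = (tau (I n) m L : ℝ≥0∞)) →
        wasserstein (P.map (normalized P (X n) (H n))) (gaussianReal 0 1) ≤
          C * (1 / (ν * n) *
                ((τ [4] + τ [2, 2]) * M 2 ^ 2 +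
                  (n : ℝ≥0∞) ^ 4 * M (2 + δ) ^ 2 * β 1 3 m ^ (δ / (2 + δ))) ^ (1 / 2 : ℝ) +
              n / ν * M (1 + δ) * β 1 ⊤ m ^ (δ / (1 + δ)) +
              (n : ℝ≥0∞) ^ 2 / ν ^ 2 * M (2 + δ) ^ 2 * β 1 1 m ^ (δ / (2 + δ)) +
              τ [2] / ν ^ 2 * M (2 + δ) ^ 2 * β 2 ⊤ m ^ (δ / (2 + δ)) +
              τ [3] / ν ^ 3 * M 3 ^ 3) := by
  refine ⟨wassersteinConst, ?_⟩
  intro d Ω _ P _ I _ _ X H βn β hcard hX _ hmix hβ hH δ m n hδ _ hn hν ν M τ hνeq hM hτ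
  -- The supremum dominates the coefficients of each single `n`, so the bound for one sample applies
  -- directly with `β`.
  have hmixβ : IsBetaMixing P (X n) β := fun n₁ n₂ r =>
    (hmix n n₁ n₂ r).trans (by rw [hβ]; exact le_iSup (fun n => βn n n₁ n₂ r) n)
  have h := wasserstein_normalized_le (m := m) hmixβ (hX n) (hH n) (by rw [hcard]; exact hn) hν hδ
  simp only [hM, hτ, hνeq]
  rw [hcard] at h
  exact h
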